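/- Let $n\ge 0$ be an integer, and let $a,i\ge 0$ be integers with $i\le\min(a-2,\,2n-a)$ and $i\equiv a \pmod 2$. A contact manifold $(M,Q)$ of dimension $2n+1$ is a smooth $(2n+1)$-dimensional manifold $M$ with a field $Q$ of tangent hyperplanes such that near every point $Q=\ker\alpha$ for a smooth $1$-form $\alpha$ with $\alpha\wedge(d\alpha)^n$ nowhere zero. A local contactomorphism $\phi:(M,Q)\to(\tilde M,\tilde Q)$ is a local diffeomorphism with $d\phi(Q)=\tilde Q$. A local contact form on an open set $U\subset M$ is a smooth $1$-form $\alpha$ on $U$ with $Q|_U=\ker\alpha$; put $\mathrm L\omega=\omega\wedge d\alpha$. A $j$-form $\pi$ on $U$ is called primitive if $j\le n$ and $\mathrm L^{n-j+1}\pi|_Q=0$. A Lefschetz decomposition over $U$ of $\omega\in\Omega^a(M)$ with respect to $\alpha$ consists of smooth primitive $j$-forms $\pi_j$ on $U$ with $$\omega|_Q=\sum_{\substack{0\le j\le \min(a,2n-a)\\ j\equiv a \bmod 2}}\mathrm L^{\frac{a-j}{2}}\pi_j|_Q .$$ Then for every contact manifold $(M,Q)$ of dimension $2n+1$, every local contact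 form $\alpha$ on an open set $U$, and every $\omega\in\Omega^a(M)$, a Lefschetz decomposition of $\omega$ over $U$ exists, and the formula $$\mathrm P_{a,i}\,\omega|_U:=\mathrm L^{\frac{a-i-2}{2}}\pi_i\wedge\alpha$$ well-defines operators $\mathrm P_{a,i}:\Omega^a(M)\to\Omega^{a-1}(M)$, independent of the choice of $U$, $\alpha$ and the decomposition. These operators are linear and commute with local contactomorphisms: $\mathrm P_{a,i}(\phi^*\omega)=\phi^*(\mathrm P_{a,i}\omega)$ for every local contactomorphism $\phi:(M,Q)\to(\tilde M,\tilde Q)$ between $(2n+1)$-dimensional contact manifolds and all $\omega\in\Omega^a(\tilde M)$. That is, there is exactly one natural linear contact morphism $\mathrm P_{a,i}:\Omega^a\to\Omega^{a-1}$ (a family of linear maps, one for each contact manifold of dimension $2n+1$, commuting with pullback under local contactomorphisms) that is given by this formula for all choices of $U$, $\alpha$ and $(\pi_j)$. -/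

import Mathlib

open scoped Manifold ContDiff Topology

noncomputable section

namespace ContactForms

/-! ### Exterior algebra of a topological vector space -/

section Algebra

variable {V : Type*} [AddCommGroup V] [Module ℝ V] [TopologicalSpace V]

/-- Transport of an alternating form along an equality of degrees. -/
def castDegree {p q : ℕ} (h : p = q) (θ : V [⋀^Fin p]→L[ℝ] ℝ) : V [⋀^Fin q]→L[ℝ] ℝ :=
  h ▸ θ

/-- The wedge product of two alternating forms as a plain alternating map:
`(θ ∧ η)(v₁, …, v_{p+q})` is the sum over all `(p,q)`-shuffles `σ` of
`sign σ * θ(v_{σ 1}, …, v_{σ p}) * η(v_{σ (p+1)}, …, v_{σ (p+q)})`. -/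
def wedgeAlternating {p q : ℕ} (θ : V [⋀^Fin p]→L[ℝ] ℝ) (η : V [⋀^Fin q]→L[ℝ] ℝ) :
    V [⋀^Fin (p + q)]→ₗ[ℝ] ℝ :=
  ((LinearMap.mul' ℝ ℝ).compAlternatingMap
    (θ.toAlternatingMap.domCoprod η.toAlternatingMap)).domDomCongr finSumFinEquiv

theorem continuous_wedgeAlternating {p q : ℕ} (θ : V [⋀^Fin p]→L[ℝ] ℝ)
    (η : V [⋀^Fin q]→L[ℝ] ℝ) : Continuous fun v => wedgeAlternating θ η v := by
  have key : ∀ σ : Equiv.Perm.ModSumCongr (Fin p) (Fin q),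
      Continuous fun v : Fin p ⊕ Fin q → V => LinearMap.mul' ℝ ℝ
        (AlternatingMap.domCoprod.summand θ.toAlternatingMap η.toAlternatingMap σ v) := by
    intro σ
    induction σ using Quotient.inductionOn' with
    | h σ =>
    have : (fun v : Fin p ⊕ Fin q → V => LinearMap.mul' ℝ ℝ
        (AlternatingMap.domCoprod.summand θ.toAlternatingMap η.toAlternatingMap
          (Quotient.mk'' σ) v)) =
        fun v => Equiv.Perm.sign σ • (θ (fun i => v (σ (Sum.inl i))) *
          η (fun i => v (σ (Sum.inr i)))) := by
      funext v
      rw [AlternatingMap.domCoprod.summand_mk'']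
      rcases Int.units_eq_one_or (Equiv.Perm.sign σ) with h | h <;> simp [h]
    rw [this]
    have h1 : Continuous fun v : Fin p ⊕ Fin q → V => θ (fun i => v (σ (Sum.inl i))) :=
      θ.cont.comp (by fun_prop)
    have h2 : Continuous fun v : Fin p ⊕ Fin q → V => η (fun i => v (σ (Sum.inr i))) :=
      η.cont.comp (by fun_prop)
    exact (h1.mul h2).const_smul _
  have h3 : (fun v => wedgeAlternating θ η v) =
      fun v : Fin (p + q) → V => ∑ σ : Equiv.Perm.ModSumCongr (Fin p) (Fin q),
        LinearMap.mul' ℝ ℝ (AlternatingMap.domCoprod.summand θ.toAlternatingMap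
          η.toAlternatingMap σ (fun i => v (finSumFinEquiv i))) := by
    funext v
    simp [wedgeAlternating, AlternatingMap.domCoprod_apply, map_sum, Function.comp_def]
  rw [h3]
  exact continuous_finsetSum _ fun σ _ => (key σ).comp (by fun_prop)

/-- The wedge product of two continuous alternating forms. -/
def wedge {p q : ℕ} (θ : V [⋀^Fin p]→L[ℝ] ℝ) (η : V [⋀^Fin q]→L[ℝ] ℝ) :
    V [⋀^Fin (p + q)]→L[ℝ] ℝ where
  toMultilinearMap := (wedgeAlternating θ η).toMultilinearMap
  map_eq_zero_of_eq' := (wedgeAlternating θ η).map_eq_zero_of_eq'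
  cont := continuous_wedgeAlternating θ η

/-- The iterated Lefschetz operator `L^k π = π ∧ Ω ∧ ⋯ ∧ Ω` (`k` factors) of a 2-form `Ω`. -/
def lefschetzPow (Ω : V [⋀^Fin 2]→L[ℝ] ℝ) {p : ℕ} (π : V [⋀^Fin p]→L[ℝ] ℝ) :
    (k : ℕ) → V [⋀^Fin (p + 2 * k)]→L[ℝ] ℝ
  | 0 => π
  | k + 1 => wedge (p := p + 2 * k) (q := 2) (lefschetzPow Ω π k) Ω

/-- The restriction of an alternating form to a linear subspace. -/
def restrictTo (W : Submodule ℝ V) {p : ℕ} (θ : V [⋀^Fin p]→L[ℝ] ℝ) : W [⋀^Fin p]→L[ℝ] ℝ :=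
  θ.compContinuousLinearMap W.subtypeL

end Algebra

/-! ### Differential forms on manifolds without boundary -/

section Forms

variable {d : ℕ}
  {M : Type*} [TopologicalSpace M] [ChartedSpace (EuclideanSpace ℝ (Fin d)) M]
  {M' : Type*} [TopologicalSpace M'] [ChartedSpace (EuclideanSpace ℝ (Fin d)) M']

variable (d M) in
/-- Fields of alternating `k`-forms on `M`, without any regularity. -/
abbrev FormField (k : ℕ) : Type _ :=
  (x : M) → TangentSpace (𝓡 d) x [⋀^Fin k]→L[ℝ] ℝ

/-- The pullback `φ^* θ`. -/
def pullbackField (φ : M → M') {k : ℕ} (θ : FormField d M' k) : FormField d M k :=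
  fun x => (θ (φ x)).compContinuousLinearMap (mfderiv (𝓡 d) (𝓡 d) φ x)

/-- The expression of a field of forms in a chart `e`, i.e. its pullback under `e⁻¹`. -/
def inChart (e : OpenPartialHomeomorph M (EuclideanSpace ℝ (Fin d))) {k : ℕ}
    (θ : FormField d M k) :
    EuclideanSpace ℝ (Fin d) → EuclideanSpace ℝ (Fin d) [⋀^Fin k]→L[ℝ] ℝ :=
  pullbackField e.symm θ

/-- `θ` is smooth on the open set `U`: its expression in every chart of the atlas is `C^∞`. -/
def IsSmoothFormOn (U : Set M) {k : ℕ} (θ : FormField d M k) : Prop :=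
  ∀ e ∈ atlas (EuclideanSpace ℝ (Fin d)) M,
    ContDiffOn ℝ ∞ (inChart e θ) (e.target ∩ e.symm ⁻¹' U)

/-- The exterior derivative: at `x` it is computed in the preferred chart at `x`. -/
def extDerivField {k : ℕ} (θ : FormField d M k) : FormField d M (k + 1) := fun x =>
  let e := chartAt (EuclideanSpace ℝ (Fin d)) x
  (extDeriv (inChart e θ) (e x)).compContinuousLinearMap (mfderiv (𝓡 d) (𝓡 d) e x)

variable (d M) in
/-- The real vector space `Ω^k(M)` of smooth differential `k`-forms on `M`. -/
def DifferentialForm (k : ℕ) : Submodule ℝ (FormField d M k) where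
  carrier := {θ | IsSmoothFormOn Set.univ θ}
  zero_mem' := fun e _ => by
    have : inChart e (0 : FormField d M k) = 0 := rfl
    rw [this]; exact contDiffOn_const
  add_mem' := fun {θ η} hθ hη e he => by
    have : inChart e (θ + η) = inChart e θ + inChart e η := rfl
    rw [this]; exact (hθ e he).add (hη e he)
  smul_mem' := fun c θ hθ e he => by
    have : inChart e (c • θ) = c • inChart e θ := rfl
    rw [this]; exact (hθ e he).const_smul c

theorem contDiff_compContinuousLinearMap {E F : Type*} [NormedAddCommGroup E] [NormedSpace ℝ E]
    [NormedAddCommGroup F] [NormedSpace ℝ F] {k : ℕ} :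
    ContDiff ℝ ∞ fun p : (F [⋀^Fin k]→L[ℝ] ℝ) × (E →L[ℝ] F) =>
      p.1.compContinuousLinearMap p.2 := by
  let S : ContinuousMultilinearMap ℝ (fun _ : Fin k => E) ℝ →L[ℝ]
      ContinuousMultilinearMap ℝ (fun _ : Fin k => E) ℝ :=
    ∑ σ : Equiv.Perm (Fin k), ((Equiv.Perm.sign σ : ℤ) : ℝ) •
      ((ContinuousMultilinearMap.domDomCongrₗᵢ ℝ E ℝ σ).toContinuousLinearEquiv :
        ContinuousMultilinearMap ℝ (fun _ : Fin k => E) ℝ →L[ℝ] _)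
  have hS : ∀ f v, S f v = ContinuousMultilinearMap.alternatization f v := by
    intro f v
    rw [ContinuousMultilinearMap.alternatization_apply_apply]
    simp only [S, sum_apply, smul_apply]
    refine Finset.sum_congr rfl fun σ _ => ?_
    rcases Int.units_eq_one_or (Equiv.Perm.sign σ) with h | h <;>
      simp only [h, Units.val_one, Units.val_neg, Int.cast_one, Int.cast_neg, one_smul, neg_smul,
        Units.neg_smul] <;>
      rfl
  let A : ContinuousMultilinearMap ℝ (fun _ : Fin k => E) ℝ →L[ℝ] (E [⋀^Fin k]→L[ℝ] ℝ) :=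
    ContinuousAlternatingMap.liftCLM S fun f v i j hv hij => by
      rw [hS]; exact (ContinuousMultilinearMap.alternatization f).map_eq_zero_of_eq v hv hij
  have hA : ∀ g : E [⋀^Fin k]→L[ℝ] ℝ,
      (Nat.factorial k : ℝ)⁻¹ • A g.toContinuousMultilinearMap = g := by
    intro g
    ext v
    have h1 : A g.toContinuousMultilinearMap v = (Nat.factorial k : ℝ) * g v := by
      change S _ v = _
      rw [hS, ContinuousMultilinearMap.alternatization_apply_apply]
      have : ∀ σ : Equiv.Perm (Fin k),
          Equiv.Perm.sign σ • g.toContinuousMultilinearMap (v ∘ σ) = g v := by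
        intro σ
        have := g.toAlternatingMap.map_perm v σ
        rcases Int.units_eq_one_or (Equiv.Perm.sign σ) with h | h <;> simp_all
      rw [Finset.sum_congr rfl fun σ _ => this σ]
      simp [Fintype.card_perm]
    have h2 : (Nat.factorial k : ℝ) ≠ 0 := by positivity
    change (Nat.factorial k : ℝ)⁻¹ * (A g.toContinuousMultilinearMap v) = g v
    rw [h1, inv_mul_cancel_left₀ h2]
  have hfun : (fun p : (F [⋀^Fin k]→L[ℝ] ℝ) × (E →L[ℝ] F) => p.1.compContinuousLinearMap p.2) =
      fun p => (Nat.factorial k : ℝ)⁻¹ • A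
        (ContinuousMultilinearMap.compContinuousLinearMapContinuousMultilinear ℝ
          (fun _ : Fin k => E) (fun _ => F) ℝ (fun _ => p.2)
          (ContinuousAlternatingMap.toContinuousMultilinearMapCLM ℝ p.1)) := by
    funext p
    exact (hA (p.1.compContinuousLinearMap p.2)).symm
  rw [hfun]
  refine ContDiff.const_smul _ (A.contDiff.comp (ContDiff.clm_apply ?_ ?_))
  · exact (ContinuousMultilinearMap.contDiff _).comp
      (contDiff_pi.2 fun _ => contDiff_snd)
  · exact (ContinuousLinearMap.contDiff _).comp contDiff_fst

theorem pullbackField_congr {φ ψ : M → M'} {x : M} (h : φ =ᶠ[𝓝 x] ψ) {k : ℕ}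
    (θ : FormField d M' k) : pullbackField φ θ x = pullbackField ψ θ x := by
  have h1 : mfderiv (𝓡 d) (𝓡 d) φ x = mfderiv (𝓡 d) (𝓡 d) ψ x := h.mfderiv_eq
  have h2 := h.eq_of_nhds
  ext v
  change θ (φ x) (fun i => mfderiv (𝓡 d) (𝓡 d) φ x (v i)) =
    θ (ψ x) (fun i => mfderiv (𝓡 d) (𝓡 d) ψ x (v i))
  rw [h1]
  generalize mfderiv (𝓡 d) (𝓡 d) ψ x = D
  change EuclideanSpace ℝ (Fin d) →L[ℝ] EuclideanSpace ℝ (Fin d) at D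
  have key : ∀ y y' : M', y = y' → ∀ w : Fin k → EuclideanSpace ℝ (Fin d),
      θ y w = θ y' w := by
    rintro y _ rfl w; rfl
  exact key _ _ h2 fun i => D (v i)

theorem pullbackField_comp {M'' : Type*} [TopologicalSpace M'']
    [ChartedSpace (EuclideanSpace ℝ (Fin d)) M''] {φ : M → M'} {ψ : M' → M''} {x : M}
    (hψ : MDifferentiableAt (𝓡 d) (𝓡 d) ψ (φ x)) (hφ : MDifferentiableAt (𝓡 d) (𝓡 d) φ x)
    {k : ℕ} (θ : FormField d M'' k) :
    pullbackField φ (pullbackField ψ θ) x = pullbackField (ψ ∘ φ) θ x := by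
  ext v
  change θ (ψ (φ x)) (fun i => mfderiv (𝓡 d) (𝓡 d) ψ (φ x) (mfderiv (𝓡 d) (𝓡 d) φ x (v i))) =
    θ (ψ (φ x)) (fun i => mfderiv (𝓡 d) (𝓡 d) (ψ ∘ φ) x (v i))
  rw [mfderiv_comp x hψ hφ]
  rfl

theorem isSmoothFormOn_pullbackField [IsManifold (𝓡 d) ∞ M] [IsManifold (𝓡 d) ∞ M']
    {φ : M → M'} (hφ : ContMDiff (𝓡 d) (𝓡 d) ∞ φ) {k : ℕ} {θ : FormField d M' k}
    (hθ : IsSmoothFormOn Set.univ θ) : IsSmoothFormOn Set.univ (pullbackField φ θ) := by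
  intro e he y hy
  have hy1 : y ∈ e.target := hy.1
  refine ContDiffAt.contDiffWithinAt ?_
  set e' := chartAt (EuclideanSpace ℝ (Fin d)) (φ (e.symm y)) with he'
  have he'M : e' ∈ atlas (EuclideanSpace ℝ (Fin d)) M' := chart_mem_atlas _ _
  have hem : e ∈ IsManifold.maximalAtlas (𝓡 d) ∞ M := IsManifold.subset_maximalAtlas he
  have hem' : e' ∈ IsManifold.maximalAtlas (𝓡 d) ∞ M' := IsManifold.subset_maximalAtlas he'M
  have hs : e' (φ (e.symm y)) ∈ e'.target := e'.map_source (mem_chart_source _ _)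
  have hcont : ContinuousAt (φ ∘ e.symm) y :=
    hφ.continuous.continuousAt.comp (e.symm.continuousAt hy1)
  have hnear : ∀ᶠ z in 𝓝 y, z ∈ e.target ∧ φ (e.symm z) ∈ e'.source :=
    (e.open_target.eventually_mem hy1).and
      (hcont.eventually (e'.open_source.eventually_mem (mem_chart_source _ _)))
  have hsmooth : ∀ z, z ∈ e.target → φ (e.symm z) ∈ e'.source →
      ContDiffAt ℝ ∞ (e' ∘ φ ∘ e.symm) z := by
    intro z hz hz'
    rw [← contMDiffAt_iff_contDiffAt]
    exact (contMDiffAt_of_mem_maximalAtlas hem' hz').comp z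
      ((hφ _).comp z (contMDiffAt_symm_of_mem_maximalAtlas hem hz))
  have heq : inChart e (pullbackField φ θ) =ᶠ[𝓝 y] fun z =>
      (inChart e' θ ((e' ∘ φ ∘ e.symm) z)).compContinuousLinearMap
        (fderiv ℝ (e' ∘ φ ∘ e.symm) z) := by
    filter_upwards [hnear.eventually_nhds] with z hz
    obtain ⟨hz1, hz2⟩ := hz.self_of_nhds
    have h1 : inChart e (pullbackField φ θ) z = pullbackField (φ ∘ e.symm) θ z :=
      pullbackField_comp ((hφ _).mdifferentiableAt (by simp))
        ((contMDiffAt_symm_of_mem_maximalAtlas hem hz1).mdifferentiableAt (by simp)) θ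
    have h2 : pullbackField (φ ∘ e.symm) θ z =
        pullbackField (e'.symm ∘ (e' ∘ φ ∘ e.symm)) θ z := by
      refine pullbackField_congr ?_ θ
      filter_upwards [hz] with w hw
      exact (e'.left_inv hw.2).symm
    have h3 : pullbackField (e' ∘ φ ∘ e.symm) (inChart e' θ) z =
        pullbackField (e'.symm ∘ (e' ∘ φ ∘ e.symm)) θ z :=
      pullbackField_comp (φ := e' ∘ φ ∘ e.symm)
        ((contMDiffAt_symm_of_mem_maximalAtlas hem'
          (e'.map_source hz2)).mdifferentiableAt (by simp))
        ((hsmooth z hz1 hz2).contMDiffAt.mdifferentiableAt (by simp)) θ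
    rw [h1, h2, ← h3]
    change ContinuousAlternatingMap.compContinuousLinearMap _ (mfderiv _ _ _ z) = _
    rw [mfderiv_eq_fderiv]
    rfl
  refine ContDiffAt.congr_of_eventuallyEq ?_ heq
  have hg : ContDiffAt ℝ ∞ (e' ∘ φ ∘ e.symm) y := hsmooth y hy1 (mem_chart_source _ _)
  have hθ' : ContDiffAt ℝ ∞ (inChart e' θ) ((e' ∘ φ ∘ e.symm) y) :=
    (hθ e' he'M).contDiffAt (by
      simpa using e'.open_target.mem_nhds hs)
  exact (contDiff_compContinuousLinearMap.contDiffAt (x := (_, _))).comp y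
    ((hθ'.comp y hg).prodMk (hg.fderiv_right (m := ∞) (by simp)))

/-- The pullback `φ^* : Ω^k(M') → Ω^k(M)` of smooth forms under a smooth map. -/
def pullback [IsManifold (𝓡 d) ∞ M] [IsManifold (𝓡 d) ∞ M'] {φ : M → M'}
    (hφ : ContMDiff (𝓡 d) (𝓡 d) ∞ φ) {k : ℕ} (θ : DifferentialForm d M' k) :
    DifferentialForm d M k :=
  ⟨pullbackField φ θ, isSmoothFormOn_pullbackField hφ θ.2⟩

end Forms
/-! ### Contact structures and the Lefschetz decomposition -/

section Contact

variable {n : ℕ} {M : Type*} [TopologicalSpace M]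
  [ChartedSpace (EuclideanSpace ℝ (Fin (2 * n + 1))) M]
  {M' : Type*} [TopologicalSpace M'] [ChartedSpace (EuclideanSpace ℝ (Fin (2 * n + 1))) M']

variable (n M) in
/-- A field of linear subspaces of the tangent spaces of a `(2n+1)`-dimensional manifold. -/
abbrev PlaneField : Type _ :=
  (x : M) → Submodule ℝ (TangentSpace (𝓡 (2 * n + 1)) x)

/-- `α` is a smooth 1-form on the open set `U` with `Q = ker α` on `U`. -/
structure IsDefiningFormOn (Q : PlaneField n M) (U : Set M) (α : FormField (2 * n + 1) M 1) :
    Prop where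
  isOpen : IsOpen U
  smooth : IsSmoothFormOn U α
  mem_iff : ∀ x ∈ U, ∀ v : TangentSpace (𝓡 (2 * n + 1)) x, v ∈ Q x ↔ α x (fun _ => v) = 0

variable (n M) in
/-- A contact structure on a `(2n+1)`-dimensional manifold `M`: a completely non-integrable field
of hyperplanes, i.e. locally the kernel of a smooth 1-form `α` such that `α ∧ (dα)^n` vanishes
nowhere. -/
structure ContactStructure where
  /-- the contact planes -/
  plane : PlaneField n M
  exists_contactForm : ∀ x : M, ∃ (U : Set M) (α : FormField (2 * n + 1) M 1), x ∈ U ∧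
    IsDefiningFormOn plane U α ∧ ∀ y ∈ U, lefschetzPow (extDerivField α y) (α y) n ≠ 0

/-- A local contactomorphism: a local diffeomorphism `φ` with `dφ(Q) = Q'`. -/
structure IsLocalContactomorphism (ξ : ContactStructure n M) (ξ' : ContactStructure n M')
    (φ : M → M') : Prop where
  isLocalDiffeomorph : IsLocalDiffeomorph (𝓡 (2 * n + 1)) (𝓡 (2 * n + 1)) ∞ φ
  map_plane : ∀ x : M, (ξ.plane x).map
    (mfderiv (𝓡 (2 * n + 1)) (𝓡 (2 * n + 1)) φ x).toLinearMap = ξ'.plane (φ x)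

/-- The `i`-form `π` is primitive on `U` with respect to the defining form `α`:
`i ≤ n` and `L^{n-i+1} π` vanishes on the contact planes. -/
def IsPrimitiveOn (ξ : ContactStructure n M) (U : Set M) (α : FormField (2 * n + 1) M 1)
    {i : ℕ} (π : FormField (2 * n + 1) M i) : Prop :=
  i ≤ n ∧ ∀ x ∈ U,
    restrictTo (ξ.plane x) (lefschetzPow (extDerivField α x) (π x) (n - i + 1)) = 0

/-- The degrees `0 ≤ i ≤ min (a, 2n - a)` with `i ≡ a mod 2`. -/
def lefschetzIndices (n a : ℕ) : Finset ℕ :=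
  {i ∈ Finset.range (a + 1) | i + a ≤ 2 * n ∧ i % 2 = a % 2}

theorem lefschetz_degree {n a : ℕ} (i : lefschetzIndices n a) :
    (i : ℕ) + 2 * ((a - i) / 2) = a := by
  have := i.2
  simp only [lefschetzIndices, Finset.mem_filter, Finset.mem_range] at this
  omega

theorem operator_degree {a i : ℕ} (hia : i + 2 ≤ a) (hmod : i % 2 = a % 2) :
    i + 2 * ((a - i - 2) / 2) + 1 = a - 1 := by
  omega

/-- `π` is a Lefschetz decomposition of the `a`-form `θ` over `U` with respect to the defining
form `α`: the `π i` are smooth primitive `i`-forms on `U`, and `θ|_Q = ∑ i, L^{(a-i)/2} (π i)|_Q`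
on `U`, where `i` runs over the degrees `0 ≤ i ≤ min (a, 2n - a)` with `i ≡ a mod 2`.
(The values of `π` in other degrees are irrelevant.) -/
structure IsLefschetzDecompositionOn (ξ : ContactStructure n M) (U : Set M)
    (α : FormField (2 * n + 1) M 1) {a : ℕ} (θ : FormField (2 * n + 1) M a)
    (π : (i : ℕ) → FormField (2 * n + 1) M i) : Prop where
  smooth : ∀ i ∈ lefschetzIndices n a, IsSmoothFormOn U (π i)
  primitive : ∀ i ∈ lefschetzIndices n a, IsPrimitiveOn ξ U α (π i)
  decomp : ∀ x ∈ U, restrictTo (ξ.plane x) (θ x) =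
    restrictTo (ξ.plane x) (∑ i : lefschetzIndices n a,
      castDegree (lefschetz_degree i)
        (lefschetzPow (extDerivField α x) (π i x) ((a - i) / 2)))

end Contact

/-- A natural linear contact morphism `Ω^a → Ω^b` in dimension `2n+1`: linear maps
`Ω^a(M) → Ω^b(M)`, one for each contact manifold `(M, ξ)` of dimension `2n+1`, which commute with
the pullback under local contactomorphisms. (No separation or countability axiom is imposed on
manifolds, so Hausdorff second countable ones are a special case.) -/
structure NaturalContactMorphism.{u} (n a b : ℕ) where
  /-- the operator on `(M, ξ)` -/
  app : ∀ (M : Type u) [TopologicalSpace M]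
    [ChartedSpace (EuclideanSpace ℝ (Fin (2 * n + 1))) M] [IsManifold (𝓡 (2 * n + 1)) ∞ M]
    (_ : ContactStructure n M),
    DifferentialForm (2 * n + 1) M a →ₗ[ℝ] DifferentialForm (2 * n + 1) M b
  naturality : ∀ (M M' : Type u)
    [TopologicalSpace M] [ChartedSpace (EuclideanSpace ℝ (Fin (2 * n + 1))) M]
    [IsManifold (𝓡 (2 * n + 1)) ∞ M]
    [TopologicalSpace M'] [ChartedSpace (EuclideanSpace ℝ (Fin (2 * n + 1))) M']
    [IsManifold (𝓡 (2 * n + 1)) ∞ M']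
    (ξ : ContactStructure n M) (ξ' : ContactStructure n M') (φ : M → M')
    (hφ : IsLocalContactomorphism ξ ξ' φ) (θ : DifferentialForm (2 * n + 1) M' a),
    app M ξ (pullback hφ.isLocalDiffeomorph.contMDiff θ) =
      pullback hφ.isLocalDiffeomorph.contMDiff (app M' ξ' θ)

end ContactForms

end

open ContactForms

universe u

open scoped Manifold ContDiff Topology

noncomputable section

set_option linter.unusedSectionVars false

/-! The heart of the matter is linear algebra in one tangent space V of dimension 2n+1, with a
1-form α and a 2-form Ω = dα such that α ∧ Ω^n ≠ 0. A form θ vanishes on Q = ker α if and only if θ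
∧ α = 0 (`restrictTo_eq_zero_iff`), so every identity on Q is replaced by the identity obtained
after multiplying with α. Products and contractions are operators on families of forms of all
degrees, and the whole calculus comes down to their commutation relations, above all [i_v, L^(m+1)]
= (m+1) (i_v Ω) ∧ L^m (`contract_mulTwo_pow`).

Modulo α, the map L^(n-k) is injective on k-forms, k ≤ n, by induction on k: contract with vectors
of Q (`IsContactPair.mulOne_eq_zero`). A dimension count gives surjectivity onto forms of degree
2n-k (`IsContactPair.exists_mulOne_eq`). Existence of the Lefschetz decomposition, and uniqueness of
its components modulo α, follow as in symplectic linear algebra.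

Two defining forms are related at each point by β = fα with f ≠ 0, and dβ = f dα on Q. If π'
decomposes ω for β, then f^((a-j)/2) π'_j decomposes it for α, whence π_i ≡ f^((a-i)/2) π'_i modulo
α. In L^((a-i-2)/2) π'_i ∧ β the powers of L and the factor β contribute f^((a-i-2)/2) · f, which is
the same power of f; the ambiguity modulo α is killed by the last factor. This is the invariance of
the operator (`IsContactPair.operator_eq`).

Smooth components exist because those annihilated by contraction with the Reeb vector are unique:
they solve an overdetermined but injective linear system with smooth coefficients
(`contDiffAt_of_injective`, `contDiffAt_of_isDecomposition`).

Finally the operator is described pointwise, by the relation `IsOperatorValue`, and each point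
carries exactly one value. Linearity, smoothness and naturality all come from this uniqueness, since
sums, multiples, local formulas and pullbacks of values are again values. -/

namespace ContactForms

/-! ### Signed sums over permutations and contraction of one slot -/

section ShuffleSum

variable {V : Type*}

/-- The signed sum over all permutations of the slots of `f ⊗ g`. -/
def shuffleSum {A B : Type*} [Fintype A] [Fintype B] [DecidableEq A] [DecidableEq B]
    (f : (A → V) → ℝ) (g : (B → V) → ℝ) (w : A ⊕ B → V) : ℝ :=
  ∑ σ : Equiv.Perm (A ⊕ B), ((Equiv.Perm.sign σ : ℤ) : ℝ) *
    (f (fun i => w (σ (Sum.inl i))) * g (fun i => w (σ (Sum.inr i))))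

theorem shuffleSum_congr {A B A' B' : Type*} [Fintype A] [Fintype B] [DecidableEq A]
    [DecidableEq B] [Fintype A'] [Fintype B'] [DecidableEq A'] [DecidableEq B']
    (eA : A ≃ A') (eB : B ≃ B') (f : (A → V) → ℝ) (g : (B → V) → ℝ) (w : A' ⊕ B' → V) :
    shuffleSum f g (fun i => w (Equiv.sumCongr eA eB i)) =
      shuffleSum (fun x => f fun i => x (eA i)) (fun x => g fun i => x (eB i)) w := by
  unfold shuffleSum
  refine Fintype.sum_equiv (Equiv.sumCongr eA eB).permCongr _ _ fun σ => ?_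
  simp [Equiv.permCongr_apply]

variable [AddCommGroup V] [Module ℝ V]

/-- The distinguished slot `none` of `A ⊕ Option B` split off. -/
def optionSumEquiv (A B : Type*) : Option (A ⊕ B) ≃ A ⊕ Option B where
  toFun o := o.elim (Sum.inr none) (Sum.map id some)
  invFun s := s.elim (fun a => some (Sum.inl a)) (fun o => o.map Sum.inr)
  left_inv := by rintro (_ | _ | _) <;> rfl
  right_inv := by rintro (_ | _ | _) <;> rfl

/-- Extension of a permutation by the identity on a distinguished slot. -/
def permExtend {A B : Type*} (τ : Equiv.Perm (A ⊕ B)) : Equiv.Perm (A ⊕ Option B) :=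
  (optionSumEquiv A B).permCongr (Equiv.optionCongr τ)

@[simp] theorem permExtend_inl {A B : Type*} (τ : Equiv.Perm (A ⊕ B)) (a : A) :
    permExtend τ (Sum.inl a) = Sum.map id some (τ (Sum.inl a)) := by
  simp [permExtend, Equiv.permCongr_apply, optionSumEquiv]

@[simp] theorem permExtend_some {A B : Type*} (τ : Equiv.Perm (A ⊕ B)) (b : B) :
    permExtend τ (Sum.inr (some b)) = Sum.map id some (τ (Sum.inr b)) := by
  simp [permExtend, Equiv.permCongr_apply, optionSumEquiv]

@[simp] theorem permExtend_none {A B : Type*} (τ : Equiv.Perm (A ⊕ B)) :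
    permExtend τ (Sum.inr none) = Sum.inr none := by
  simp [permExtend, Equiv.permCongr_apply, optionSumEquiv]

@[simp] theorem sign_permExtend {A B : Type*} [Fintype A] [Fintype B] [DecidableEq A]
    [DecidableEq B] (τ : Equiv.Perm (A ⊕ B)) :
    Equiv.Perm.sign (permExtend τ) = Equiv.Perm.sign τ := by
  simp [permExtend, Equiv.Perm.sign_permCongr]

theorem permExtend_mul_swap {A B : Type*} [DecidableEq A] [DecidableEq B]
    (τ : Equiv.Perm (A ⊕ B)) (a a' : A) :
    permExtend (τ * Equiv.swap (Sum.inl a) (Sum.inl a')) =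
      permExtend τ * Equiv.swap (Sum.inl a) (Sum.inl a') := by
  ext i
  rcases i with i | (_ | i)
  · simp only [permExtend_inl, Equiv.Perm.coe_mul, Function.comp_apply]
    rw [← Sum.inl_injective.map_swap, ← Sum.inl_injective.map_swap, permExtend_inl]
  · simp [Equiv.swap_apply_of_ne_of_ne]
  · simp [Equiv.swap_apply_of_ne_of_ne]

/-- Coset decomposition: the index i is the slot that receives the distinguished argument.
`Equiv.Perm.decomposeOption` has the transposition on the left, so inversion is used to move it to
the right. -/
theorem sum_perm_sum_option {A B : Type*} [Fintype A] [Fintype B] [DecidableEq A]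
    [DecidableEq B] (F : Equiv.Perm (A ⊕ Option B) → ℝ) :
    ∑ σ, F σ = ∑ i : A ⊕ Option B, ∑ τ, F (permExtend τ * Equiv.swap (Sum.inr none) i) := by
  have h1 : ∀ G : Equiv.Perm (Option (A ⊕ B)) → ℝ,
      ∑ σ, G σ = ∑ i, ∑ τ, G (Equiv.optionCongr τ * Equiv.swap none i) := by
    intro G
    rw [← Fintype.sum_prod_type']
    symm
    refine Fintype.sum_equiv (((Equiv.refl _).prodCongr (Equiv.inv _)).trans
      (Equiv.Perm.decomposeOption.symm.trans (Equiv.inv _))) _ _ fun x => ?_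
    congr 1
  have h2 := h1 fun σ => F ((optionSumEquiv A B).permCongr σ)
  rw [← Fintype.sum_equiv (optionSumEquiv A B).permCongr _ F fun _ => rfl, h2]
  refine Fintype.sum_equiv (optionSumEquiv A B) _ _ fun i => Finset.sum_congr rfl fun τ _ => ?_
  congr 1
  rw [Equiv.permCongr_mul, permExtend]
  congr 1
  ext j
  simp only [Equiv.permCongr_apply]
  rw [(optionSumEquiv A B).injective.map_swap, Equiv.apply_symm_apply]
  rfl

/-- A summand of `shuffleSum`. -/
def shuffleTerm {A B : Type*} [Fintype A] [Fintype B] [DecidableEq A] [DecidableEq B]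
    (f : (A → V) → ℝ) (g : (B → V) → ℝ) (w : A ⊕ B → V) (σ : Equiv.Perm (A ⊕ B)) : ℝ :=
  ((Equiv.Perm.sign σ : ℤ) : ℝ) *
    (f (fun i => w (σ (Sum.inl i))) * g (fun i => w (σ (Sum.inr i))))

/-- The sign of the transposition cancels the sign produced by the alternating factor. -/
theorem shuffleTerm_mul_swap_inl {A B : Type*} [Fintype A] [Fintype B] [DecidableEq A]
    [DecidableEq B] (f : V [⋀^A]→ₗ[ℝ] ℝ) (g : (B → V) → ℝ) (w : A ⊕ B → V)
    (σ : Equiv.Perm (A ⊕ B)) (a a' : A) :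
    shuffleTerm f g w (σ * Equiv.swap (Sum.inl a) (Sum.inl a')) = shuffleTerm f g w σ := by
  by_cases ha : a = a'
  · subst ha; rw [Equiv.swap_self]; rfl
  · have e1 : (fun i => w ((σ * Equiv.swap (Sum.inl a) (Sum.inl a') : Equiv.Perm _)
        (Sum.inl i))) = (fun i => w (σ (Sum.inl i))) ∘ Equiv.swap a a' := by
      funext i
      simp only [Equiv.Perm.coe_mul, Function.comp_apply]
      rw [Sum.inl_injective.map_swap]
    have e2 : (fun i => w ((σ * Equiv.swap (Sum.inl a) (Sum.inl a') : Equiv.Perm _)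
        (Sum.inr i))) = (fun i => w (σ (Sum.inr i))) := by
      funext i
      simp [Equiv.swap_apply_of_ne_of_ne]
    unfold shuffleTerm
    rw [e1, e2, AlternatingMap.map_swap _ _ ha]
    simp [Equiv.Perm.sign_mul, Equiv.Perm.sign_swap (Sum.inl_injective.ne ha)]

theorem shuffleTerm_mul_swap_inr {A B : Type*} [Fintype A] [Fintype B] [DecidableEq A]
    [DecidableEq B] (f : (A → V) → ℝ) (g : V [⋀^B]→ₗ[ℝ] ℝ) (w : A ⊕ B → V)
    (σ : Equiv.Perm (A ⊕ B)) (a a' : B) :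
    shuffleTerm f g w (σ * Equiv.swap (Sum.inr a) (Sum.inr a')) = shuffleTerm f g w σ := by
  by_cases ha : a = a'
  · subst ha; rw [Equiv.swap_self]; rfl
  · have e1 : (fun i => w ((σ * Equiv.swap (Sum.inr a) (Sum.inr a') : Equiv.Perm _)
        (Sum.inr i))) = (fun i => w (σ (Sum.inr i))) ∘ Equiv.swap a a' := by
      funext i
      simp only [Equiv.Perm.coe_mul, Function.comp_apply]
      rw [Sum.inr_injective.map_swap]
    have e2 : (fun i => w ((σ * Equiv.swap (Sum.inr a) (Sum.inr a') : Equiv.Perm _)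
        (Sum.inl i))) = (fun i => w (σ (Sum.inl i))) := by
      funext i
      simp [Equiv.swap_apply_of_ne_of_ne]
    unfold shuffleTerm
    rw [e1, e2, AlternatingMap.map_swap _ _ ha]
    simp [Equiv.Perm.sign_mul, Equiv.Perm.sign_swap (Sum.inr_injective.ne ha)]

/-- Split by the slot that receives `w (Sum.inr none)`. The card B + 1 slots of the second factor
all contribute the same, because g is alternating. -/
theorem shuffleSum_eq_add {A B : Type*} [Fintype A] [Fintype B] [DecidableEq A]
    [DecidableEq B] (f : (A → V) → ℝ) (g : V [⋀^Option B]→ₗ[ℝ] ℝ) (w : A ⊕ Option B → V) :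
    shuffleSum f g w = (Fintype.card B + 1) *
      shuffleSum f (fun x => g fun o => o.elim (w (Sum.inr none)) x)
        (fun i => w (Sum.map id some i)) +
      ∑ a : A, ∑ τ : Equiv.Perm (A ⊕ B),
        shuffleTerm f g w (permExtend τ * Equiv.swap (Sum.inr none) (Sum.inl a)) := by
  have hS : ∑ τ, shuffleTerm f g w (permExtend τ) =
      shuffleSum f (fun x => g fun o => o.elim (w (Sum.inr none)) x)
        (fun i => w (Sum.map id some i)) := by
    unfold shuffleSum shuffleTerm
    refine Finset.sum_congr rfl fun τ _ => ?_
    rw [sign_permExtend]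
    congr 3
    funext i
    rcases i with _ | i <;> simp
  change ∑ σ, shuffleTerm f g w σ = _
  rw [sum_perm_sum_option, Fintype.sum_sum_type, add_comm]
  congr 1
  simp [shuffleTerm_mul_swap_inr, hS]

theorem shuffleSum_option_right {A B : Type*} [Fintype A] [Fintype B] [DecidableEq A]
    [DecidableEq B] [IsEmpty A] (f : (A → V) → ℝ) (g : V [⋀^Option B]→ₗ[ℝ] ℝ)
    (w : A ⊕ Option B → V) :
    shuffleSum f g w = (Fintype.card B + 1) *
      shuffleSum f (fun x => g fun o => o.elim (w (Sum.inr none)) x)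
        (fun i => w (Sum.map id some i)) := by
  rw [shuffleSum_eq_add]; simp

/-- Contraction of a vector into the slot `none` of the second factor of a product. -/
theorem shuffleSum_option_option {A B : Type*} [Fintype A] [Fintype B] [DecidableEq A]
    [DecidableEq B] (f : V [⋀^Option A]→ₗ[ℝ] ℝ) (g : V [⋀^Option B]→ₗ[ℝ] ℝ)
    (w : Option A ⊕ Option B → V) :
    shuffleSum f g w = (Fintype.card B + 1) *
      shuffleSum f (fun x => g fun o => o.elim (w (Sum.inr none)) x)
        (fun i => w (Sum.map id some i)) -
      (Fintype.card A + 1) *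
      shuffleSum (fun x => f fun o => o.elim (w (Sum.inr none)) x) g
        (fun i : A ⊕ Option B => i.elim (fun a => w (Sum.inl (some a)))
          (fun o => o.elim (w (Sum.inl none)) fun b => w (Sum.inr (some b)))) := by
  have hne : (Sum.inr none : Option A ⊕ Option B) ≠ Sum.inl none := by simp
  -- Reindexing by a transposition of slots of f shows that every slot of the first factor
  -- contributes the same amount.
  have h1 : ∀ a : Option A, ∑ τ : Equiv.Perm (Option A ⊕ B),
        shuffleTerm f g w (permExtend τ * Equiv.swap (Sum.inr none) (Sum.inl a)) =
      ∑ τ : Equiv.Perm (Option A ⊕ B),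
        shuffleTerm f g w (permExtend τ * Equiv.swap (Sum.inr none) (Sum.inl none)) := by
    intro a
    refine Fintype.sum_equiv
      (Equiv.mulRight (Equiv.swap (Sum.inl a) (Sum.inl none))) _ _ fun τ => ?_
    rw [Equiv.coe_mulRight, permExtend_mul_swap,
      ← shuffleTerm_mul_swap_inl f g w (permExtend τ * _) a none]
    congr 1
    rw [mul_assoc, mul_assoc]
    congr 1
    by_cases ha : a = none
    · subst ha; rw [Equiv.swap_self]; rfl
    ext i
    simp only [Equiv.Perm.coe_mul, Function.comp_apply, Equiv.swap_apply_def]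
    grind
  -- The transposition costs a sign; the distinguished vector enters f, and `w (Sum.inl none)` takes
  -- the place it leaves among the arguments.
  have h2 : ∑ τ : Equiv.Perm (Option A ⊕ B),
        shuffleTerm f g w (permExtend τ * Equiv.swap (Sum.inr none) (Sum.inl none)) =
      - shuffleSum (fun x => f fun o => o.elim (w (Sum.inr none)) x) g
        (fun i : A ⊕ Option B => i.elim (fun a => w (Sum.inl (some a)))
          (fun o => o.elim (w (Sum.inl none)) fun b => w (Sum.inr (some b)))) := by
    let E : Option A ⊕ B ≃ A ⊕ Option B :=
      { toFun := Sum.elim (fun o => o.elim (Sum.inr none) Sum.inl) (Sum.inr ∘ some)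
        invFun := Sum.elim (Sum.inl ∘ some) (fun o => o.elim (Sum.inl none) Sum.inr)
        left_inv := by rintro ((_ | _) | _) <;> rfl
        right_inv := by rintro (_ | (_ | _)) <;> rfl }
    have hE : ∀ j, (E j).elim (fun a => w (Sum.inl (some a)))
          (fun o => o.elim (w (Sum.inl none)) fun b => w (Sum.inr (some b))) =
        w (Sum.map id some j) := by
      rintro ((_ | _) | _) <;> rfl
    unfold shuffleSum
    rw [← Finset.sum_neg_distrib]
    refine Fintype.sum_equiv E.permCongr _ _ fun τ => ?_
    unfold shuffleTerm
    rw [Equiv.Perm.sign_permCongr, Equiv.Perm.sign_mul, Equiv.Perm.sign_swap hne,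
      sign_permExtend]
    simp only [mul_neg, mul_one, Units.val_neg, Int.cast_neg, neg_mul, neg_inj,
      Equiv.permCongr_apply, hE]
    congr 3
    · funext o
      rcases o with _ | a
      · simp
      · simp [Equiv.swap_apply_of_ne_of_ne, E]
    · funext o
      rcases o with _ | a
      · simp [E]
      · simp [Equiv.swap_apply_of_ne_of_ne, E]
  rw [shuffleSum_eq_add, Finset.sum_congr rfl fun a _ => h1 a, h2]
  simp
  ring

end ShuffleSum

/-! ### Appending a vector as last argument -/

section Snoc

variable {V : Type*}

theorem elim_finSuccEquivLast {p : ℕ} (v : V) (x : Fin p → V) :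
    (fun i => (finSuccEquivLast i).elim v x) = Fin.snoc (α := fun _ => V) x v := by
  funext i
  induction i using Fin.lastCases <;> simp

theorem snoc_finSumFinEquiv {p q : ℕ} (w : Fin (p + q) → V) (v : V) :
    (fun i : Fin p ⊕ Fin (q + 1) =>
      Fin.snoc (n := p + q) (α := fun _ => V) w v (finSumFinEquiv i : Fin (p + (q + 1)))) =
      Sum.elim (fun i => w (finSumFinEquiv (Sum.inl i)))
        (Fin.snoc (α := fun _ => V) (fun i => w (finSumFinEquiv (Sum.inr i))) v) := by
  funext i
  rcases i with i | i
  · exact Fin.snoc_castSucc (α := fun _ => V) v w (Fin.castAdd q i)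
  · induction i using Fin.lastCases with
    | last =>
      rw [Sum.elim_inr, Fin.snoc_last]
      exact Fin.snoc_last (α := fun _ => V) v w
    | cast j =>
      rw [Sum.elim_inr, Fin.snoc_castSucc]
      exact Fin.snoc_castSucc (α := fun _ => V) v w (Fin.natAdd p j)

end Snoc

/-! ### Bilinearity, functoriality and contraction of the wedge product -/

section Wedge

variable {V : Type*} [AddCommGroup V] [Module ℝ V] [TopologicalSpace V]

/-- Each shuffle class contains p! q! permutations with equal contributions. This replaces the
quotient in the definition of the wedge product by a plain sum over permutations. -/
theorem factorial_mul_wedge {p q : ℕ} (θ : V [⋀^Fin p]→L[ℝ] ℝ) (η : V [⋀^Fin q]→L[ℝ] ℝ)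
    (v : Fin (p + q) → V) :
    (p.factorial * q.factorial : ℝ) * wedge θ η v =
      shuffleSum θ η fun i => v (finSumFinEquiv i) := by
  have h := congrArg (fun f => LinearMap.mul' ℝ ℝ (f fun i => v (finSumFinEquiv i)))
    (MultilinearMap.domCoprod_alternization_eq θ.toAlternatingMap η.toAlternatingMap)
  simp only [AlternatingMap.smul_apply, map_nsmul, Fintype.card_fin] at h
  rw [nsmul_eq_mul, Nat.cast_mul] at h
  refine Eq.trans h.symm ?_
  rw [MultilinearMap.alternatization_apply, map_sum]
  unfold shuffleSum
  refine Finset.sum_congr rfl fun σ _ => ?_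
  rcases Int.units_eq_one_or (Equiv.Perm.sign σ) with h | h <;> simp [h]

theorem wedge_ext_iff {p q : ℕ} (θ : V [⋀^Fin p]→L[ℝ] ℝ) (η : V [⋀^Fin q]→L[ℝ] ℝ)
    (v : Fin (p + q) → V) (c : ℝ) : wedge θ η v = c ↔
      shuffleSum θ η (fun i => v (finSumFinEquiv i)) = (p.factorial * q.factorial : ℝ) * c := by
  rw [← factorial_mul_wedge]
  exact (mul_right_inj' (by positivity)).symm

theorem wedge_add_left {p q : ℕ} (θ θ' : V [⋀^Fin p]→L[ℝ] ℝ) (η : V [⋀^Fin q]→L[ℝ] ℝ) :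
    wedge (θ + θ') η = wedge θ η + wedge θ' η := by
  ext v
  rw [wedge_ext_iff, ContinuousAlternatingMap.add_apply, mul_add, factorial_mul_wedge,
    factorial_mul_wedge]
  simp [shuffleSum, ← Finset.sum_add_distrib, add_mul, mul_add]

theorem wedge_add_right {p q : ℕ} (θ : V [⋀^Fin p]→L[ℝ] ℝ) (η η' : V [⋀^Fin q]→L[ℝ] ℝ) :
    wedge θ (η + η') = wedge θ η + wedge θ η' := by
  ext v
  rw [wedge_ext_iff, ContinuousAlternatingMap.add_apply, mul_add, factorial_mul_wedge,
    factorial_mul_wedge]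
  simp [shuffleSum, ← Finset.sum_add_distrib, mul_add]

theorem wedge_smul_left {p q : ℕ} (c : ℝ) (θ : V [⋀^Fin p]→L[ℝ] ℝ) (η : V [⋀^Fin q]→L[ℝ] ℝ) :
    wedge (c • θ) η = c • wedge θ η := by
  ext v
  rw [wedge_ext_iff, ContinuousAlternatingMap.smul_apply, smul_eq_mul, mul_left_comm,
    factorial_mul_wedge]
  simp only [shuffleSum, Finset.mul_sum, ContinuousAlternatingMap.smul_apply, smul_eq_mul]
  exact Finset.sum_congr rfl fun _ _ => by ring

theorem wedge_smul_right {p q : ℕ} (c : ℝ) (θ : V [⋀^Fin p]→L[ℝ] ℝ) (η : V [⋀^Fin q]→L[ℝ] ℝ) :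
    wedge θ (c • η) = c • wedge θ η := by
  ext v
  rw [wedge_ext_iff, ContinuousAlternatingMap.smul_apply, smul_eq_mul, mul_left_comm,
    factorial_mul_wedge]
  simp only [shuffleSum, Finset.mul_sum, ContinuousAlternatingMap.smul_apply, smul_eq_mul]
  exact Finset.sum_congr rfl fun _ _ => by ring

theorem wedge_compContinuousLinearMap {W : Type*} [AddCommGroup W] [Module ℝ W]
    [TopologicalSpace W] (f : W →L[ℝ] V) {p q : ℕ} (θ : V [⋀^Fin p]→L[ℝ] ℝ)
    (η : V [⋀^Fin q]→L[ℝ] ℝ) :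
    (wedge θ η).compContinuousLinearMap f =
      wedge (θ.compContinuousLinearMap f) (η.compContinuousLinearMap f) := by
  ext v
  symm
  rw [wedge_ext_iff]
  exact (factorial_mul_wedge θ η fun i => f (v i)).symm

theorem wedge_degree_zero {p : ℕ} (θ : V [⋀^Fin p]→L[ℝ] ℝ) (η : V [⋀^Fin 0]→L[ℝ] ℝ) :
    wedge θ η = η 0 • θ := by
  ext v
  rw [wedge_ext_iff]
  have h : ∀ σ : Equiv.Perm (Fin p ⊕ Fin 0), ((Equiv.Perm.sign σ : ℤ) : ℝ) *
      (θ (fun i => v (finSumFinEquiv (σ (Sum.inl i)))) *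
        η (fun i => v (finSumFinEquiv (σ (Sum.inr i))))) = η 0 * θ v := by
    intro σ
    obtain ⟨τ, rfl⟩ := (Equiv.sumEmpty (Fin p) (Fin 0)).symm.permCongr.surjective σ
    have h1 : (fun i => v (finSumFinEquiv
        ((Equiv.sumEmpty (Fin p) (Fin 0)).symm.permCongr τ (Sum.inl i)))) = v ∘ τ := by
      funext i
      simp [Equiv.permCongr_apply]
      rfl
    rw [h1, Subsingleton.elim (fun i : Fin 0 => _) (0 : Fin 0 → V), Equiv.Perm.sign_permCongr]
    have := θ.toAlternatingMap.map_perm v τ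
    simp only [ContinuousAlternatingMap.coe_toAlternatingMap] at this
    rw [this]
    rcases Int.units_eq_one_or (Equiv.Perm.sign τ) with h | h <;> simp [h, mul_comm]
  unfold shuffleSum
  rw [Finset.sum_congr rfl fun σ _ => h σ]
  simp [Fintype.card_perm]

/-- Contraction of a vector into the last slot of an alternating form. -/
def contractLast [IsTopologicalAddGroup V] [ContinuousSMul ℝ V] {p : ℕ} (v : V)
    (θ : V [⋀^Fin (p + 1)]→L[ℝ] ℝ) : V [⋀^Fin p]→L[ℝ] ℝ where
  toFun w := θ (Fin.snoc (α := fun _ => V) w v)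
  map_update_add' := by
    intro inst w i x y
    rw [Subsingleton.elim inst (instDecidableEqFin p)]
    have h := fun z => Fin.snoc_update (α := fun _ => V) v w i z
    rw [h, h, h, θ.map_update_add]
  map_update_smul' := by
    intro inst w i c x
    rw [Subsingleton.elim inst (instDecidableEqFin p)]
    have h := fun z => Fin.snoc_update (α := fun _ => V) v w i z
    rw [h, h, θ.map_update_smul]
  map_eq_zero_of_eq' w i j hw hij :=
    θ.map_eq_zero_of_eq _ (i := i.castSucc) (j := j.castSucc) (by simpa using hw)
      (by simpa using hij)
  cont := θ.cont.comp (by fun_prop)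

variable [IsTopologicalAddGroup V] [ContinuousSMul ℝ V]

@[simp] theorem contractLast_apply {p : ℕ} (v : V) (θ : V [⋀^Fin (p + 1)]→L[ℝ] ℝ)
    (w : Fin p → V) : contractLast v θ w = θ (Fin.snoc (α := fun _ => V) w v) := rfl

theorem shuffleSum_snoc_zero {q : ℕ} (θ : V [⋀^Fin 0]→L[ℝ] ℝ)
    (η : V [⋀^Fin (q + 1)]→L[ℝ] ℝ) (v : V) (w : Fin 0 ⊕ Fin q → V) :
    shuffleSum θ η (Sum.elim (fun i => w (Sum.inl i))
      (Fin.snoc (α := fun _ => V) (fun i => w (Sum.inr i)) v)) =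
      (q + 1) * shuffleSum θ (contractLast v η) w := by
  have h := shuffleSum_congr (Equiv.refl (Fin 0)) (finSuccEquivLast (n := q)) θ η
    (Sum.elim (fun i => w (Sum.inl i)) fun o => o.elim v fun i => w (Sum.inr i))
  have h' := shuffleSum_option_right θ
    (η.toAlternatingMap.domDomCongr (finSuccEquivLast (n := q)))
    (Sum.elim (fun i => w (Sum.inl i)) fun o => o.elim v fun i => w (Sum.inr i))
  refine Eq.trans ?_ (h.trans (h'.trans ?_))
  · congr 1
    funext i
    rcases i with i | i
    · rfl
    · exact (congrFun (elim_finSuccEquivLast v fun i => w (Sum.inr i)) i).symm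
  · simp only [Fintype.card_fin]
    congr 2
    · funext x
      exact congrArg η (elim_finSuccEquivLast v x)
    · funext i
      rcases i with i | i <;> rfl

theorem shuffleSum_snoc_succ {p q : ℕ} (θ : V [⋀^Fin (p + 1)]→L[ℝ] ℝ)
    (η : V [⋀^Fin (q + 1)]→L[ℝ] ℝ) (v : V) (w : Fin (p + 1) ⊕ Fin q → V) :
    shuffleSum θ η (Sum.elim (fun i => w (Sum.inl i))
      (Fin.snoc (α := fun _ => V) (fun i => w (Sum.inr i)) v)) =
      (q + 1) * shuffleSum θ (contractLast v η) w -
      (p + 1) * shuffleSum (contractLast v θ) η (Sum.elim (fun i => w (Sum.inl i.castSucc))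
        (Fin.snoc (α := fun _ => V) (fun i => w (Sum.inr i)) (w (Sum.inl (Fin.last p))))) := by
  have h := shuffleSum_congr (finSuccEquivLast (n := p)) (finSuccEquivLast (n := q)) θ η
    (Sum.elim (fun o => o.elim (w (Sum.inl (Fin.last p))) fun i => w (Sum.inl i.castSucc))
      fun o => o.elim v fun i => w (Sum.inr i))
  have h' := shuffleSum_option_option
    (θ.toAlternatingMap.domDomCongr (finSuccEquivLast (n := p)))
    (η.toAlternatingMap.domDomCongr (finSuccEquivLast (n := q)))
    (Sum.elim (fun o => o.elim (w (Sum.inl (Fin.last p))) fun i => w (Sum.inl i.castSucc))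
      fun o => o.elim v fun i => w (Sum.inr i))
  have h1 := shuffleSum_congr (finSuccEquivLast (n := p)) (Equiv.refl (Fin q)) θ
    (contractLast v η)
    (Sum.elim (fun o => o.elim (w (Sum.inl (Fin.last p))) fun i => w (Sum.inl i.castSucc))
      fun i => w (Sum.inr i))
  have h2 := shuffleSum_congr (Equiv.refl (Fin p)) (finSuccEquivLast (n := q))
    (contractLast v θ) η (Sum.elim (fun i => w (Sum.inl i.castSucc))
      fun o => o.elim (w (Sum.inl (Fin.last p))) fun i => w (Sum.inr i))
  refine Eq.trans ?_ (h.trans (h'.trans ?_))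
  · congr 1
    funext i
    rcases i with i | i
    · induction i using Fin.lastCases <;> simp
    · exact (congrFun (elim_finSuccEquivLast v fun i => w (Sum.inr i)) i).symm
  · simp only [Fintype.card_fin]
    congr 2
    · refine Eq.trans ?_ (h1.symm.trans ?_)
      · congr 1
        · funext x
          exact congrArg η (elim_finSuccEquivLast v x)
        · funext i
          rcases i with i | i <;> rfl
      · congr 1
        funext i
        rcases i with i | i
        · induction i using Fin.lastCases <;> simp
        · rfl
    · refine Eq.trans ?_ (h2.symm.trans ?_)
      · congr 1
        funext x
        exact congrArg θ (elim_finSuccEquivLast v x)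
      · congr 1
        funext i
        rcases i with i | i
        · rfl
        · exact congrFun (elim_finSuccEquivLast _ _) i

theorem contractLast_zero_apply (v : V) (α : V [⋀^Fin 1]→L[ℝ] ℝ) :
    contractLast v α 0 = α fun _ => v := by
  rw [contractLast_apply]; congr 1

theorem contractLast_wedge_zero {q : ℕ} (v : V) (θ : V [⋀^Fin 0]→L[ℝ] ℝ)
    (η : V [⋀^Fin (q + 1)]→L[ℝ] ℝ) :
    contractLast v (p := 0 + q) (wedge (p := 0) (q := q + 1) θ η) =
      wedge θ (contractLast v η) := by
  ext w
  rw [contractLast_apply]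
  refine (wedge_ext_iff θ η _ _).2 ?_
  rw [snoc_finSumFinEquiv w v, shuffleSum_snoc_zero θ η v (fun i => w (finSumFinEquiv i)),
    ← factorial_mul_wedge, Nat.factorial_succ]
  push_cast
  ring

/-- Leibniz rule before reordering: in the second term the last argument of θ has been displaced to
the end of the arguments of η. Restoring its place is trivial when η has degree 1 and costs one
transposition when η has degree 2; hence the opposite signs in the two rules derived below. -/
theorem factorial_mul_contractLast_wedge {p q : ℕ} (v : V) (θ : V [⋀^Fin (p + 1)]→L[ℝ] ℝ)
    (η : V [⋀^Fin (q + 1)]→L[ℝ] ℝ) (w : Fin (p + 1 + q) → V) :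
    (contractLast v (p := p + 1 + q) (wedge (p := p + 1) (q := q + 1) θ η)) w =
      wedge θ (contractLast v η) w -
      (p.factorial * (q + 1).factorial : ℝ)⁻¹ * shuffleSum (contractLast v θ) η
        (Sum.elim (fun i => w (Fin.castAdd q i.castSucc))
          (Fin.snoc (α := fun _ => V) (fun i => w (Fin.natAdd (p + 1) i))
            (w (Fin.castAdd q (Fin.last p))))) := by
  rw [contractLast_apply]
  refine (wedge_ext_iff θ η _ _).2 ?_
  rw [snoc_finSumFinEquiv w v, shuffleSum_snoc_succ θ η v (fun i => w (finSumFinEquiv i)),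
    ← factorial_mul_wedge, mul_sub, Nat.factorial_succ, Nat.factorial_succ]
  have h1 : (p.factorial : ℝ) ≠ 0 := by positivity
  have h2 : (q.factorial : ℝ) ≠ 0 := by positivity
  have h3 : (q + 1 : ℝ) ≠ 0 := by positivity
  simp only [finSumFinEquiv_apply_left, finSumFinEquiv_apply_right]
  push_cast
  field_simp

theorem contractLast_wedge_one_zero (v : V) (θ : V [⋀^Fin 0]→L[ℝ] ℝ)
    (α : V [⋀^Fin 1]→L[ℝ] ℝ) :
    contractLast v (p := 0) (wedge (p := 0) (q := 1) θ α) = α (fun _ => v) • θ := by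
  rw [← contractLast_zero_apply, ← wedge_degree_zero]
  exact contractLast_wedge_zero v θ α

theorem contractLast_wedge_one_succ {p : ℕ} (v : V) (θ : V [⋀^Fin (p + 1)]→L[ℝ] ℝ)
    (α : V [⋀^Fin 1]→L[ℝ] ℝ) :
    contractLast v (p := p + 1) (wedge (p := p + 1) (q := 1) θ α) =
      α (fun _ => v) • θ - wedge (contractLast v θ) α := by
  rw [← contractLast_zero_apply, ← wedge_degree_zero]
  ext w
  refine (factorial_mul_contractLast_wedge v θ α w).trans ?_
  rw [ContinuousAlternatingMap.sub_apply]
  congr 1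
  rw [inv_mul_eq_iff_eq_mul₀ (by positivity)]
  refine Eq.trans ?_ (factorial_mul_wedge _ _ _).symm
  congr 1
  funext i
  rcases i with i | i
  · rfl
  · fin_cases i; rfl

theorem contractLast_wedge_two_zero (v : V) (θ : V [⋀^Fin 0]→L[ℝ] ℝ)
    (Ω : V [⋀^Fin 2]→L[ℝ] ℝ) :
    contractLast v (p := 0 + 1) (wedge (p := 0) (q := 2) θ Ω) =
      wedge θ (contractLast v (p := 1) Ω) :=
  contractLast_wedge_zero v θ Ω

theorem contractLast_wedge_two_succ {p : ℕ} (v : V) (θ : V [⋀^Fin (p + 1)]→L[ℝ] ℝ)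
    (Ω : V [⋀^Fin 2]→L[ℝ] ℝ) :
    contractLast v (p := p + 1 + 1) (wedge (p := p + 1) (q := 2) θ Ω) =
      wedge θ (contractLast v (p := 1) Ω) + wedge (contractLast v θ) Ω := by
  ext w
  refine (factorial_mul_contractLast_wedge v θ Ω w).trans ?_
  rw [ContinuousAlternatingMap.add_apply, sub_eq_add_neg]
  congr 1
  rw [neg_eq_iff_eq_neg, inv_mul_eq_iff_eq_mul₀ (by positivity)]
  have hne : (Fin.natAdd p (0 : Fin 2)) ≠ Fin.natAdd p (1 : Fin 2) := by simp [Fin.ext_iff]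
  have h := (wedge (contractLast v θ) Ω).toAlternatingMap.map_swap w hne
  have h' : wedge (contractLast v θ) Ω (w ∘ Equiv.swap (Fin.natAdd p 0) (Fin.natAdd p 1)) =
    - wedge (contractLast v θ) Ω w := h
  rw [← h']
  refine Eq.trans ?_ (factorial_mul_wedge _ _ _).symm
  congr 1
  funext i
  rcases i with i | i
  · rw [finSumFinEquiv_apply_left, Function.comp_apply, Equiv.swap_apply_of_ne_of_ne]
    · rfl
    · simp [Fin.ext_iff]; omega
    · simp [Fin.ext_iff]; omega
  · fin_cases i
    · simp
      rfl
    · simp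
      rfl

end Wedge

/-! ### Operators on graded families of forms and their commutation relations -/

section Graded

variable {V : Type*} [AddCommGroup V] [Module ℝ V] [TopologicalSpace V]

variable (V) in
/-- Families of alternating forms, one in each degree. -/
abbrev GradedForm : Type _ := (p : ℕ) → V [⋀^Fin p]→L[ℝ] ℝ

/-- Right multiplication by a 1-form. -/
def mulOne (α : V [⋀^Fin 1]→L[ℝ] ℝ) : Module.End ℝ (GradedForm V) where
  toFun θ
    | 0 => 0
    | p + 1 => wedge (θ p) α
  map_add' θ η := by
    funext p
    rcases p with _ | p
    · exact (add_zero _).symm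
    · exact wedge_add_left _ _ _
  map_smul' c θ := by
    funext p
    rcases p with _ | p
    · exact (smul_zero c).symm
    · exact wedge_smul_left _ _ _

/-- Right multiplication by a 2-form. -/
def mulTwo (Ω : V [⋀^Fin 2]→L[ℝ] ℝ) : Module.End ℝ (GradedForm V) where
  toFun θ
    | 0 => 0
    | 1 => 0
    | p + 2 => wedge (θ p) Ω
  map_add' θ η := by
    funext p
    rcases p with _ | _ | p
    · exact (add_zero _).symm
    · exact (add_zero _).symm
    · exact wedge_add_left _ _ _
  map_smul' c θ := by
    funext p
    rcases p with _ | _ | p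
    · exact (smul_zero c).symm
    · exact (smul_zero c).symm
    · exact wedge_smul_left _ _ _

theorem mulOne_succ_apply (α : V [⋀^Fin 1]→L[ℝ] ℝ) (θ : GradedForm V) (p : ℕ) :
    mulOne α θ (p + 1) = wedge (θ p) α := rfl

theorem mulTwo_succ_apply (Ω : V [⋀^Fin 2]→L[ℝ] ℝ) (θ : GradedForm V) (p : ℕ) :
    mulTwo Ω θ (p + 2) = wedge (θ p) Ω := rfl

variable [IsTopologicalAddGroup V] [ContinuousSMul ℝ V]

/-- Contraction of a vector into the last slot, in all degrees. -/
def contract (v : V) : Module.End ℝ (GradedForm V) where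
  toFun θ p := contractLast v (θ (p + 1))
  map_add' _ _ := rfl
  map_smul' _ _ := rfl

theorem contract_apply (v : V) (θ : GradedForm V) (p : ℕ) :
    contract v θ p = contractLast v (θ (p + 1)) := rfl

/-- A form of positive degree is determined by its contractions; this drives all the inductions on
the degree. -/
theorem eq_of_contractLast_eq {p : ℕ} {θ η : V [⋀^Fin (p + 1)]→L[ℝ] ℝ}
    (h : ∀ v, contractLast v θ = contractLast v η) : θ = η := by
  ext w
  have := congrArg (fun f => f (Fin.init w)) (h (w (Fin.last p)))
  simpa [Fin.snoc_init_self] using this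

theorem contract_mulOne (v : V) (α : V [⋀^Fin 1]→L[ℝ] ℝ) :
    contract v * mulOne α = (α fun _ => v) • 1 - mulOne α * contract v := by
  refine LinearMap.ext fun θ => funext fun p => ?_
  rcases p with _ | p
  · refine (contractLast_wedge_one_zero v (θ 0) α).trans ?_
    exact (sub_zero _).symm
  · exact contractLast_wedge_one_succ v (θ (p + 1)) α

theorem contract_mulTwo (v : V) (Ω : V [⋀^Fin 2]→L[ℝ] ℝ) :
    contract v * mulTwo Ω = mulTwo Ω * contract v + mulOne (contractLast v Ω) := by
  refine LinearMap.ext fun θ => funext fun p => ?_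
  rcases p with _ | _ | p
  · exact (add_zero _).symm
  · refine (contractLast_wedge_two_zero v (θ 0) Ω).trans ?_
    exact (zero_add _).symm
  · exact (contractLast_wedge_two_succ v (θ (p + 1)) Ω).trans (add_comm _ _)

theorem contract_mulOne_apply (v : V) (α : V [⋀^Fin 1]→L[ℝ] ℝ) (θ : GradedForm V) :
    contract v (mulOne α θ) = (α fun _ => v) • θ - mulOne α (contract v θ) :=
  LinearMap.congr_fun (contract_mulOne v α) θ

theorem contract_mulTwo_apply (v : V) (Ω : V [⋀^Fin 2]→L[ℝ] ℝ) (θ : GradedForm V) :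
    contract v (mulTwo Ω θ) = mulTwo Ω (contract v θ) + mulOne (contractLast v Ω) θ :=
  LinearMap.congr_fun (contract_mulTwo v Ω) θ

/-- Induction on the degree: contracting both sides with an arbitrary vector reduces to the relation
one degree lower. Associativity of the wedge product is thereby never needed. -/
theorem mulOne_mulOne (α β : V [⋀^Fin 1]→L[ℝ] ℝ) : mulOne α * mulOne β = -(mulOne β * mulOne α) := by
  suffices h : ∀ p (θ : GradedForm V), mulOne α (mulOne β θ) p = -mulOne β (mulOne α θ) p from
    LinearMap.ext fun θ => funext fun p => h p θ
  intro p
  induction p with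
  | zero => intro θ; exact (neg_zero).symm
  | succ p ih =>
    intro θ
    refine eq_of_contractLast_eq fun v => ?_
    change contract v (mulOne α (mulOne β θ)) p = -contract v (mulOne β (mulOne α θ)) p
    simp only [contract_mulOne_apply, map_sub, map_smul, Pi.sub_apply, Pi.smul_apply, ih]
    abel

theorem mulOne_mulTwo (α : V [⋀^Fin 1]→L[ℝ] ℝ) (Ω : V [⋀^Fin 2]→L[ℝ] ℝ) :
    Commute (mulOne α) (mulTwo Ω) := by
  suffices h : ∀ p (θ : GradedForm V), mulOne α (mulTwo Ω θ) p = mulTwo Ω (mulOne α θ) p from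
    LinearMap.ext fun θ => funext fun p => h p θ
  intro p
  induction p with
  | zero => intro θ; rfl
  | succ p ih =>
    intro θ
    refine eq_of_contractLast_eq fun v => ?_
    change contract v (mulOne α (mulTwo Ω θ)) p = contract v (mulTwo Ω (mulOne α θ)) p
    have h := congrFun (LinearMap.congr_fun (mulOne_mulOne α (contractLast v Ω)) θ) p
    simp only [Module.End.mul_apply, LinearMap.neg_apply, Pi.neg_apply] at h
    simp only [contract_mulOne_apply, contract_mulTwo_apply, map_sub, map_smul, map_add,
      Pi.sub_apply, Pi.smul_apply, Pi.add_apply, ih, h]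
    abel

theorem contractLast_contractLast {p : ℕ} (u v : V) (θ : V [⋀^Fin (p + 2)]→L[ℝ] ℝ) :
    contractLast u (contractLast v θ) = -contractLast v (contractLast u θ) := by
  ext w
  have hne : (Fin.last p).castSucc ≠ Fin.last (p + 1) := by simp [Fin.ext_iff]
  have h := θ.toAlternatingMap.map_swap
    (Fin.snoc (α := fun _ => V) (Fin.snoc (α := fun _ => V) w v) u) hne
  refine Eq.trans (congrArg θ ?_) h
  funext i
  induction i using Fin.lastCases with
  | last => simp
  | cast i =>
    induction i using Fin.lastCases with
    | last => simp
    | cast i =>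
      rw [Function.comp_apply, Equiv.swap_apply_of_ne_of_ne]
      · simp
      · simp [Fin.ext_iff]; omega
      · simp [Fin.ext_iff]; omega

theorem contractLast_add_left {p : ℕ} (u v : V) (θ : V [⋀^Fin (p + 1)]→L[ℝ] ℝ) :
    contractLast (u + v) θ = contractLast u θ + contractLast v θ := by
  ext w
  have h := fun z => Fin.update_snoc_last (α := fun _ => V) (x := 0) (p := w) (z := z)
  simp only [contractLast_apply, ContinuousAlternatingMap.add_apply]
  rw [← h u, ← h v, ← h, θ.map_update_add]

theorem contractLast_smul_left {p : ℕ} (c : ℝ) (v : V) (θ : V [⋀^Fin (p + 1)]→L[ℝ] ℝ) :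
    contractLast (c • v) θ = c • contractLast v θ := by
  ext w
  have h := fun z => Fin.update_snoc_last (α := fun _ => V) (x := 0) (p := w) (z := z)
  simp only [contractLast_apply, ContinuousAlternatingMap.smul_apply]
  rw [← h v, ← h, θ.map_update_smul]

theorem contract_contract (u v : V) (θ : GradedForm V) :
    contract u (contract v θ) = -contract v (contract u θ) :=
  funext fun p => contractLast_contractLast u v (θ (p + 2))

theorem eq_zero_of_eq_neg_self {E : Type*} [AddCommGroup E] [Module ℝ E] {x : E}
    (h : x = -x) : x = 0 := by
  have h2 : (2 : ℝ) • x = 0 := by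
    rw [two_smul]
    nth_rewrite 1 [h]
    exact neg_add_cancel x
  simpa using h2

theorem contract_contract_self (v : V) (θ : GradedForm V) : contract v (contract v θ) = 0 :=
  eq_zero_of_eq_neg_self (contract_contract v v θ)

theorem mulOne_mulOne_self (α : V [⋀^Fin 1]→L[ℝ] ℝ) (θ : GradedForm V) :
    mulOne α (mulOne α θ) = 0 :=
  eq_zero_of_eq_neg_self (LinearMap.congr_fun (mulOne_mulOne α α) θ)

/-- Iterates the Leibniz rule for Ω; the m+1 equal terms collect because right multiplications by a
1-form and by Ω commute. -/
theorem contract_mulTwo_pow (v : V) (Ω : V [⋀^Fin 2]→L[ℝ] ℝ) (m : ℕ) (θ : GradedForm V) :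
    contract v ((mulTwo Ω ^ (m + 1)) θ) = (mulTwo Ω ^ (m + 1)) (contract v θ) +
      (m + 1 : ℝ) • mulOne (contractLast v Ω) ((mulTwo Ω ^ m) θ) := by
  induction m with
  | zero => simpa using contract_mulTwo_apply v Ω θ
  | succ m ih =>
    have h : ∀ (l : ℕ) (η : GradedForm V),
        (mulTwo Ω ^ (l + 1)) η = mulTwo Ω ((mulTwo Ω ^ l) η) :=
      fun l η => by rw [pow_succ', Module.End.mul_apply]
    have hc : ∀ η : GradedForm V, mulOne (contractLast (p := 1) v Ω) (mulTwo Ω η) =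
        mulTwo Ω (mulOne (contractLast (p := 1) v Ω) η) := fun η =>
      LinearMap.congr_fun (mulOne_mulTwo (contractLast (p := 1) v Ω) Ω) η
    rw [h (m + 1) θ, contract_mulTwo_apply, ih, h (m + 1), map_add, map_smul, add_assoc,
      h m θ, hc, Nat.cast_succ, add_smul (m + 1 : ℝ) 1, one_smul]

theorem mulTwo_pow_mulOne (α : V [⋀^Fin 1]→L[ℝ] ℝ) (Ω : V [⋀^Fin 2]→L[ℝ] ℝ) (m : ℕ)
    (θ : GradedForm V) : (mulTwo Ω ^ m) (mulOne α θ) = mulOne α ((mulTwo Ω ^ m) θ) :=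
  (LinearMap.congr_fun ((mulOne_mulTwo α Ω).pow_right m) θ).symm

theorem mulTwo_pow_mulTwo_pow (Ω : V [⋀^Fin 2]→L[ℝ] ℝ) (m l : ℕ)
    (θ : GradedForm V) : (mulTwo Ω ^ m) ((mulTwo Ω ^ l) θ) = (mulTwo Ω ^ (m + l)) θ := by
  rw [pow_add, Module.End.mul_apply]

/-- All components outside degree `p` vanish. -/
def IsHomogeneous (p : ℕ) (θ : GradedForm V) : Prop := ∀ q, q ≠ p → θ q = 0

theorem isHomogeneous_single (p : ℕ) (θ : V [⋀^Fin p]→L[ℝ] ℝ) :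
    IsHomogeneous p (Pi.single p θ : GradedForm V) := fun _ hq => by
  rw [Pi.single_eq_of_ne hq]

namespace IsHomogeneous

variable {p : ℕ} {θ η : GradedForm V}

theorem eq_single (h : IsHomogeneous p θ) : θ = Pi.single p (θ p) := by
  funext q
  by_cases hq : q = p
  · subst hq; rw [Pi.single_eq_same]
  · rw [h q hq, Pi.single_eq_of_ne hq]

theorem eq_zero (h : IsHomogeneous p θ) (h0 : θ p = 0) : θ = 0 := by
  rw [h.eq_single, h0, Pi.single_zero]

theorem add (h : IsHomogeneous p θ) (h' : IsHomogeneous p η) : IsHomogeneous p (θ + η) :=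
  fun q hq => by rw [Pi.add_apply, h q hq, h' q hq, add_zero]

theorem sub (h : IsHomogeneous p θ) (h' : IsHomogeneous p η) : IsHomogeneous p (θ - η) :=
  fun q hq => by rw [Pi.sub_apply, h q hq, h' q hq, sub_zero]

theorem smul (c : ℝ) (h : IsHomogeneous p θ) : IsHomogeneous p (c • θ) :=
  fun q hq => by rw [Pi.smul_apply, h q hq, smul_zero]

theorem zero : IsHomogeneous p (0 : GradedForm V) := fun _ _ => rfl

theorem sum {ι : Type*} {s : Finset ι} {f : ι → GradedForm V}
    (h : ∀ j ∈ s, IsHomogeneous p (f j)) : IsHomogeneous p (∑ j ∈ s, f j) :=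
  fun q hq => by rw [Finset.sum_apply, Finset.sum_eq_zero fun j hj => h j hj q hq]

theorem wedge_zero_left {q : ℕ} (α : V [⋀^Fin q]→L[ℝ] ℝ) :
    wedge (0 : V [⋀^Fin p]→L[ℝ] ℝ) α = 0 := by
  simpa using wedge_smul_left 0 (0 : V [⋀^Fin p]→L[ℝ] ℝ) α

theorem mulOne (α : V [⋀^Fin 1]→L[ℝ] ℝ) (h : IsHomogeneous p θ) :
    IsHomogeneous (p + 1) (mulOne α θ) := by
  rintro (_ | q) hq
  · rfl
  · rw [mulOne_succ_apply, h q (by omega), wedge_zero_left]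

theorem mulTwo (Ω : V [⋀^Fin 2]→L[ℝ] ℝ) (h : IsHomogeneous p θ) :
    IsHomogeneous (p + 2) (mulTwo Ω θ) := by
  rintro (_ | _ | q) hq
  · rfl
  · rfl
  · rw [mulTwo_succ_apply, h q (by omega), wedge_zero_left]

theorem mulTwo_pow (Ω : V [⋀^Fin 2]→L[ℝ] ℝ) (m : ℕ) (h : IsHomogeneous p θ) :
    IsHomogeneous (p + 2 * m) ((ContactForms.mulTwo Ω ^ m) θ) := by
  induction m with
  | zero => exact h
  | succ m ih =>
    rw [pow_succ', Module.End.mul_apply]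
    exact ih.mulTwo Ω

theorem contract (v : V) (h : IsHomogeneous (p + 1) θ) : IsHomogeneous p (contract v θ) :=
  fun q hq => by rw [contract_apply, h (q + 1) (by omega)]; rfl

theorem contract_zero (v : V) (h : IsHomogeneous 0 θ) : ContactForms.contract v θ = 0 :=
  funext fun q => by rw [contract_apply, h (q + 1) (by omega)]; rfl

theorem eq_zero_of_contract (h : IsHomogeneous (p + 1) θ)
    (h' : ∀ v, ContactForms.contract v θ = 0) : θ = 0 :=
  h.eq_zero (eq_of_contractLast_eq fun v => congrFun (h' v) p)

end IsHomogeneous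

theorem wedge_zero_right {p q : ℕ} (θ : V [⋀^Fin p]→L[ℝ] ℝ) :
    wedge θ (0 : V [⋀^Fin q]→L[ℝ] ℝ) = 0 := by
  simpa using wedge_smul_right 0 θ (0 : V [⋀^Fin q]→L[ℝ] ℝ)

/-- A form of degree at least two vanishes if its contractions with the kernel of a nonzero
1-form do. -/
theorem eq_zero_of_contract_ker {p : ℕ} {θ : GradedForm V} (hθ : IsHomogeneous (p + 2) θ)
    {α : V [⋀^Fin 1]→L[ℝ] ℝ} {R : V} (hR : α (fun _ => R) = 1)
    (h : ∀ v, α (fun _ => v) = 0 → contract v θ = 0) : θ = 0 := by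
  have hlin : ∀ (v : V) (η : GradedForm V), contract v η =
      contract (v - α (fun _ => v) • R) η + α (fun _ => v) • contract R η := by
    intro v η
    funext p
    have h := contractLast_add_left (v - α (fun _ => v) • R) (α (fun _ => v) • R) (η (p + 1))
    rw [sub_add_cancel, contractLast_smul_left] at h
    exact h
  have hker : ∀ v : V, α (fun _ => v - α (fun _ => v) • R) = 0 := by
    intro v
    have h := contractLast_add_left (v - α (fun _ => v) • R) (α (fun _ => v) • R) α
    rw [sub_add_cancel, contractLast_smul_left] at h
    have h := congrArg (fun f => f 0) h
    simp only [ContinuousAlternatingMap.add_apply, ContinuousAlternatingMap.smul_apply,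
      contractLast_zero_apply, hR, smul_eq_mul, mul_one] at h
    linarith
  -- Contractions of i_R θ with the kernel vanish by anticommutation, that with R because i_R i_R =
  -- 0. Degree at least two makes the degree of i_R θ positive; in degree one α itself would be a
  -- counterexample.
  have h1 : contract R θ = 0 := by
    refine (hθ.contract R).eq_zero_of_contract fun v => ?_
    rw [hlin, contract_contract, h _ (hker v), contract_contract_self]
    simp
  refine hθ.eq_zero_of_contract fun v => ?_
  rw [hlin, h _ (hker v), h1]
  simp

end Graded

/-! ### Dimensions of spaces of forms -/

section Dimension

variable {V : Type*} [AddCommGroup V] [Module ℝ V] [TopologicalSpace V]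
  [IsTopologicalAddGroup V] [ContinuousSMul ℝ V] [T2Space V] [FiniteDimensional ℝ V]

theorem continuous_multilinearMap {k : ℕ} (f : MultilinearMap ℝ (fun _ : Fin k => V) ℝ) :
    Continuous f := by
  let b := Module.finBasis ℝ V
  have h : ∀ v, f v = ∑ s : Fin k → Fin (Module.finrank ℝ V),
      (∏ i, b.coord (s i) (v i)) * f fun i => b (s i) := by
    intro v
    conv_lhs => rw [show v = fun i => ∑ j, b.coord j (v i) • b j from
      funext fun i => (b.sum_repr (v i)).symm]
    rw [f.map_sum]
    exact Finset.sum_congr rfl fun s _ => f.map_smul_univ _ _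
  rw [show (f : (Fin k → V) → ℝ) = _ from funext h]
  refine continuous_finsetSum _ fun s _ => (continuous_finsetProd _ fun i _ => ?_).mul
    continuous_const
  exact (LinearMap.continuous_of_finiteDimensional (b.coord (s i))).comp (continuous_apply i)

variable (V) in
/-- In finite dimension all alternating maps are continuous. -/
def alternatingEquiv (k : ℕ) : (V [⋀^Fin k]→L[ℝ] ℝ) ≃ₗ[ℝ] (V [⋀^Fin k]→ₗ[ℝ] ℝ) where
  toFun f := f.toAlternatingMap
  map_add' _ _ := rfl
  map_smul' _ _ := rfl
  invFun f := { f with cont := continuous_multilinearMap f.toMultilinearMap }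
  left_inv _ := rfl
  right_inv _ := rfl

variable (V) in
/-- Forms as functionals on the exterior power. -/
def exteriorPowerEquiv (k : ℕ) : (V [⋀^Fin k]→L[ℝ] ℝ) ≃ₗ[ℝ] Module.Dual ℝ (⋀[ℝ]^k V) :=
  (alternatingEquiv V k).trans exteriorPower.alternatingMapLinearEquiv

instance finiteDimensional_form (k : ℕ) : FiniteDimensional ℝ (V [⋀^Fin k]→L[ℝ] ℝ) :=
  Module.Finite.equiv (exteriorPowerEquiv V k).symm

theorem finrank_form (k : ℕ) :
    Module.finrank ℝ (V [⋀^Fin k]→L[ℝ] ℝ) = (Module.finrank ℝ V).choose k := by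
  rw [(exteriorPowerEquiv V k).finrank_eq, Subspace.dual_finrank_eq, exteriorPower.finrank_eq]

theorem form_eq_zero_of_finrank_lt {k : ℕ} (hk : Module.finrank ℝ V < k)
    (θ : V [⋀^Fin k]→L[ℝ] ℝ) : θ = 0 := by
  have h := finrank_form (V := V) k
  rw [Nat.choose_eq_zero_of_lt hk, Module.finrank_zero_iff] at h
  exact Subsingleton.elim _ _

theorem IsHomogeneous.eq_zero_of_finrank_lt {p : ℕ} {θ : GradedForm V} (h : IsHomogeneous p θ)
    (hp : Module.finrank ℝ V < p) : θ = 0 :=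
  h.eq_zero (form_eq_zero_of_finrank_lt hp _)

end Dimension

/-! ### Contact pairs, injectivity of hard Lefschetz, restriction to the kernel -/

section Contact

variable {V : Type*} [AddCommGroup V] [Module ℝ V] [TopologicalSpace V]
  [IsTopologicalAddGroup V] [ContinuousSMul ℝ V]

variable (V) in
/-- The unit of the exterior algebra. -/
def unitForm : GradedForm V := Pi.single 0 (ContinuousAlternatingMap.constOfIsEmpty ℝ V (Fin 0) 1)

theorem isHomogeneous_unitForm : IsHomogeneous 0 (unitForm V) := isHomogeneous_single _ _

theorem eq_smul_unitForm {θ : GradedForm V} (h : IsHomogeneous 0 θ) :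
    ∃ c : ℝ, θ = c • unitForm V := by
  refine ⟨θ 0 0, funext fun p => ?_⟩
  rw [Pi.smul_apply]
  by_cases hp : p = 0
  · subst hp
    ext v
    rw [unitForm, Pi.single_eq_same, Subsingleton.elim v 0]
    simp
  · rw [h p hp, isHomogeneous_unitForm p hp, smul_zero]

theorem mulOne_unitForm (α : V [⋀^Fin 1]→L[ℝ] ℝ) :
    mulOne α (unitForm V) = Pi.single 1 α := by
  have h1 : IsHomogeneous 1 (mulOne α (unitForm V)) := isHomogeneous_unitForm.mulOne α
  rw [h1.eq_single]
  congr 1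
  refine eq_of_contractLast_eq (p := 0) fun v => ?_
  refine (contractLast_wedge_one_zero v (unitForm V 0) α).trans ?_
  ext w
  rw [unitForm, Pi.single_eq_same, Subsingleton.elim w 0, contractLast_zero_apply]
  simp

/-- `α ∧ Ω^n ≠ 0`. -/
def IsContactPair (n : ℕ) (α : V [⋀^Fin 1]→L[ℝ] ℝ) (Ω : V [⋀^Fin 2]→L[ℝ] ℝ) : Prop :=
  (mulTwo Ω ^ n) (mulOne α (unitForm V)) ≠ 0

variable {n : ℕ} {α : V [⋀^Fin 1]→L[ℝ] ℝ} {Ω : V [⋀^Fin 2]→L[ℝ] ℝ}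

theorem IsContactPair.ne_zero (h : IsContactPair n α Ω) : α ≠ 0 := by
  rintro rfl
  apply h
  rw [mulOne_unitForm, Pi.single_zero, map_zero]

theorem exists_apply_eq_one (hα : α ≠ 0) : ∃ R : V, α (fun _ => R) = 1 := by
  by_contra! h
  apply hα
  refine eq_of_contractLast_eq (p := 0) fun v => ?_
  ext w
  rw [Subsingleton.elim w 0, contractLast_zero_apply]
  by_contra hv
  have hv : α (fun _ => v) ≠ 0 := hv
  apply h ((α fun _ => v)⁻¹ • v)
  have := congrArg (fun f => f 0) (contractLast_smul_left (α fun _ => v)⁻¹ v α)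
  simp only [contractLast_zero_apply, ContinuousAlternatingMap.smul_apply, smul_eq_mul] at this
  rw [this, inv_mul_cancel₀ hv]

/-- Injectivity in the hard Lefschetz theorem, modulo `α`. -/
theorem IsContactPair.mulOne_eq_zero (h : IsContactPair n α Ω) {k : ℕ} (hk : k ≤ n)
    {θ : GradedForm V} (hθ : IsHomogeneous k θ) (h0 : (mulTwo Ω ^ (n - k)) (mulOne α θ) = 0) :
    mulOne α θ = 0 := by
  obtain ⟨R, hR⟩ := exists_apply_eq_one h.ne_zero
  induction k generalizing θ with
  | zero =>
    obtain ⟨c, rfl⟩ := eq_smul_unitForm hθ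
    rw [map_smul, map_smul, smul_eq_zero] at h0
    rcases h0 with rfl | h0
    · rw [zero_smul, map_zero]
    · exact absurd h0 h
  | succ k ih =>
    refine eq_zero_of_contract_ker (hθ.mulOne α) hR fun v hv => ?_
    have hc : ∀ η : GradedForm V, contract v (mulOne α η) = -mulOne α (contract v η) :=
      fun η => by rw [contract_mulOne_apply, hv, zero_smul, zero_sub]
    rw [hc, neg_eq_zero]
    refine ih (by omega) (hθ.contract v) ?_
    -- Contract L^(n-k)(θ ∧ α) = 0 with v in ker α. The commutator term contains L^(n-k-1)(θ ∧ α),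
    -- which vanishes by assumption, so L^(n-k)(i_v θ ∧ α) = 0 and the induction hypothesis applies
    -- to i_v θ.
    have h1 := contract_mulTwo_pow v Ω (n - (k + 1)) (mulOne α θ)
    rw [show n - (k + 1) + 1 = n - k by omega, h0, map_zero, smul_zero, add_zero, hc,
      map_neg, show n - k = n - (k + 1) + 1 by omega, pow_succ', Module.End.mul_apply, h0,
      map_zero, map_zero] at h1
    rw [show n - k = n - (k + 1) + 1 by omega, pow_succ', Module.End.mul_apply]
    exact neg_eq_zero.1 h1.symm

/-- A form vanishes on the kernel of `α` if and only if its product with `α` vanishes. -/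
theorem restrictTo_eq_zero_iff (hα : α ≠ 0) {Q : Submodule ℝ V}
    (hQ : ∀ v, v ∈ Q ↔ α (fun _ => v) = 0) {p : ℕ} (θ : V [⋀^Fin p]→L[ℝ] ℝ) :
    restrictTo Q θ = 0 ↔ wedge θ α = 0 := by
  obtain ⟨R, hR⟩ := exists_apply_eq_one hα
  constructor
  · intro h
    suffices H : ∀ p (θ : V [⋀^Fin p]→L[ℝ] ℝ), restrictTo Q θ = 0 →
        mulOne α (Pi.single p θ) = 0 by
      have := congrFun (H p θ h) (p + 1)
      rwa [mulOne_succ_apply, Pi.single_eq_same] at this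
    clear h θ p
    intro p
    induction p with
    | zero =>
      intro θ h
      have : θ = 0 := by
        ext w
        rw [Subsingleton.elim w 0]
        exact congrArg (fun f => f 0) h
      rw [this, Pi.single_zero, map_zero]
    | succ p ih =>
      intro θ h
      -- For v in the kernel, i_v(θ ∧ α) = -(i_v θ) ∧ α, and i_v θ vanishes on Q in degree one less.
      refine eq_zero_of_contract_ker ((isHomogeneous_single _ _).mulOne α) hR fun v hv => ?_
      rw [contract_mulOne_apply, hv, zero_smul, zero_sub, neg_eq_zero,
        ((isHomogeneous_single (p + 1) θ).contract v).eq_single, contract_apply,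
        Pi.single_eq_same]
      refine ih _ ?_
      ext w
      refine Eq.trans (congrArg θ ?_) (congrArg (fun f => f (Fin.snoc (α := fun _ => Q) w
        ⟨v, (hQ v).2 hv⟩)) h)
      funext i
      induction i using Fin.lastCases <;> simp
  · intro h
    have h0 : mulOne α (Pi.single p θ) = 0 := by
      refine ((isHomogeneous_single p θ).mulOne α).eq_zero ?_
      rwa [mulOne_succ_apply, Pi.single_eq_same]
    -- Contracting θ ∧ α = 0 with R gives θ = (i_R θ) ∧ α, which vanishes on ker α.
    have h1 := contract_mulOne_apply R α (Pi.single p θ)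
    rw [h0, map_zero, hR, one_smul] at h1
    have h2 := congrFun (sub_eq_zero.1 h1.symm) p
    rw [Pi.single_eq_same] at h2
    rw [h2]
    rcases p with _ | p
    · rfl
    · rw [mulOne_succ_apply]
      refine (wedge_compContinuousLinearMap Q.subtypeL _ α).trans ?_
      have : α.compContinuousLinearMap Q.subtypeL = 0 := by
        ext w
        refine Eq.trans (congrArg α ?_) ((hQ (w 0)).1 (w 0).2)
        funext i
        fin_cases i
        rfl
      rw [this, wedge_zero_right]

end Contact

/-! ### Reeb vector, surjectivity of hard Lefschetz, Lefschetz decomposition -/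

section Lefschetz

variable {V : Type*} [AddCommGroup V] [Module ℝ V] [TopologicalSpace V]
  [IsTopologicalAddGroup V] [ContinuousSMul ℝ V] [T2Space V] [FiniteDimensional ℝ V]

variable {n : ℕ} {α : V [⋀^Fin 1]→L[ℝ] ℝ} {Ω : V [⋀^Fin 2]→L[ℝ] ℝ}

/-- Such a v kills the volume form vol = α ∧ Ω^n. For every 1-form β the product vol ∧ β is zero for
reasons of degree, and contracting it with v gives β(v) vol = 0. -/
theorem IsContactPair.eq_zero_of_contractLast (h : IsContactPair n α Ω)
    (hV : Module.finrank ℝ V = 2 * n + 1) {v : V} (hα : α (fun _ => v) = 0)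
    (hΩ : contractLast (p := 1) v Ω = 0) : v = 0 := by
  have hvol : contract v ((mulTwo Ω ^ n) (mulOne α (unitForm V))) = 0 := by
    have h0 : contract v (mulOne α (unitForm V)) = 0 := by
      rw [contract_mulOne_apply, hα, zero_smul, isHomogeneous_unitForm.contract_zero, map_zero,
        sub_zero]
    rcases n with _ | n
    · simpa using h0
    · have h1 : ∀ η : GradedForm V, mulOne (0 : V [⋀^Fin 1]→L[ℝ] ℝ) η = 0 := by
        intro η
        funext p
        rcases p with _ | p
        · rfl
        · exact wedge_zero_right _
      rw [contract_mulTwo_pow, h0, map_zero, hΩ, h1, smul_zero, add_zero]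
  have hβ : ∀ β : V [⋀^Fin 1]→L[ℝ] ℝ, β (fun _ => v) = 0 := by
    intro β
    have h1 : mulOne β ((mulTwo Ω ^ n) (mulOne α (unitForm V))) = 0 :=
      (((isHomogeneous_unitForm.mulOne α).mulTwo_pow Ω n).mulOne β).eq_zero_of_finrank_lt
        (by omega)
    have h2 := contract_mulOne_apply v β ((mulTwo Ω ^ n) (mulOne α (unitForm V)))
    rw [h1, map_zero, hvol, map_zero, sub_zero, eq_comm, smul_eq_zero] at h2
    exact h2.resolve_right h
  exact (Module.forall_dual_apply_eq_zero_iff ℝ v).1 fun f => (hβ (ContinuousAlternatingMap.ofSubsingleton ℝ V ℝ 0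
    (LinearMap.toContinuousLinearMap f)))

theorem contractLast_self (v : V) (Ω : V [⋀^Fin 2]→L[ℝ] ℝ) :
    contractLast (p := 1) v Ω (fun _ => v) = 0 := by
  rw [contractLast_apply]
  exact Ω.map_eq_zero_of_eq _ (i := 0) (j := 1) (by simp [Fin.snoc]) (by simp)

/-- A Reeb vector exists. -/
theorem IsContactPair.exists_reeb (h : IsContactPair n α Ω)
    (hV : Module.finrank ℝ V = 2 * n + 1) :
    ∃ R : V, α (fun _ => R) = 1 ∧ contractLast (p := 1) R Ω = 0 := by
  have hadd : ∀ u v : V, α (fun _ => u + v) = α (fun _ => u) + α (fun _ => v) := fun u v => by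
    simpa only [contractLast_zero_apply, ContinuousAlternatingMap.add_apply] using
      congrArg (fun f => f 0) (contractLast_add_left u v α)
  have hsmul : ∀ (c : ℝ) (v : V), α (fun _ => c • v) = c * α (fun _ => v) := fun c v => by
    simpa only [contractLast_zero_apply, ContinuousAlternatingMap.smul_apply, smul_eq_mul] using
      congrArg (fun f => f 0) (contractLast_smul_left c v α)
  -- Since (T v)(v) = α(v)², a vector of the kernel of T is killed by α and Ω, so T is bijective.
  -- The Reeb vector will be the preimage of α; evaluating T R = α at R gives α(R)² = α(R).
  let T : V →ₗ[ℝ] V [⋀^Fin 1]→L[ℝ] ℝ :=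
    { toFun := fun v => contractLast (p := 1) v Ω + α (fun _ => v) • α
      map_add' := fun u v => by
        rw [contractLast_add_left, hadd, add_smul]; abel
      map_smul' := fun c v => by
        rw [contractLast_smul_left, hsmul, mul_smul, ← smul_add]; rfl }
  have hTv : ∀ v, T v (fun _ => v) = α (fun _ => v) * α (fun _ => v) := by
    intro v
    change contractLast (p := 1) v Ω (fun _ => v) + α (fun _ => v) • α (fun _ => v) = _
    rw [contractLast_self, zero_add, smul_eq_mul]
  have hinj : Function.Injective T := by
    rw [injective_iff_map_eq_zero]
    intro v hv
    have h1 : α (fun _ => v) = 0 := by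
      have := hTv v
      rw [hv] at this
      exact mul_self_eq_zero.1 this.symm
    refine h.eq_zero_of_contractLast hV h1 ?_
    have h2 : contractLast (p := 1) v Ω + α (fun _ => v) • α = 0 := hv
    rwa [h1, zero_smul, add_zero] at h2
  have hdim : Module.finrank ℝ V = Module.finrank ℝ (V [⋀^Fin 1]→L[ℝ] ℝ) := by
    rw [finrank_form, Nat.choose_one_right]
  obtain ⟨R, hR⟩ := (LinearMap.injective_iff_surjective_of_finrank_eq_finrank hdim).1 hinj α
  have hR' : contractLast (p := 1) R Ω + α (fun _ => R) • α = α := hR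
  have hsq : α (fun _ => R) = α (fun _ => R) * α (fun _ => R) := by rw [← hTv, hR]
  have h01 : α (fun _ => R) = 0 ∨ α (fun _ => R) = 1 := by
    rcases eq_or_ne (α fun _ => R) 0 with h0 | h0
    · exact Or.inl h0
    · exact Or.inr ((mul_eq_left₀ h0).1 hsq.symm)
  rcases h01 with h0 | h1
  · exfalso
    rw [h0, zero_smul, add_zero] at hR'
    -- If α(R) = 0, then i_R Ω = α, and contracting Ω^(n+1) = 0 with R gives (n+1) α ∧ Ω^n = 0, a
    -- contradiction.
    have h2 : (mulTwo Ω ^ (n + 1)) (unitForm V) = 0 :=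
      (isHomogeneous_unitForm.mulTwo_pow Ω (n + 1)).eq_zero_of_finrank_lt (by omega)
    have h3 := contract_mulTwo_pow R Ω n (unitForm V)
    rw [h2, map_zero, isHomogeneous_unitForm.contract_zero, map_zero, zero_add, hR',
      ← mulTwo_pow_mulOne, eq_comm, smul_eq_zero] at h3
    rcases h3 with h3 | h3
    · have : (n : ℝ) + 1 ≠ 0 := by positivity
      exact this h3
    · exact h h3
  · refine ⟨R, h1, ?_⟩
    rwa [h1, one_smul, add_eq_right] at hR'

/-- Surjectivity in the hard Lefschetz theorem, modulo `α`. -/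
theorem IsContactPair.exists_mulOne_eq (h : IsContactPair n α Ω)
    (hV : Module.finrank ℝ V = 2 * n + 1) {k : ℕ} (hk : k ≤ n) {ψ : GradedForm V}
    (hψ : IsHomogeneous (2 * n - k) ψ) :
    ∃ θ, IsHomogeneous k θ ∧ (mulTwo Ω ^ (n - k)) (mulOne α θ) = mulOne α ψ := by
  obtain ⟨R, hR, -⟩ := h.exists_reeb hV
  -- The second term is added so that B is injective on all k-forms, also on multiples of α. It maps
  -- them to forms of degree 2n+1-k, a space of the same dimension, so B is onto there.
  let B : Module.End ℝ (GradedForm V) :=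
    mulTwo Ω ^ (n - k) * mulOne α + mulTwo Ω ^ (n - k + 1) * contract R
  have hB : ∀ θ, B θ = (mulTwo Ω ^ (n - k)) (mulOne α θ) +
    (mulTwo Ω ^ (n - k + 1)) (contract R θ) := fun _ => rfl
  -- Multiplication by α removes the first term of B; injectivity in degree k-1 then gives (i_R θ) ∧
  -- α = 0, and contraction with R gives i_R θ = 0.
  have hcontr : ∀ θ, IsHomogeneous k θ → mulOne α (B θ) = 0 → contract R θ = 0 := by
    intro θ hθ h0
    rw [hB, map_add, ← mulTwo_pow_mulOne, mulOne_mulOne_self, map_zero, zero_add,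
      ← mulTwo_pow_mulOne] at h0
    rcases k with _ | k
    · exact hθ.contract_zero R
    · have h1 := h.mulOne_eq_zero (k := k) (by omega) (hθ.contract R)
        (by rwa [show n - k = n - (k + 1) + 1 by omega])
      have h2 := contract_mulOne_apply R α (contract R θ)
      rw [h1, contract_contract_self, map_zero, map_zero, sub_zero, hR, one_smul] at h2
      exact h2.symm
  have hBhom : ∀ θ, IsHomogeneous k θ → IsHomogeneous (2 * n + 1 - k) (B θ) := by
    intro θ hθ
    rw [hB]
    refine IsHomogeneous.add ?_ ?_
    · have := (hθ.mulOne α).mulTwo_pow Ω (n - k)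
      rwa [show k + 1 + 2 * (n - k) = 2 * n + 1 - k by omega] at this
    · rcases k with _ | k
      · rw [hθ.contract_zero, map_zero]
        exact IsHomogeneous.zero
      · have := (hθ.contract R).mulTwo_pow Ω (n - (k + 1) + 1)
        rwa [show k + 2 * (n - (k + 1) + 1) = 2 * n + 1 - (k + 1) by omega] at this
  have hBinj : ∀ θ, IsHomogeneous k θ → B θ = 0 → θ = 0 := by
    intro θ hθ h0
    have h1 := hcontr θ hθ (by rw [h0, map_zero])
    rw [hB, h1, map_zero, add_zero] at h0
    have h2 := contract_mulOne_apply R α θ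
    rw [h.mulOne_eq_zero hk hθ h0, h1, map_zero, map_zero, sub_zero, hR, one_smul] at h2
    exact h2.symm
  let C : (V [⋀^Fin k]→L[ℝ] ℝ) →ₗ[ℝ] (V [⋀^Fin (2 * n + 1 - k)]→L[ℝ] ℝ) :=
    (LinearMap.proj (2 * n + 1 - k)).comp (B.comp (LinearMap.single ℝ _ k))
  have hC : ∀ θ, C θ = B (Pi.single k θ) (2 * n + 1 - k) := fun _ => rfl
  have hCinj : Function.Injective C := by
    rw [injective_iff_map_eq_zero]
    intro θ h0
    have h1 := hBinj _ (isHomogeneous_single k θ)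
      ((hBhom _ (isHomogeneous_single k θ)).eq_zero h0)
    exact Pi.single_eq_zero_iff.1 h1
  have hdim : Module.finrank ℝ (V [⋀^Fin k]→L[ℝ] ℝ) =
      Module.finrank ℝ (V [⋀^Fin (2 * n + 1 - k)]→L[ℝ] ℝ) := by
    rw [finrank_form, finrank_form, hV, Nat.choose_symm (by omega)]
  obtain ⟨θ, hθ⟩ := (LinearMap.injective_iff_surjective_of_finrank_eq_finrank hdim).1 hCinj
    (mulOne α ψ (2 * n + 1 - k))
  have hθ' : B (Pi.single k θ) = mulOne α ψ := by
    have h1 := hψ.mulOne α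
    rw [show 2 * n - k + 1 = 2 * n + 1 - k by omega] at h1
    rw [(hBhom _ (isHomogeneous_single k θ)).eq_single, h1.eq_single]
    congr 1
  refine ⟨Pi.single k θ, isHomogeneous_single k θ, ?_⟩
  -- As B θ = ψ ∧ α is a multiple of α, the correction term of B vanishes at this preimage.
  have h1 := hcontr _ (isHomogeneous_single k θ) (by rw [hθ', mulOne_mulOne_self])
  rw [hB, h1, map_zero, add_zero] at hθ'
  exact hθ'

theorem mem_lefschetzIndices {a j : ℕ} :
    j ∈ lefschetzIndices n a ↔ j ≤ a ∧ j + a ≤ 2 * n ∧ j % 2 = a % 2 := by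
  simp only [lefschetzIndices, Finset.mem_filter, Finset.mem_range]
  omega

theorem lefschetzIndices_add_two {a : ℕ} (ha : a + 2 ≤ n) :
    lefschetzIndices n (a + 2) = insert (a + 2) (lefschetzIndices n a) := by
  ext j
  rw [Finset.mem_insert, mem_lefschetzIndices, mem_lefschetzIndices]
  omega

theorem lefschetzIndices_symm {a : ℕ} (ha : a ≤ 2 * n) :
    lefschetzIndices n (2 * n - a) = lefschetzIndices n a := by
  ext j
  rw [mem_lefschetzIndices, mem_lefschetzIndices]
  omega

/-- The Lefschetz decomposition of a form modulo `α`. -/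
structure IsDecomposition (n : ℕ) (α : V [⋀^Fin 1]→L[ℝ] ℝ) (Ω : V [⋀^Fin 2]→L[ℝ] ℝ) (a : ℕ)
    (θ : GradedForm V) (π : ℕ → GradedForm V) : Prop where
  homogeneous : ∀ j, IsHomogeneous j (π j)
  primitive : ∀ j ∈ lefschetzIndices n a, (mulTwo Ω ^ (n - j + 1)) (mulOne α (π j)) = 0
  sum_eq : mulOne α θ = ∑ j ∈ lefschetzIndices n a, (mulTwo Ω ^ ((a - j) / 2)) (mulOne α (π j))

/-- For a ≤ 1 the only index is a itself, and primitivity modulo α is automatic: the degree 2n+3-a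
exceeds 2n+1. -/
theorem exists_isDecomposition_of_le_one (hV : Module.finrank ℝ V = 2 * n + 1) {a : ℕ}
    (ha : a ≤ 1) (han : a ≤ n) {θ : GradedForm V} (hθ : IsHomogeneous a θ) :
    ∃ π, IsDecomposition n α Ω a θ π := by
  have hI : lefschetzIndices n a = {a} := by
    ext j
    rw [mem_lefschetzIndices, Finset.mem_singleton]
    omega
  refine ⟨fun j => if j = a then θ else 0, ⟨fun j => ?_, ?_, ?_⟩⟩
  · split_ifs with hj
    · rwa [hj]
    · exact IsHomogeneous.zero
  · intro j hj
    rw [hI, Finset.mem_singleton] at hj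
    subst hj
    rw [if_pos rfl]
    exact ((hθ.mulOne α).mulTwo_pow Ω _).eq_zero_of_finrank_lt (by omega)
  · simp [hI]

/-- For θ of degree a+2, surjectivity yields an a-form η with L^(n-a) η ≡ L^(n-a-1) θ modulo α. Then
θ - L η is primitive, and η is decomposed by induction. -/
theorem IsContactPair.exists_isDecomposition_of_le (h : IsContactPair n α Ω)
    (hV : Module.finrank ℝ V = 2 * n + 1) : ∀ {a : ℕ}, a ≤ n → ∀ {θ : GradedForm V},
      IsHomogeneous a θ → ∃ π, IsDecomposition n α Ω a θ π
  | 0, ha, _, hθ => exists_isDecomposition_of_le_one hV zero_le_one ha hθ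
  | 1, ha, _, hθ => exists_isDecomposition_of_le_one hV le_rfl ha hθ
  | a + 2, ha, θ, hθ => by
    have h1 : IsHomogeneous (2 * n - a) ((mulTwo Ω ^ (n - (a + 2) + 1)) θ) := by
      have := hθ.mulTwo_pow Ω (n - (a + 2) + 1)
      rwa [show a + 2 + 2 * (n - (a + 2) + 1) = 2 * n - a by omega] at this
    obtain ⟨η, hη, hηθ⟩ := h.exists_mulOne_eq hV (k := a) (by omega) h1
    obtain ⟨π, hπ⟩ := h.exists_isDecomposition_of_le hV (by omega) hη
    have hnot : a + 2 ∉ lefschetzIndices n a := by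
      rw [mem_lefschetzIndices]; omega
    have hne : ∀ j ∈ lefschetzIndices n a, j ≠ a + 2 := fun j hj h => hnot (h ▸ hj)
    refine ⟨fun j => if j = a + 2 then θ - mulTwo Ω η else π j, ⟨fun j => ?_, ?_, ?_⟩⟩
    · split_ifs with hj
      · rw [hj]
        exact hθ.sub (hη.mulTwo Ω)
      · exact hπ.homogeneous j
    · intro j hj
      rw [lefschetzIndices_add_two ha, Finset.mem_insert] at hj
      rcases hj with rfl | hj
      · rw [if_pos rfl, map_sub, map_sub, sub_eq_zero, mulTwo_pow_mulOne, ← hηθ,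
          ← pow_one (mulTwo Ω), ← mulTwo_pow_mulOne, pow_one, show n - a = n - (a + 2) + 1 + 1 by omega, pow_succ,
          Module.End.mul_apply]
      · rw [if_neg (hne j hj)]
        exact hπ.primitive j hj
    · rw [lefschetzIndices_add_two ha, Finset.sum_insert hnot, if_pos rfl, Nat.sub_self,
        Nat.zero_div, pow_zero, Module.End.one_apply, map_sub]
      have h2 : mulOne α (mulTwo Ω η) = mulTwo Ω (mulOne α η) :=
        LinearMap.congr_fun (mulOne_mulTwo α Ω) η
      rw [h2, hπ.sum_eq, map_sum, ← sub_eq_iff_eq_add', sub_sub_cancel]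
      refine Finset.sum_congr rfl fun j hj => ?_
      have hja := (mem_lefschetzIndices.1 hj).1
      rw [if_neg (hne j hj), show (a + 2 - j) / 2 = (a - j) / 2 + 1 by omega, pow_succ',
        Module.End.mul_apply]

/-- Above the middle degree, θ ≡ L^(a-n) η with η of degree 2n-a. The index sets for a and 2n-a
coincide, so a decomposition of η serves for θ. -/
theorem IsContactPair.exists_isDecomposition (h : IsContactPair n α Ω)
    (hV : Module.finrank ℝ V = 2 * n + 1) {a : ℕ} (ha : a ≤ 2 * n) {θ : GradedForm V}
    (hθ : IsHomogeneous a θ) : ∃ π, IsDecomposition n α Ω a θ π := by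
  rcases le_total a n with han | han
  · exact h.exists_isDecomposition_of_le hV han hθ
  · obtain ⟨η, hη, hηθ⟩ := h.exists_mulOne_eq hV (k := 2 * n - a) (by omega)
      (ψ := θ) (by rwa [show 2 * n - (2 * n - a) = a by omega])
    obtain ⟨π, hπ⟩ := h.exists_isDecomposition_of_le hV (by omega) hη
    refine ⟨π, hπ.homogeneous, ?_, ?_⟩
    · rw [← lefschetzIndices_symm ha]
      exact hπ.primitive
    · rw [← hηθ, hπ.sum_eq, map_sum, lefschetzIndices_symm ha]
      refine Finset.sum_congr rfl fun j hj => ?_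
      have := mem_lefschetzIndices.1 hj
      rw [mulTwo_pow_mulTwo_pow]
      congr 2
      omega

/-- In degree a+2, the power L^(n-a-1) annihilates the top primitive component and turns the rest
into L^(n-a) of an a-form. By injectivity that a-form vanishes modulo α; then so does the top
component, and the others follow by induction. -/
theorem IsContactPair.mulOne_eq_zero_of_sum_of_le (h : IsContactPair n α Ω) :
    ∀ {a : ℕ}, a ≤ n → ∀ {π : ℕ → GradedForm V}, (∀ j, IsHomogeneous j (π j)) →
      (∀ j ∈ lefschetzIndices n a, (mulTwo Ω ^ (n - j + 1)) (mulOne α (π j)) = 0) →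
      ∑ j ∈ lefschetzIndices n a, (mulTwo Ω ^ ((a - j) / 2)) (mulOne α (π j)) = 0 →
      ∀ j ∈ lefschetzIndices n a, mulOne α (π j) = 0
  | 0, ha, π, _, _, h0 => by
    have hI : lefschetzIndices n 0 = {0} := by
      ext j; rw [mem_lefschetzIndices, Finset.mem_singleton]; omega
    simpa [hI] using h0
  | 1, ha, π, _, _, h0 => by
    have hI : lefschetzIndices n 1 = {1} := by
      ext j; rw [mem_lefschetzIndices, Finset.mem_singleton]; omega
    simpa [hI] using h0
  | a + 2, ha, π, hπ, hprim, h0 => by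
    have hnot : a + 2 ∉ lefschetzIndices n a := by
      rw [mem_lefschetzIndices]; omega
    rw [lefschetzIndices_add_two ha] at hprim h0 ⊢
    have hsum : ∑ j ∈ lefschetzIndices n a, (mulTwo Ω ^ ((a + 2 - j) / 2)) (mulOne α (π j)) =
        mulTwo Ω (∑ j ∈ lefschetzIndices n a, (mulTwo Ω ^ ((a - j) / 2)) (mulOne α (π j))) := by
      rw [map_sum]
      refine Finset.sum_congr rfl fun j hj => ?_
      have hja := (mem_lefschetzIndices.1 hj).1
      rw [show (a + 2 - j) / 2 = (a - j) / 2 + 1 by omega, pow_succ', Module.End.mul_apply]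
    have hmul : ∑ j ∈ lefschetzIndices n a, (mulTwo Ω ^ ((a - j) / 2)) (mulOne α (π j)) =
        mulOne α (∑ j ∈ lefschetzIndices n a, (mulTwo Ω ^ ((a - j) / 2)) (π j)) := by
      rw [map_sum]
      exact Finset.sum_congr rfl fun j _ => mulTwo_pow_mulOne _ _ _ _
    rw [Finset.sum_insert hnot, Nat.sub_self, Nat.zero_div, pow_zero, Module.End.one_apply,
      hsum] at h0
    have h1 : ∑ j ∈ lefschetzIndices n a, (mulTwo Ω ^ ((a - j) / 2)) (mulOne α (π j)) = 0 := by
      have h2 := congrArg (mulTwo Ω ^ (n - (a + 2) + 1)) h0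
      rw [map_add, hprim _ (Finset.mem_insert_self _ _), zero_add, map_zero,
        ← Module.End.mul_apply, ← pow_succ, show n - (a + 2) + 1 + 1 = n - a by omega,
        hmul] at h2
      rw [hmul]
      refine h.mulOne_eq_zero (by omega) (IsHomogeneous.sum fun j hj => ?_) h2
      have hj' := mem_lefschetzIndices.1 hj
      have := (hπ j).mulTwo_pow Ω ((a - j) / 2)
      rwa [show j + 2 * ((a - j) / 2) = a by omega] at this
    intro j hj
    rcases Finset.mem_insert.1 hj with rfl | hj
    · rwa [h1, map_zero, add_zero] at h0
    · exact h.mulOne_eq_zero_of_sum_of_le (by omega) hπ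
        (fun j hj => hprim j (Finset.mem_insert_of_mem hj)) h1 j hj

/-- For a ≥ n the sum is L^(a-n) of the corresponding sum in degree 2n-a, to which injectivity
applies. -/
theorem IsContactPair.mulOne_eq_zero_of_sum (h : IsContactPair n α Ω) {a : ℕ}
    {π : ℕ → GradedForm V} (hπ : ∀ j, IsHomogeneous j (π j))
    (hprim : ∀ j ∈ lefschetzIndices n a, (mulTwo Ω ^ (n - j + 1)) (mulOne α (π j)) = 0)
    (h0 : ∑ j ∈ lefschetzIndices n a, (mulTwo Ω ^ ((a - j) / 2)) (mulOne α (π j)) = 0) :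
    ∀ j ∈ lefschetzIndices n a, mulOne α (π j) = 0 := by
  rcases le_total a n with han | han
  · exact h.mulOne_eq_zero_of_sum_of_le han hπ hprim h0
  · intro j hj
    have ha : a ≤ 2 * n := by have := mem_lefschetzIndices.1 hj; omega
    rw [← lefschetzIndices_symm ha] at hprim h0 hj
    refine h.mulOne_eq_zero_of_sum_of_le (by omega) hπ hprim ?_ j hj
    have hmul : ∑ j ∈ lefschetzIndices n (2 * n - a),
        (mulTwo Ω ^ ((2 * n - a - j) / 2)) (mulOne α (π j)) =
        mulOne α (∑ j ∈ lefschetzIndices n (2 * n - a),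
          (mulTwo Ω ^ ((2 * n - a - j) / 2)) (π j)) := by
      rw [map_sum]
      exact Finset.sum_congr rfl fun j _ => mulTwo_pow_mulOne _ _ _ _
    rw [hmul]
    refine h.mulOne_eq_zero (k := 2 * n - a) (by omega) (IsHomogeneous.sum fun j hj => ?_) ?_
    · have hj' := mem_lefschetzIndices.1 hj
      have := (hπ j).mulTwo_pow Ω ((2 * n - a - j) / 2)
      rwa [show j + 2 * ((2 * n - a - j) / 2) = 2 * n - a by omega] at this
    · rw [← hmul, map_sum, ← h0]
      refine Finset.sum_congr rfl fun j hj => ?_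
      have := mem_lefschetzIndices.1 hj
      rw [mulTwo_pow_mulTwo_pow]
      congr 2
      omega

/-- The components of a Lefschetz decomposition are unique modulo `α`. -/
theorem IsContactPair.isDecomposition_unique (h : IsContactPair n α Ω) {a : ℕ}
    {θ : GradedForm V} {π π' : ℕ → GradedForm V} (hπ : IsDecomposition n α Ω a θ π)
    (hπ' : IsDecomposition n α Ω a θ π') :
    ∀ j ∈ lefschetzIndices n a, mulOne α (π j) = mulOne α (π' j) := by
  intro j hj
  rw [← sub_eq_zero, ← map_sub]
  refine h.mulOne_eq_zero_of_sum (π := fun j => π j - π' j) (a := a)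
    (fun j => (hπ.homogeneous j).sub (hπ'.homogeneous j)) (fun j hj => ?_) ?_ j hj
  · rw [map_sub, map_sub, hπ.primitive j hj, hπ'.primitive j hj, sub_zero]
  · simp only [map_sub, Finset.sum_sub_distrib]
    rw [← hπ.sum_eq, ← hπ'.sum_eq, sub_self]

end Lefschetz

/-! ### From restrictions to products with α; change of contact form -/

section Translation

variable {V : Type*} [AddCommGroup V] [Module ℝ V] [TopologicalSpace V]
  [IsTopologicalAddGroup V] [ContinuousSMul ℝ V]

theorem single_castDegree {p q : ℕ} (h : p = q) (θ : V [⋀^Fin p]→L[ℝ] ℝ) :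
    (Pi.single q (castDegree h θ) : GradedForm V) = Pi.single p θ := by
  subst h; rfl

theorem mulOne_single (α : V [⋀^Fin 1]→L[ℝ] ℝ) {p : ℕ} (θ : V [⋀^Fin p]→L[ℝ] ℝ) :
    mulOne α (Pi.single p θ) = Pi.single (p + 1) (wedge θ α) := by
  have h := IsHomogeneous.mulOne α (p := p) (θ := Pi.single p θ) fun _ hq => by
    rw [Pi.single_eq_of_ne hq]
  funext q
  by_cases hq : q = p + 1
  · subst hq; rw [mulOne_succ_apply, Pi.single_eq_same, Pi.single_eq_same]
  · rw [h q hq, Pi.single_eq_of_ne hq]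

theorem mulTwo_single (Ω : V [⋀^Fin 2]→L[ℝ] ℝ) {p : ℕ} (θ : V [⋀^Fin p]→L[ℝ] ℝ) :
    mulTwo Ω (Pi.single p θ) = Pi.single (p + 2) (wedge θ Ω) := by
  have h := IsHomogeneous.mulTwo Ω (p := p) (θ := Pi.single p θ) fun _ hq => by
    rw [Pi.single_eq_of_ne hq]
  funext q
  by_cases hq : q = p + 2
  · subst hq; rw [mulTwo_succ_apply, Pi.single_eq_same, Pi.single_eq_same]
  · rw [h q hq, Pi.single_eq_of_ne hq]

theorem mulTwo_pow_single (Ω : V [⋀^Fin 2]→L[ℝ] ℝ) {p : ℕ} (θ : V [⋀^Fin p]→L[ℝ] ℝ) (k : ℕ) :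
    (mulTwo Ω ^ k) (Pi.single p θ) = Pi.single (p + 2 * k) (lefschetzPow Ω θ k) := by
  induction k with
  | zero => rfl
  | succ k ih =>
    rw [pow_succ', Module.End.mul_apply, ih]
    exact mulTwo_single Ω _

theorem isContactPair_iff {n : ℕ} {α : V [⋀^Fin 1]→L[ℝ] ℝ} {Ω : V [⋀^Fin 2]→L[ℝ] ℝ} :
    IsContactPair n α Ω ↔ lefschetzPow Ω α n ≠ 0 := by
  rw [IsContactPair, mulOne_unitForm, mulTwo_pow_single, Ne, Pi.single_eq_zero_iff]

theorem mulOne_single_eq_zero_iff {α : V [⋀^Fin 1]→L[ℝ] ℝ} (hα : α ≠ 0) {Q : Submodule ℝ V}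
    (hQ : ∀ v, v ∈ Q ↔ α (fun _ => v) = 0) {p : ℕ} (θ : V [⋀^Fin p]→L[ℝ] ℝ) :
    mulOne α (Pi.single p θ) = 0 ↔ restrictTo Q θ = 0 := by
  rw [mulOne_single, Pi.single_eq_zero_iff, restrictTo_eq_zero_iff hα hQ]

/-- The bridge between the decomposition by restriction to Q and the operator calculus; inside
graded families the degree casts disappear. -/
theorem isDecomposition_single_iff {n : ℕ} {α : V [⋀^Fin 1]→L[ℝ] ℝ} {Ω : V [⋀^Fin 2]→L[ℝ] ℝ}
    (hα : α ≠ 0) {Q : Submodule ℝ V} (hQ : ∀ v, v ∈ Q ↔ α (fun _ => v) = 0) {a : ℕ}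
    {θ : V [⋀^Fin a]→L[ℝ] ℝ} {π : (j : ℕ) → V [⋀^Fin j]→L[ℝ] ℝ} :
    IsDecomposition n α Ω a (Pi.single a θ) (fun j => Pi.single j (π j)) ↔
      (∀ j ∈ lefschetzIndices n a, restrictTo Q (lefschetzPow Ω (π j) (n - j + 1)) = 0) ∧
      restrictTo Q θ = restrictTo Q (∑ i : lefschetzIndices n a,
        castDegree (lefschetz_degree i) (lefschetzPow Ω (π i) ((a - i) / 2))) := by
  have h1 : ∀ j, (mulTwo Ω ^ (n - j + 1)) (mulOne α (Pi.single j (π j))) = 0 ↔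
      restrictTo Q (lefschetzPow Ω (π j) (n - j + 1)) = 0 := by
    intro j
    rw [mulTwo_pow_mulOne, mulTwo_pow_single, mulOne_single_eq_zero_iff hα hQ]
  have h2 : ∑ j ∈ lefschetzIndices n a, (mulTwo Ω ^ ((a - j) / 2))
      (mulOne α (Pi.single j (π j))) = mulOne α (Pi.single a (∑ i : lefschetzIndices n a,
        castDegree (lefschetz_degree i) (lefschetzPow Ω (π i) ((a - i) / 2)))) := by
    have h3 : (Pi.single a (∑ i : lefschetzIndices n a,
        castDegree (lefschetz_degree i) (lefschetzPow Ω (π i) ((a - i) / 2))) : GradedForm V) =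
        ∑ i : lefschetzIndices n a, (mulTwo Ω ^ ((a - i) / 2)) (Pi.single (i : ℕ) (π i)) := by
      refine (map_sum (LinearMap.single ℝ (fun p => V [⋀^Fin p]→L[ℝ] ℝ) a) _ _).trans ?_
      refine Finset.sum_congr rfl fun i _ => ?_
      rw [mulTwo_pow_single]
      exact single_castDegree _ _
    rw [h3, map_sum, ← Finset.sum_coe_sort]
    exact Finset.sum_congr rfl fun i _ => mulTwo_pow_mulOne _ _ _ _
  have h4 : restrictTo Q θ = restrictTo Q (∑ i : lefschetzIndices n a,
        castDegree (lefschetz_degree i) (lefschetzPow Ω (π i) ((a - i) / 2))) ↔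
      mulOne α (Pi.single a θ) = ∑ j ∈ lefschetzIndices n a, (mulTwo Ω ^ ((a - j) / 2))
      (mulOne α (Pi.single j (π j))) := by
    rw [h2, ← sub_eq_zero, ← sub_eq_zero (a := mulOne α _), ← map_sub, ← Pi.single_sub,
      mulOne_single_eq_zero_iff hα hQ]
    rfl
  rw [h4]
  constructor
  · intro h
    exact ⟨fun j hj => (h1 j).1 (h.primitive j hj), h.sum_eq⟩
  · intro h
    exact ⟨fun j => isHomogeneous_single _ _, fun j hj => (h1 j).2 (h.1 j hj), h.2⟩

theorem mulOne_smul_left (c : ℝ) (α : V [⋀^Fin 1]→L[ℝ] ℝ) (θ : GradedForm V) :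
    mulOne (c • α) θ = c • mulOne α θ := by
  funext p
  rcases p with _ | p
  · exact (smul_zero c).symm
  · exact wedge_smul_right _ _ _

/-- Multiplication by a 2-form modulo `α` depends only on its restriction to the kernel. -/
theorem mulTwo_mulOne_of_restrictTo {α : V [⋀^Fin 1]→L[ℝ] ℝ} (hα : α ≠ 0) {Q : Submodule ℝ V}
    (hQ : ∀ v, v ∈ Q ↔ α (fun _ => v) = 0) {Ω Ω' : V [⋀^Fin 2]→L[ℝ] ℝ} {f : ℝ}
    (hΩ : restrictTo Q Ω' = f • restrictTo Q Ω) (θ : GradedForm V) :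
    mulTwo Ω' (mulOne α θ) = f • mulTwo Ω (mulOne α θ) := by
  have hc : ∀ Ω : V [⋀^Fin 2]→L[ℝ] ℝ, mulTwo Ω (mulOne α θ) = mulOne α (mulTwo Ω θ) :=
    fun Ω => (LinearMap.congr_fun (mulOne_mulTwo α Ω) θ).symm
  rw [hc, hc, ← map_smul, ← sub_eq_zero, ← map_sub]
  have h0 : restrictTo Q (Ω' - f • Ω) = 0 := by
    change restrictTo Q Ω' - f • restrictTo Q Ω = 0
    rw [hΩ, sub_self]
  have hp : ∀ p, wedge (θ p) Ω' - f • wedge (θ p) Ω = wedge (θ p) (Ω' - f • Ω) := by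
    intro p
    rw [sub_eq_iff_eq_add, ← wedge_smul_right, ← wedge_add_right, sub_add_cancel]
  funext p
  rcases p with _ | _ | _ | p
  · rfl
  · change wedge (0 - f • 0 : V [⋀^Fin 0]→L[ℝ] ℝ) α = 0
    rw [smul_zero, sub_zero, IsHomogeneous.wedge_zero_left]
  · change wedge (0 - f • 0 : V [⋀^Fin 1]→L[ℝ] ℝ) α = 0
    rw [smul_zero, sub_zero, IsHomogeneous.wedge_zero_left]
  · change wedge (wedge (θ p) Ω' - f • wedge (θ p) Ω) α = 0
    rw [← restrictTo_eq_zero_iff hα hQ, hp]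
    refine (wedge_compContinuousLinearMap Q.subtypeL _ _).trans ?_
    change wedge _ (restrictTo Q (Ω' - f • Ω)) = 0
    rw [h0, wedge_zero_right]

theorem mulTwo_pow_mulOne_of_restrictTo {α : V [⋀^Fin 1]→L[ℝ] ℝ} (hα : α ≠ 0)
    {Q : Submodule ℝ V} (hQ : ∀ v, v ∈ Q ↔ α (fun _ => v) = 0) {Ω Ω' : V [⋀^Fin 2]→L[ℝ] ℝ}
    {f : ℝ} (hΩ : restrictTo Q Ω' = f • restrictTo Q Ω) (m : ℕ) (θ : GradedForm V) :
    (mulTwo Ω' ^ m) (mulOne α θ) = f ^ m • (mulTwo Ω ^ m) (mulOne α θ) := by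
  induction m with
  | zero => simp
  | succ m ih =>
    rw [pow_succ', Module.End.mul_apply, ih, map_smul, mulTwo_pow_mulOne,
      mulTwo_mulOne_of_restrictTo hα hQ hΩ, smul_smul, ← mulTwo_pow_mulOne,
      ← Module.End.mul_apply, ← pow_succ', ← pow_succ]

/-- The volume form is multiplied by f^(n+1). -/
theorem IsContactPair.smul {n : ℕ} {α : V [⋀^Fin 1]→L[ℝ] ℝ} {Ω Ω' : V [⋀^Fin 2]→L[ℝ] ℝ}
    (h : IsContactPair n α Ω) {Q : Submodule ℝ V} (hQ : ∀ v, v ∈ Q ↔ α (fun _ => v) = 0) {f : ℝ}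
    (hf : f ≠ 0) (hΩ : restrictTo Q Ω' = f • restrictTo Q Ω) : IsContactPair n (f • α) Ω' := by
  rw [IsContactPair, mulOne_smul_left, map_smul,
    mulTwo_pow_mulOne_of_restrictTo h.ne_zero hQ hΩ, smul_smul]
  exact smul_ne_zero (mul_ne_zero hf (pow_ne_zero _ hf)) h

/-- The contact operator does not depend on the contact form and the decomposition. -/
theorem IsContactPair.operator_eq [T2Space V] [FiniteDimensional ℝ V] {n : ℕ} {α : V [⋀^Fin 1]→L[ℝ] ℝ}
    {Ω Ω' : V [⋀^Fin 2]→L[ℝ] ℝ} (h : IsContactPair n α Ω) {Q : Submodule ℝ V}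
    (hQ : ∀ v, v ∈ Q ↔ α (fun _ => v) = 0) {f : ℝ} (hf : f ≠ 0)
    (hΩ : restrictTo Q Ω' = f • restrictTo Q Ω) {a : ℕ} {θ : GradedForm V}
    {π π' : ℕ → GradedForm V} (hπ : IsDecomposition n α Ω a θ π)
    (hπ' : IsDecomposition n (f • α) Ω' a θ π') {i : ℕ} (hi : i ∈ lefschetzIndices n a)
    (hia : i + 2 ≤ a) :
    mulOne (f • α) ((mulTwo Ω' ^ ((a - i - 2) / 2)) (π' i)) =
      mulOne α ((mulTwo Ω ^ ((a - i - 2) / 2)) (π i)) := by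
  have hpow := mulTwo_pow_mulOne_of_restrictTo h.ne_zero hQ hΩ
  -- On Q the operators satisfy L' = f L, so the j-th summand for the form f α carries f^((a-j)/2),
  -- which is absorbed into its component.
  have hπ'' : IsDecomposition n α Ω a θ fun j => f ^ ((a - j) / 2) • π' j := by
    refine ⟨fun j => (hπ'.homogeneous j).smul _, fun j hj => ?_, ?_⟩
    · have h1 := hπ'.primitive j hj
      rw [mulOne_smul_left, map_smul, hpow, smul_smul, smul_eq_zero] at h1
      rw [map_smul, map_smul, h1.resolve_left (mul_ne_zero hf (pow_ne_zero _ hf)), smul_zero]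
    · have h1 := hπ'.sum_eq
      simp only [mulOne_smul_left, map_smul, hpow] at h1
      rw [← Finset.smul_sum] at h1
      simp only [map_smul]
      exact smul_right_injective _ hf h1
  -- It remains to compare powers of f: the factor α and the powers of L give 1 + (a-i-2)/2, the
  -- component gives (a-i)/2.
  have h2 := h.isDecomposition_unique hπ hπ'' i hi
  rw [mulOne_smul_left, ← mulTwo_pow_mulOne, ← mulTwo_pow_mulOne, hpow, h2, map_smul, map_smul,
    smul_smul, ← pow_succ']
  congr 2
  omega

end Translation

/-! ### Normalising the components by the Reeb vector -/

section Horizontal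

variable {V : Type*} [AddCommGroup V] [Module ℝ V] [TopologicalSpace V]
  [IsTopologicalAddGroup V] [ContinuousSMul ℝ V]

/-- The contractions of `θ` with the kernel of `Ω` vanish. -/
def IsHorizontal (Ω : V [⋀^Fin 2]→L[ℝ] ℝ) (θ : GradedForm V) : Prop :=
  ∀ r : V, contractLast (p := 1) r Ω = 0 → contract r θ = 0

theorem IsHorizontal.contract_mulOne_eq {α : V [⋀^Fin 1]→L[ℝ] ℝ} {Ω : V [⋀^Fin 2]→L[ℝ] ℝ}
    {θ : GradedForm V} (h : IsHorizontal Ω θ) {R : V} (hR : α (fun _ => R) = 1)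
    (hΩ : contractLast (p := 1) R Ω = 0) : contract R (mulOne α θ) = θ := by
  rw [contract_mulOne_apply, h R hΩ, map_zero, sub_zero, hR, one_smul]

/-- The component π_j is replaced by i_R(π_j ∧ α), which has the same product with α and is killed
by i_R. The purpose is uniqueness: horizontal components are determined as forms and not only modulo
α. -/
theorem IsContactPair.exists_horizontal [T2Space V] [FiniteDimensional ℝ V] {n : ℕ}
    {α : V [⋀^Fin 1]→L[ℝ] ℝ} {Ω : V [⋀^Fin 2]→L[ℝ] ℝ} (h : IsContactPair n α Ω)
    (hV : Module.finrank ℝ V = 2 * n + 1) {a : ℕ} (ha : a ≤ 2 * n)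
    (θ : V [⋀^Fin a]→L[ℝ] ℝ) : ∃ π : (j : ℕ) → V [⋀^Fin j]→L[ℝ] ℝ,
      IsDecomposition n α Ω a (Pi.single a θ) (fun j => Pi.single j (π j)) ∧
      ∀ j, IsHorizontal Ω (Pi.single j (π j)) := by
  obtain ⟨R, hR, hRΩ⟩ := h.exists_reeb hV
  obtain ⟨π, hπ⟩ := h.exists_isDecomposition hV ha (isHomogeneous_single a θ)
  have hhom : ∀ j, IsHomogeneous j (contract R (mulOne α (π j))) := fun j =>
    ((hπ.homogeneous j).mulOne α).contract R
  have hmul : ∀ j, mulOne α (contract R (mulOne α (π j))) = mulOne α (π j) := by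
    intro j
    rw [contract_mulOne_apply, map_sub, mulOne_mulOne_self, sub_zero, hR, one_smul]
  have hsingle : ∀ j, (Pi.single j (contract R (mulOne α (π j)) j) : GradedForm V) =
    contract R (mulOne α (π j)) := fun j => (hhom j).eq_single.symm
  refine ⟨fun j => contract R (mulOne α (π j)) j, ⟨fun j => isHomogeneous_single _ _,
    fun j hj => ?_, ?_⟩, fun j r hr => ?_⟩
  · rw [hsingle, hmul, hπ.primitive j hj]
  · simp only [hsingle, hmul]
    exact hπ.sum_eq
  · rw [hsingle]
    -- The kernel of Ω is spanned by R, so contraction with R alone decides horizontality.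
    have hr' : r - α (fun _ => r) • R = 0 := by
      refine h.eq_zero_of_contractLast hV ?_ ?_
      · have h1 := contractLast_add_left (r - α (fun _ => r) • R) (α (fun _ => r) • R) α
        rw [sub_add_cancel, contractLast_smul_left] at h1
        have h1 := congrArg (fun f => f 0) h1
        simp only [ContinuousAlternatingMap.add_apply, ContinuousAlternatingMap.smul_apply,
          contractLast_zero_apply, hR, smul_eq_mul, mul_one] at h1
        linarith
      · have h1 := contractLast_add_left (p := 1) (r - α (fun _ => r) • R)
          (α (fun _ => r) • R) Ω
        rw [sub_add_cancel, contractLast_smul_left, hr, hRΩ, smul_zero, add_zero] at h1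
        exact h1.symm
    rw [sub_eq_zero.1 hr']
    have h2 : ∀ η : GradedForm V, contract (α (fun _ => r) • R) η =
        α (fun _ => r) • contract R η := fun η => funext fun p => contractLast_smul_left _ _ _
    rw [h2, contract_contract_self, smul_zero]

end Horizontal

/-! ### Smooth dependence of the Reeb vector and the components on parameters -/

section Smooth

variable {X : Type*} [NormedAddCommGroup X] [NormedSpace ℝ X]

/-- The solution of an injective linear equation with smooth coefficients is smooth. -/
theorem contDiffAt_of_injective {E F : Type*} [NormedAddCommGroup E] [NormedSpace ℝ E]
    [FiniteDimensional ℝ E] [NormedAddCommGroup F] [NormedSpace ℝ F] [FiniteDimensional ℝ F]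
    {x₀ : X} {A : X → E →ₗ[ℝ] F} {b : X → F} {u : X → E}
    (hA : ∀ e, ContDiffAt ℝ ∞ (fun x => A x e) x₀) (hb : ContDiffAt ℝ ∞ b x₀)
    (hinj : Function.Injective (A x₀)) (h : ∀ᶠ x in 𝓝 x₀, A x (u x) = b x) :
    ContDiffAt ℝ ∞ u x₀ := by
  -- With C a fixed left inverse of A x₀, the endomorphism C ∘ A x equals the identity at x₀ and is
  -- therefore invertible nearby. Hence u = (C ∘ A)⁻¹ (C b) there, and inversion is smooth.
  obtain ⟨C, hC⟩ := LinearMap.exists_leftInverse_of_injective (A x₀) (LinearMap.ker_eq_bot.2 hinj)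
  let C' : F →L[ℝ] E := LinearMap.toContinuousLinearMap C
  let T : X → E →L[ℝ] E := fun x => LinearMap.toContinuousLinearMap (C.comp (A x))
  have hT : ContDiffAt ℝ ∞ T x₀ := by
    let b' := Module.finBasis ℝ E
    have h1 : ∀ x, T x = ∑ i, (LinearMap.toContinuousLinearMap (b'.coord i)).smulRight
        (C' (A x (b' i))) := by
      intro x
      ext v
      have h2 := congrArg (T x) (b'.sum_repr v)
      rw [map_sum] at h2
      rw [← h2, sum_apply]
      refine Finset.sum_congr rfl fun i _ => ?_
      rw [map_smul]
      rfl
    rw [show T = _ from funext h1]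
    refine ContDiffAt.sum fun i _ => ?_
    have h3 : ContDiffAt ℝ ∞ (fun x => C' (A x (b' i))) x₀ := C'.contDiff.contDiffAt.comp x₀ (hA _)
    exact contDiffAt_const.smulRight h3
  have hT0 : T x₀ = ContinuousLinearEquiv.refl ℝ E := by
    ext v
    exact LinearMap.congr_fun hC v
  have hopen : ∀ᶠ x in 𝓝 x₀, ∃ e : E ≃L[ℝ] E, (e : E →L[ℝ] E) = T x := by
    have h1 := hT.continuousAt.eventually
      ((ContinuousLinearEquiv.isOpen (𝕜 := ℝ) (E := E) (F := E)).mem_nhds ⟨_, hT0.symm⟩)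
    exact h1
  have hu : u =ᶠ[𝓝 x₀] fun x => ContinuousLinearMap.inverse (T x) (C' (b x)) := by
    filter_upwards [h, hopen] with x hx hx'
    obtain ⟨e, he⟩ := hx'
    rw [← he, ContinuousLinearMap.inverse_equiv, ← hx]
    refine (e.symm_apply_eq.2 ?_).symm
    exact (DFunLike.congr_fun he (u x)).symm
  refine ContDiffAt.congr_of_eventuallyEq ?_ hu
  refine ContDiffAt.clm_apply ?_ (C'.contDiff.contDiffAt.comp x₀ hb)
  have hinv : ContDiffAt ℝ ∞ ContinuousLinearMap.inverse (T x₀) := by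
    rw [hT0]
    exact contDiffAt_map_inverse _
  exact hinv.comp x₀ hT

theorem contDiffAt_bilinear {E F G : Type*} [NormedAddCommGroup E] [NormedSpace ℝ E]
    [FiniteDimensional ℝ E] [NormedAddCommGroup F] [NormedSpace ℝ F] [FiniteDimensional ℝ F]
    [NormedAddCommGroup G] [NormedSpace ℝ G] (B : E →ₗ[ℝ] F →ₗ[ℝ] G) {x₀ : X} {f : X → E}
    {g : X → F} (hf : ContDiffAt ℝ ∞ f x₀) (hg : ContDiffAt ℝ ∞ g x₀) :
    ContDiffAt ℝ ∞ (fun x => B (f x) (g x)) x₀ :=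
  (B.toContinuousBilinearMap.contDiff.contDiffAt.comp x₀ hf).clm_apply hg

variable {V : Type*} [NormedAddCommGroup V] [NormedSpace ℝ V] [FiniteDimensional ℝ V]

variable (V) in
/-- The wedge product as a bilinear map. -/
def wedgeBilinear (p q : ℕ) : (V [⋀^Fin p]→L[ℝ] ℝ) →ₗ[ℝ] (V [⋀^Fin q]→L[ℝ] ℝ) →ₗ[ℝ]
    V [⋀^Fin (p + q)]→L[ℝ] ℝ :=
  LinearMap.mk₂ ℝ (fun θ η => wedge θ η) wedge_add_left wedge_smul_left wedge_add_right
    fun c θ η => wedge_smul_right c θ η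

variable (V) in
/-- The contraction as a bilinear map. -/
def contractBilinear (p : ℕ) : V →ₗ[ℝ] (V [⋀^Fin (p + 1)]→L[ℝ] ℝ) →ₗ[ℝ] V [⋀^Fin p]→L[ℝ] ℝ :=
  LinearMap.mk₂ ℝ (fun v θ => contractLast v θ) contractLast_add_left contractLast_smul_left
    (fun _ _ _ => rfl) (fun _ _ _ => rfl)

theorem contDiffAt_wedge {p q : ℕ} {x₀ : X} {θ : X → V [⋀^Fin p]→L[ℝ] ℝ}
    {η : X → V [⋀^Fin q]→L[ℝ] ℝ} (hθ : ContDiffAt ℝ ∞ θ x₀) (hη : ContDiffAt ℝ ∞ η x₀) :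
    ContDiffAt ℝ ∞ (fun x => wedge (θ x) (η x)) x₀ :=
  contDiffAt_bilinear (wedgeBilinear V p q) hθ hη

theorem contDiffAt_contractLast {p : ℕ} {x₀ : X} {v : X → V} {θ : X → V [⋀^Fin (p + 1)]→L[ℝ] ℝ}
    (hv : ContDiffAt ℝ ∞ v x₀) (hθ : ContDiffAt ℝ ∞ θ x₀) :
    ContDiffAt ℝ ∞ (fun x => contractLast (v x) (θ x)) x₀ :=
  contDiffAt_bilinear (contractBilinear V p) hv hθ

/-- All components of a family of graded forms are smooth. -/
def GradedSmoothAt (θ : X → GradedForm V) (x₀ : X) : Prop :=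
  ∀ p, ContDiffAt ℝ ∞ (fun x => θ x p) x₀

namespace GradedSmoothAt

variable {x₀ : X} {θ : X → GradedForm V}

theorem single {p : ℕ} {θ : X → V [⋀^Fin p]→L[ℝ] ℝ} (h : ContDiffAt ℝ ∞ θ x₀) :
    GradedSmoothAt (fun x => Pi.single p (θ x)) x₀ := by
  intro q
  by_cases hq : q = p
  · subst hq
    simpa only [Pi.single_eq_same] using h
  · simp only [Pi.single_eq_of_ne hq]
    exact contDiffAt_const

theorem mulOne {α : X → V [⋀^Fin 1]→L[ℝ] ℝ} (hα : ContDiffAt ℝ ∞ α x₀)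
    (h : GradedSmoothAt θ x₀) : GradedSmoothAt (fun x => mulOne (α x) (θ x)) x₀ := by
  rintro (_ | p)
  · exact contDiffAt_const
  · exact contDiffAt_wedge (h p) hα

theorem mulTwo {Ω : X → V [⋀^Fin 2]→L[ℝ] ℝ} (hΩ : ContDiffAt ℝ ∞ Ω x₀)
    (h : GradedSmoothAt θ x₀) : GradedSmoothAt (fun x => mulTwo (Ω x) (θ x)) x₀ := by
  rintro (_ | _ | p)
  · exact contDiffAt_const
  · exact contDiffAt_const
  · exact contDiffAt_wedge (h p) hΩ

theorem mulTwo_pow {Ω : X → V [⋀^Fin 2]→L[ℝ] ℝ} (hΩ : ContDiffAt ℝ ∞ Ω x₀)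
    (h : GradedSmoothAt θ x₀) (k : ℕ) :
    GradedSmoothAt (fun x => (ContactForms.mulTwo (Ω x) ^ k) (θ x)) x₀ := by
  induction k with
  | zero => exact h
  | succ k ih =>
    simp only [pow_succ', Module.End.mul_apply]
    exact ih.mulTwo hΩ

theorem contract {v : X → V} (hv : ContDiffAt ℝ ∞ v x₀)
    (h : GradedSmoothAt θ x₀) : GradedSmoothAt (fun x => contract (v x) (θ x)) x₀ :=
  fun p => contDiffAt_contractLast hv (h (p + 1))

theorem sum {ι : Type*} {s : Finset ι} {θ : ι → X → GradedForm V}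
    (h : ∀ i ∈ s, GradedSmoothAt (θ i) x₀) : GradedSmoothAt (fun x => ∑ i ∈ s, θ i x) x₀ := by
  intro p
  simp only [Finset.sum_apply]
  exact ContDiffAt.sum fun i hi => h i hi p

end GradedSmoothAt

variable {n : ℕ} {x₀ : X} {α : X → V [⋀^Fin 1]→L[ℝ] ℝ} {Ω : X → V [⋀^Fin 2]→L[ℝ] ℝ}

/-- The Reeb vector solves the linear system α(R) = 1, i_R Ω = 0, which is injective since no
nonzero vector is killed by both α and Ω. -/
theorem exists_contDiffAt_reeb (hV : Module.finrank ℝ V = 2 * n + 1)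
    (hα : ContDiffAt ℝ ∞ α x₀) (hΩ : ContDiffAt ℝ ∞ Ω x₀)
    (hc : ∀ᶠ x in 𝓝 x₀, IsContactPair n (α x) (Ω x)) :
    ∃ R : X → V, ContDiffAt ℝ ∞ R x₀ ∧
      ∀ᶠ x in 𝓝 x₀, α x (fun _ => R x) = 1 ∧ contractLast (p := 1) (R x) (Ω x) = 0 := by
  have h : ∀ x, ∃ R : V, IsContactPair n (α x) (Ω x) →
      α x (fun _ => R) = 1 ∧ contractLast (p := 1) R (Ω x) = 0 := by
    intro x
    by_cases hx : IsContactPair n (α x) (Ω x)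
    · obtain ⟨R, hR⟩ := hx.exists_reeb hV
      exact ⟨R, fun _ => hR⟩
    · exact ⟨0, fun h => absurd h hx⟩
  choose R hR using h
  refine ⟨R, ?_, hc.mono hR⟩
  let A : X → V →ₗ[ℝ] (V [⋀^Fin 0]→L[ℝ] ℝ) × (V [⋀^Fin 1]→L[ℝ] ℝ) := fun x =>
    { toFun := fun v => (contractLast v (α x), contractLast (p := 1) v (Ω x))
      map_add' := fun u v => by rw [contractLast_add_left, contractLast_add_left]; rfl
      map_smul' := fun c v => by rw [contractLast_smul_left, contractLast_smul_left]; rfl }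
  have h0 : ∀ (α : V [⋀^Fin 1]→L[ℝ] ℝ) (v : V), contractLast v α =
      ContinuousAlternatingMap.constOfIsEmpty ℝ V (Fin 0) (α fun _ => v) := by
    intro α v
    ext w
    rw [Subsingleton.elim w 0, contractLast_zero_apply]
    rfl
  refine contDiffAt_of_injective (A := A)
    (b := fun _ => (ContinuousAlternatingMap.constOfIsEmpty ℝ V (Fin 0) 1, 0))
    (fun v => ?_) contDiffAt_const ?_ (hc.mono fun x hx => ?_)
  · exact (contDiffAt_contractLast contDiffAt_const hα).prodMk
      (contDiffAt_contractLast contDiffAt_const hΩ)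
  · rw [injective_iff_map_eq_zero]
    intro v hv
    refine hc.self_of_nhds.eq_zero_of_contractLast hV ?_ (Prod.ext_iff.1 hv).2
    rw [← contractLast_zero_apply]
    exact congrArg (fun f => f 0) (Prod.ext_iff.1 hv).1
  · obtain ⟨h1, h2⟩ := hR x hx
    refine Prod.ext ?_ h2
    rw [← h1]
    exact h0 _ _

/-- The horizontal Lefschetz components depend smoothly on parameters. -/
theorem contDiffAt_of_isDecomposition (hV : Module.finrank ℝ V = 2 * n + 1)
    (hα : ContDiffAt ℝ ∞ α x₀) (hΩ : ContDiffAt ℝ ∞ Ω x₀)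
    (hc : ∀ᶠ x in 𝓝 x₀, IsContactPair n (α x) (Ω x)) {a : ℕ}
    {θ : X → V [⋀^Fin a]→L[ℝ] ℝ} (hθ : ContDiffAt ℝ ∞ θ x₀)
    {π : X → (j : ℕ) → V [⋀^Fin j]→L[ℝ] ℝ}
    (hπ : ∀ᶠ x in 𝓝 x₀, IsDecomposition n (α x) (Ω x) a (Pi.single a (θ x))
      (fun j => Pi.single j (π x j)))
    (hh : ∀ᶠ x in 𝓝 x₀, ∀ j, IsHorizontal (Ω x) (Pi.single j (π x j))) {j : ℕ}
    (hj : j ∈ lefschetzIndices n a) : ContDiffAt ℝ ∞ (fun x => π x j) x₀ := by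
  obtain ⟨R, hR, hR'⟩ := exists_contDiffAt_reeb hV hα hΩ hc
  let I := lefschetzIndices n a
  let E := (i : I) → V [⋀^Fin (i : ℕ)]→L[ℝ] ℝ
  let s : (i : I) → E →ₗ[ℝ] GradedForm V := fun i =>
    (LinearMap.single ℝ (fun p => V [⋀^Fin p]→L[ℝ] ℝ) (i : ℕ)).comp (LinearMap.proj i)
  have hs : ∀ i (u : E), s i u = Pi.single (i : ℕ) (u i) := fun _ _ => rfl
  -- The components solve a system with three blocks: A₁ expresses the decomposition modulo α, A₂
  -- primitivity, and A₃ horizontality in the form i_R(u_i ∧ α) = u_i. If all three vanish on u,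
  -- then A₁ and A₂ force u_i ∧ α = 0, and A₃ forces u_i = 0.
  obtain ⟨A₁, hA₁⟩ : ∃ A₁ : X → E →ₗ[ℝ] V [⋀^Fin (a + 1)]→L[ℝ] ℝ,
      ∀ x u, A₁ x u = (∑ i : I, (mulTwo (Ω x) ^ ((a - i) / 2))
        (mulOne (α x) (Pi.single (i : ℕ) (u i)))) (a + 1) :=
    ⟨fun x => (LinearMap.proj (a + 1)).comp
      (∑ i : I, (mulTwo (Ω x) ^ ((a - i) / 2)).comp ((mulOne (α x)).comp (s i))), fun x u => by
        simp only [LinearMap.comp_apply, LinearMap.sum_apply, LinearMap.proj_apply, hs]⟩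
  obtain ⟨A₂, hA₂⟩ : ∃ A₂ : X → E →ₗ[ℝ] (i : I) →
      V [⋀^Fin ((i : ℕ) + 1 + 2 * (n - i + 1))]→L[ℝ] ℝ,
      ∀ x u i, A₂ x u i = (mulTwo (Ω x) ^ (n - (i : ℕ) + 1))
        (mulOne (α x) (Pi.single (i : ℕ) (u i))) ((i : ℕ) + 1 + 2 * (n - i + 1)) :=
    ⟨fun x => LinearMap.pi fun i => (LinearMap.proj ((i : ℕ) + 1 + 2 * (n - i + 1))).comp
      ((mulTwo (Ω x) ^ (n - (i : ℕ) + 1)).comp ((mulOne (α x)).comp (s i))), fun _ _ _ => rfl⟩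
  obtain ⟨A₃, hA₃⟩ : ∃ A₃ : X → E →ₗ[ℝ] E,
      ∀ x u i, A₃ x u i = (contract (R x) (mulOne (α x) (Pi.single (i : ℕ) (u i))) -
        Pi.single (i : ℕ) (u i) : GradedForm V) (i : ℕ) :=
    ⟨fun x => LinearMap.pi fun i => (LinearMap.proj (i : ℕ)).comp
      ((contract (R x)).comp ((mulOne (α x)).comp (s i)) - s i), fun _ _ _ => rfl⟩
  suffices h : ContDiffAt ℝ ∞ (fun x (i : I) => π x i) x₀ from
    contDiffAt_pi.1 h ⟨j, hj⟩
  refine contDiffAt_of_injective (A := fun x => (A₁ x).prod ((A₂ x).prod (A₃ x)))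
    (b := fun x => (mulOne (α x) (Pi.single a (θ x)) (a + 1), 0, 0)) (fun u => ?_) ?_ ?_ ?_
  · have h1 : ∀ i : I, GradedSmoothAt (fun x => mulOne (α x) (Pi.single (i : ℕ) (u i))) x₀ :=
      fun i => (GradedSmoothAt.single contDiffAt_const).mulOne hα
    refine ContDiffAt.prodMk ?_ (ContDiffAt.prodMk ?_ ?_)
    · simp only [hA₁]
      exact GradedSmoothAt.sum (fun i _ => (h1 i).mulTwo_pow hΩ _) _
    · refine contDiffAt_pi.2 fun i => ?_
      simp only [hA₂]
      exact (h1 i).mulTwo_pow hΩ _ _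
    · refine contDiffAt_pi.2 fun i => ?_
      simp only [hA₃, Pi.sub_apply]
      exact ((h1 i).contract hR i).sub contDiffAt_const
  · exact (((GradedSmoothAt.single hθ).mulOne hα) (a + 1)).prodMk contDiffAt_const
  · rw [injective_iff_map_eq_zero]
    intro u hu
    have hu1 : A₁ x₀ u = 0 := (Prod.ext_iff.1 hu).1
    have hu2 : A₂ x₀ u = 0 := (Prod.ext_iff.1 (Prod.ext_iff.1 hu).2).1
    have hu3 : A₃ x₀ u = 0 := (Prod.ext_iff.1 (Prod.ext_iff.1 hu).2).2
    -- Extension by zero to the degrees outside the index set, as the uniqueness theorem is stated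
    -- for families in all degrees.
    obtain ⟨ρ, hρ⟩ : ∃ ρ : (i : ℕ) → V [⋀^Fin i]→L[ℝ] ℝ, ∀ i : I, ρ i = u i :=
      ⟨fun i => if h : i ∈ I then u ⟨i, h⟩ else 0, fun i => dif_pos i.2⟩
    have h1 := hc.self_of_nhds.mulOne_eq_zero_of_sum (a := a)
      (π := fun i => Pi.single i (ρ i)) (fun i => isHomogeneous_single i _) (fun i hi => ?_) ?_
    · funext i
      have h2 := h1 i i.2
      have h3 := congrFun hu3 i
      rw [hA₃, ← hρ, h2, map_zero, zero_sub] at h3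
      have h4 := neg_eq_zero.1 h3
      rwa [Pi.single_eq_same, hρ] at h4
    · refine (((isHomogeneous_single i _).mulOne _).mulTwo_pow _ _).eq_zero ?_
      have h3 := congrFun hu2 ⟨i, hi⟩
      rw [hA₂, ← hρ] at h3
      exact h3
    · refine IsHomogeneous.eq_zero (p := a + 1) (IsHomogeneous.sum fun i hi => ?_) ?_
      · have hi' := mem_lefschetzIndices.1 hi
        have := ((isHomogeneous_single i (ρ i)).mulOne (α x₀)).mulTwo_pow (Ω x₀) ((a - i) / 2)
        rwa [show i + 1 + 2 * ((a - i) / 2) = a + 1 by omega] at this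
      · rw [← hu1, hA₁, ← Finset.sum_coe_sort]
        simp only [hρ, I]
  · filter_upwards [hπ, hh, hR'] with x h1 h2 h3
    have e1 : A₁ x (fun i => π x i) = mulOne (α x) (Pi.single a (θ x)) (a + 1) := by
      rw [hA₁, h1.sum_eq]
      exact congrFun (Finset.sum_coe_sort I fun j => (mulTwo (Ω x) ^ ((a - j) / 2))
        (mulOne (α x) (Pi.single j (π x j)))) (a + 1)
    have e2 : A₂ x (fun i => π x i) = 0 := by
      funext i
      rw [hA₂, h1.primitive i i.2]
      rfl
    have e3 : A₃ x (fun i => π x i) = 0 := by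
      funext i
      rw [hA₃, (h2 i).contract_mulOne_eq h3.1 h3.2, sub_self]
      rfl
    exact Prod.ext e1 (Prod.ext e2 e3)

end Smooth

/-! ### Pullback, smoothness and exterior derivative in charts -/

section Charts

variable {d : ℕ}
  {M : Type*} [TopologicalSpace M] [ChartedSpace (EuclideanSpace ℝ (Fin d)) M]
  [IsManifold (𝓡 d) ∞ M]
  {M' : Type*} [TopologicalSpace M'] [ChartedSpace (EuclideanSpace ℝ (Fin d)) M']
  [IsManifold (𝓡 d) ∞ M']

/-- A pullback of forms in charts. -/
theorem inChart_pullbackField {φ : M → M'} {x : M}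
    (hφ : ∀ᶠ z in 𝓝 x, ContMDiffAt (𝓡 d) (𝓡 d) ∞ φ z)
    {e : OpenPartialHomeomorph M (EuclideanSpace ℝ (Fin d))}
    (he : e ∈ atlas (EuclideanSpace ℝ (Fin d)) M) (hx : x ∈ e.source)
    {e' : OpenPartialHomeomorph M' (EuclideanSpace ℝ (Fin d))}
    (he' : e' ∈ atlas (EuclideanSpace ℝ (Fin d)) M') (hx' : φ x ∈ e'.source) {k : ℕ}
    (θ : FormField d M' k) :
    ∀ᶠ z in 𝓝 (e x), ContDiffAt ℝ ∞ (e' ∘ φ ∘ e.symm) z ∧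
      inChart e (pullbackField φ θ) z = (inChart e' θ ((e' ∘ φ ∘ e.symm) z)).compContinuousLinearMap
        (fderiv ℝ (e' ∘ φ ∘ e.symm) z) := by
  have hem : e ∈ IsManifold.maximalAtlas (𝓡 d) ∞ M := IsManifold.subset_maximalAtlas he
  have hem' : e' ∈ IsManifold.maximalAtlas (𝓡 d) ∞ M' := IsManifold.subset_maximalAtlas he'
  have hy : e x ∈ e.target := e.map_source hx
  have hsymm : Filter.Tendsto e.symm (𝓝 (e x)) (𝓝 x) := by
    have := e.symm.continuousAt hy
    rwa [ContinuousAt, e.left_inv hx] at this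
  have hnear : ∀ᶠ z in 𝓝 (e x), z ∈ e.target ∧ φ (e.symm z) ∈ e'.source ∧
      ContMDiffAt (𝓡 d) (𝓡 d) ∞ φ (e.symm z) := by
    refine (e.open_target.eventually_mem hy).and (Filter.Eventually.and ?_ (hsymm.eventually hφ))
    exact hsymm.eventually (hφ.self_of_nhds.continuousAt.eventually
      (e'.open_source.eventually_mem hx'))
  filter_upwards [hnear.eventually_nhds] with z hz
  obtain ⟨hz1, hz2, hz3⟩ := hz.self_of_nhds
  have hsm : ContDiffAt ℝ ∞ (e' ∘ φ ∘ e.symm) z := by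
    rw [← contMDiffAt_iff_contDiffAt]
    exact (contMDiffAt_of_mem_maximalAtlas hem' hz2).comp z
      (hz3.comp z (contMDiffAt_symm_of_mem_maximalAtlas hem hz1))
  refine ⟨hsm, ?_⟩
  have h1 : inChart e (pullbackField φ θ) z = pullbackField (φ ∘ e.symm) θ z :=
    pullbackField_comp (hz3.mdifferentiableAt (by simp))
      ((contMDiffAt_symm_of_mem_maximalAtlas hem hz1).mdifferentiableAt (by simp)) θ
  have h2 : pullbackField (φ ∘ e.symm) θ z =
      pullbackField (e'.symm ∘ (e' ∘ φ ∘ e.symm)) θ z := by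
    refine pullbackField_congr ?_ θ
    filter_upwards [hz] with w hw
    exact (e'.left_inv hw.2.1).symm
  have h3 : pullbackField (e' ∘ φ ∘ e.symm) (inChart e' θ) z =
      pullbackField (e'.symm ∘ (e' ∘ φ ∘ e.symm)) θ z :=
    pullbackField_comp (φ := e' ∘ φ ∘ e.symm)
      ((contMDiffAt_symm_of_mem_maximalAtlas hem'
        (e'.map_source hz2)).mdifferentiableAt (by simp))
      (hsm.contMDiffAt.mdifferentiableAt (by simp)) θ
  rw [h1, h2, ← h3]
  change ContinuousAlternatingMap.compContinuousLinearMap _ (mfderiv _ _ _ z) = _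
  rw [mfderiv_eq_fderiv]
  rfl

theorem contDiffAt_inChart_pullbackField {φ : M → M'} {x : M}
    (hφ : ∀ᶠ z in 𝓝 x, ContMDiffAt (𝓡 d) (𝓡 d) ∞ φ z)
    {e : OpenPartialHomeomorph M (EuclideanSpace ℝ (Fin d))}
    (he : e ∈ atlas (EuclideanSpace ℝ (Fin d)) M) (hx : x ∈ e.source)
    {e' : OpenPartialHomeomorph M' (EuclideanSpace ℝ (Fin d))}
    (he' : e' ∈ atlas (EuclideanSpace ℝ (Fin d)) M') (hx' : φ x ∈ e'.source) {k : ℕ}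
    {θ : FormField d M' k} (hθ : ContDiffAt ℝ ∞ (inChart e' θ) (e' (φ x))) :
    ContDiffAt ℝ ∞ (inChart e (pullbackField φ θ)) (e x) := by
  have h := inChart_pullbackField hφ he hx he' hx' θ
  refine ContDiffAt.congr_of_eventuallyEq ?_ (h.mono fun z hz => hz.2)
  have hg := h.self_of_nhds.1
  have hgx : (e' ∘ φ ∘ e.symm) (e x) = e' (φ x) := by simp [e.left_inv hx]
  rw [← hgx] at hθ
  exact (contDiff_compContinuousLinearMap.contDiffAt (x := (_, _))).comp (e x)
    ((hθ.comp (e x) hg).prodMk (hg.fderiv_right (m := ∞) (by simp)))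

theorem extDeriv_inChart_pullbackField {φ : M → M'} {x : M}
    (hφ : ∀ᶠ z in 𝓝 x, ContMDiffAt (𝓡 d) (𝓡 d) ∞ φ z)
    {e : OpenPartialHomeomorph M (EuclideanSpace ℝ (Fin d))}
    (he : e ∈ atlas (EuclideanSpace ℝ (Fin d)) M) (hx : x ∈ e.source)
    {e' : OpenPartialHomeomorph M' (EuclideanSpace ℝ (Fin d))}
    (he' : e' ∈ atlas (EuclideanSpace ℝ (Fin d)) M') (hx' : φ x ∈ e'.source) {k : ℕ}
    {θ : FormField d M' k} (hθ : ContDiffAt ℝ ∞ (inChart e' θ) (e' (φ x))) :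
    extDeriv (inChart e (pullbackField φ θ)) (e x) =
      (extDeriv (inChart e' θ) (e' (φ x))).compContinuousLinearMap
        (fderiv ℝ (e' ∘ φ ∘ e.symm) (e x)) := by
  have h := inChart_pullbackField hφ he hx he' hx' θ
  have hgx : (e' ∘ φ ∘ e.symm) (e x) = e' (φ x) := by simp [e.left_inv hx]
  rw [← hgx] at hθ ⊢
  rw [Filter.EventuallyEq.extDeriv_eq (h.mono fun z hz => hz.2)]
  exact extDeriv_pullback (r := ∞) (hθ.differentiableAt (by simp)) h.self_of_nhds.1
    (by rw [minSmoothness_of_isRCLikeNormedField]; exact WithTop.coe_le_coe.2 (le_top : (2 : ℕ∞) ≤ ⊤))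

theorem pullbackField_id {k : ℕ} (θ : FormField d M k) : pullbackField id θ = θ := by
  funext x
  ext v
  change θ x (fun i => mfderiv (𝓡 d) (𝓡 d) id x (v i)) = θ x v
  rw [mfderiv_id]
  rfl

/-- Smoothness of a field of forms at a point, in the preferred chart. -/
def SmoothFormAt {k : ℕ} (θ : FormField d M k) (x : M) : Prop :=
  ContDiffAt ℝ ∞ (inChart (chartAt (EuclideanSpace ℝ (Fin d)) x) θ)
    (chartAt (EuclideanSpace ℝ (Fin d)) x x)

/-- A change of chart is the pullback under the identity, read in two different charts. -/
theorem SmoothFormAt.contDiffAt_inChart {k : ℕ} {θ : FormField d M k} {x : M}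
    (h : SmoothFormAt θ x) {e : OpenPartialHomeomorph M (EuclideanSpace ℝ (Fin d))}
    (he : e ∈ atlas (EuclideanSpace ℝ (Fin d)) M) (hx : x ∈ e.source) :
    ContDiffAt ℝ ∞ (inChart e θ) (e x) := by
  have := contDiffAt_inChart_pullbackField (φ := id) (Filter.Eventually.of_forall fun _ => contMDiffAt_id) he hx
    (chart_mem_atlas _ x) (mem_chart_source _ x) h
  rwa [pullbackField_id] at this

theorem IsSmoothFormOn.smoothFormAt {k : ℕ} {θ : FormField d M k} {U : Set M} (hU : IsOpen U)
    (h : IsSmoothFormOn U θ) {x : M} (hx : x ∈ U) : SmoothFormAt θ x := by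
  set e := chartAt (EuclideanSpace ℝ (Fin d)) x
  refine (h e (chart_mem_atlas _ x)).contDiffAt ?_
  refine (e.symm.isOpen_inter_preimage hU).mem_nhds ⟨mem_chart_target _ x, ?_⟩
  change e.symm (e x) ∈ U
  rwa [e.left_inv (mem_chart_source _ x)]

theorem isSmoothFormOn_of_smoothFormAt {k : ℕ} {θ : FormField d M k} {U : Set M}
    (h : ∀ x ∈ U, SmoothFormAt θ x) : IsSmoothFormOn U θ := by
  intro e he y hy
  have := (h _ hy.2).contDiffAt_inChart he (e.map_target hy.1)
  rw [e.right_inv hy.1] at this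
  exact this.contDiffWithinAt

theorem SmoothFormAt.pullbackField {φ : M → M'} {x : M}
    (hφ : ∀ᶠ z in 𝓝 x, ContMDiffAt (𝓡 d) (𝓡 d) ∞ φ z) {k : ℕ}
    {θ : FormField d M' k} (hθ : SmoothFormAt θ (φ x)) : SmoothFormAt (pullbackField φ θ) x :=
  contDiffAt_inChart_pullbackField hφ (chart_mem_atlas _ x) (mem_chart_source _ x)
    (chart_mem_atlas _ _) (mem_chart_source _ _) hθ

/-- Naturality of d in coordinates, combined with the chain rule for the coordinate expression e' ∘
φ ∘ e⁻¹. -/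
theorem pullbackField_extDerivField {φ : M → M'} {x : M}
    (hφ : ∀ᶠ z in 𝓝 x, ContMDiffAt (𝓡 d) (𝓡 d) ∞ φ z) {k : ℕ}
    {θ : FormField d M' k} (hθ : SmoothFormAt θ (φ x)) :
    pullbackField φ (extDerivField θ) x = extDerivField (pullbackField φ θ) x := by
  set e := chartAt (EuclideanSpace ℝ (Fin d)) x with he
  set e' := chartAt (EuclideanSpace ℝ (Fin d)) (φ x) with he'
  have hxs : x ∈ e.source := mem_chart_source _ x
  have hxs' : φ x ∈ e'.source := mem_chart_source _ _
  have hem : e ∈ IsManifold.maximalAtlas (𝓡 d) ∞ M := IsManifold.chart_mem_maximalAtlas x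
  have hem' : e' ∈ IsManifold.maximalAtlas (𝓡 d) ∞ M' := IsManifold.chart_mem_maximalAtlas _
  have h := extDeriv_inChart_pullbackField hφ (chart_mem_atlas _ x) hxs
    (chart_mem_atlas _ (φ x)) hxs' hθ
  have hg := (inChart_pullbackField hφ (chart_mem_atlas _ x) hxs
    (chart_mem_atlas _ (φ x)) hxs' θ).self_of_nhds.1
  have hd : ∀ v, fderiv ℝ (e' ∘ φ ∘ e.symm) (e x) (mfderiv (𝓡 d) (𝓡 d) e x v) =
      mfderiv (𝓡 d) (𝓡 d) e' (φ x) (mfderiv (𝓡 d) (𝓡 d) φ x v) := by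
    have hge : MDifferentiableAt (𝓡 d) (𝓡 d) (e' ∘ φ ∘ e.symm) (e x) :=
      hg.contMDiffAt.mdifferentiableAt (by simp)
    have hee : MDifferentiableAt (𝓡 d) (𝓡 d) e x :=
      (contMDiffAt_of_mem_maximalAtlas hem hxs).mdifferentiableAt (by simp)
    have hee' : MDifferentiableAt (𝓡 d) (𝓡 d) e' (φ x) :=
      (contMDiffAt_of_mem_maximalAtlas hem' hxs').mdifferentiableAt (by simp)
    have hφ' : MDifferentiableAt (𝓡 d) (𝓡 d) φ x :=
      hφ.self_of_nhds.mdifferentiableAt (by simp)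
    have h1 := mfderiv_comp x hge hee
    have h2 := mfderiv_comp x hee' hφ'
    have h3 : ((e' ∘ φ ∘ e.symm) ∘ e) =ᶠ[𝓝 x] e' ∘ φ := by
      filter_upwards [e.open_source.mem_nhds hxs] with z hz
      simp [e.left_inv hz]
    rw [h3.mfderiv_eq, h2, mfderiv_eq_fderiv] at h1
    intro v
    exact (DFunLike.congr_fun h1 v).symm
  ext v
  change extDeriv (inChart e' θ) (e' (φ x)) (fun i => mfderiv (𝓡 d) (𝓡 d) e' (φ x)
    (mfderiv (𝓡 d) (𝓡 d) φ x (v i))) = extDeriv (inChart e (pullbackField φ θ)) (e x)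
      (fun i => mfderiv (𝓡 d) (𝓡 d) e x (v i))
  rw [h]
  change _ = extDeriv (inChart e' θ) (e' (φ x)) (fun i =>
    fderiv ℝ (e' ∘ φ ∘ e.symm) (e x) (mfderiv (𝓡 d) (𝓡 d) e x (v i)))
  simp only [hd]

/-- The exterior derivative is defined with a chart that varies from point to point. That any fixed
chart computes it is what makes dθ smooth. -/
theorem inChart_extDerivField {e : OpenPartialHomeomorph M (EuclideanSpace ℝ (Fin d))}
    (he : e ∈ atlas (EuclideanSpace ℝ (Fin d)) M) {k : ℕ} {θ : FormField d M k} {y}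
    (hy : y ∈ e.target) (hθ : SmoothFormAt θ (e.symm y)) :
    inChart e (extDerivField θ) y = extDeriv (inChart e θ) y := by
  set x := e.symm y with hx
  set e' := chartAt (EuclideanSpace ℝ (Fin d)) x with he'
  have hxs : x ∈ e.source := e.map_target hy
  have hxs' : x ∈ e'.source := mem_chart_source _ x
  have hem : e ∈ IsManifold.maximalAtlas (𝓡 d) ∞ M := IsManifold.subset_maximalAtlas he
  have hem' : e' ∈ IsManifold.maximalAtlas (𝓡 d) ∞ M := IsManifold.chart_mem_maximalAtlas x
  have h := extDeriv_inChart_pullbackField (φ := id) (Filter.Eventually.of_forall fun _ => contMDiffAt_id)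
    he hxs (chart_mem_atlas _ x) hxs' hθ
  rw [pullbackField_id, hx, e.right_inv hy, ← hx] at h
  rw [h]
  have h2 : mfderiv (𝓡 d) (𝓡 d) (e' ∘ e.symm) y = _ := mfderiv_comp y
    ((contMDiffAt_of_mem_maximalAtlas hem' hxs').mdifferentiableAt (by simp))
    ((contMDiffAt_symm_of_mem_maximalAtlas hem hy).mdifferentiableAt (by simp))
  rw [mfderiv_eq_fderiv] at h2
  ext v
  change extDeriv (inChart e' θ) (e' x) (fun i => mfderiv (𝓡 d) (𝓡 d) e' x
    (mfderiv (𝓡 d) (𝓡 d) e.symm y (v i))) = extDeriv (inChart e' θ) (e' x) (fun i =>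
      fderiv ℝ (e' ∘ e.symm) y (v i))
  rw [h2]
  rfl

end Charts

/-! ### Pullback of the pointwise structures under linear maps -/

section LinearPullback

variable {V : Type*} [AddCommGroup V] [Module ℝ V] [TopologicalSpace V]
  [IsTopologicalAddGroup V] [ContinuousSMul ℝ V]
  {W : Type*} [AddCommGroup W] [Module ℝ W] [TopologicalSpace W]
  [IsTopologicalAddGroup W] [ContinuousSMul ℝ W]

/-- The pullback of graded forms under a continuous linear map. -/
def gradedPullback (f : V →L[ℝ] W) : GradedForm W →ₗ[ℝ] GradedForm V where
  toFun θ p := (θ p).compContinuousLinearMap f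
  map_add' _ _ := rfl
  map_smul' _ _ := rfl

theorem castDegree_compContinuousLinearMap {p q : ℕ} (h : p = q) (θ : W [⋀^Fin p]→L[ℝ] ℝ)
    (f : V →L[ℝ] W) :
    (castDegree h θ).compContinuousLinearMap f = castDegree h (θ.compContinuousLinearMap f) := by
  subst h; rfl

theorem lefschetzPow_compContinuousLinearMap (Ω : W [⋀^Fin 2]→L[ℝ] ℝ) {p : ℕ}
    (θ : W [⋀^Fin p]→L[ℝ] ℝ) (f : V →L[ℝ] W) (k : ℕ) :
    (lefschetzPow Ω θ k).compContinuousLinearMap f =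
      lefschetzPow (Ω.compContinuousLinearMap f) (θ.compContinuousLinearMap f) k := by
  induction k with
  | zero => rfl
  | succ k ih =>
    refine (wedge_compContinuousLinearMap f _ _).trans ?_
    rw [ih]
    rfl

theorem gradedPullback_single (f : V →L[ℝ] W) {p : ℕ} (θ : W [⋀^Fin p]→L[ℝ] ℝ) :
    gradedPullback f (Pi.single p θ) = Pi.single p (θ.compContinuousLinearMap f) := by
  funext q
  by_cases hq : q = p
  · subst hq
    change (Pi.single (M := fun p => W [⋀^Fin p]→L[ℝ] ℝ) q θ q).compContinuousLinearMap f = _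
    rw [Pi.single_eq_same, Pi.single_eq_same]
  · change (Pi.single (M := fun p => W [⋀^Fin p]→L[ℝ] ℝ) p θ q).compContinuousLinearMap f = _
    rw [Pi.single_eq_of_ne hq, Pi.single_eq_of_ne hq]
    rfl

theorem gradedPullback_mulOne (f : V →L[ℝ] W) (α : W [⋀^Fin 1]→L[ℝ] ℝ) (θ : GradedForm W) :
    gradedPullback f (mulOne α θ) =
      mulOne (α.compContinuousLinearMap f) (gradedPullback f θ) := by
  funext p
  rcases p with _ | p
  · rfl
  · exact wedge_compContinuousLinearMap f _ _

theorem gradedPullback_mulTwo (f : V →L[ℝ] W) (Ω : W [⋀^Fin 2]→L[ℝ] ℝ) (θ : GradedForm W) :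
    gradedPullback f (mulTwo Ω θ) =
      mulTwo (Ω.compContinuousLinearMap f) (gradedPullback f θ) := by
  funext p
  rcases p with _ | _ | p
  · rfl
  · rfl
  · exact wedge_compContinuousLinearMap f _ _

theorem gradedPullback_mulTwo_pow (f : V →L[ℝ] W) (Ω : W [⋀^Fin 2]→L[ℝ] ℝ) (k : ℕ)
    (θ : GradedForm W) : gradedPullback f ((mulTwo Ω ^ k) θ) =
      (mulTwo (Ω.compContinuousLinearMap f) ^ k) (gradedPullback f θ) := by
  induction k with
  | zero => rfl
  | succ k ih =>
    rw [pow_succ', Module.End.mul_apply, gradedPullback_mulTwo, ih, ← Module.End.mul_apply,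
      ← pow_succ']

theorem contractLast_compContinuousLinearMap (f : V →L[ℝ] W) (r : V) {p : ℕ}
    (θ : W [⋀^Fin (p + 1)]→L[ℝ] ℝ) : contractLast r (θ.compContinuousLinearMap f) =
      (contractLast (f r) θ).compContinuousLinearMap f := by
  ext v
  change contractLast r (θ.compContinuousLinearMap f) v = contractLast (f r) θ (f ∘ v)
  rw [contractLast_apply, contractLast_apply]
  change θ (f ∘ Fin.snoc v r) = _
  rw [Fin.comp_snoc]

theorem compContinuousLinearMap_injective {f : V →L[ℝ] W} (hf : Function.Surjective f) {p : ℕ} :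
    Function.Injective fun θ : W [⋀^Fin p]→L[ℝ] ℝ => θ.compContinuousLinearMap f := by
  intro θ η h
  ext v
  choose g hg using hf
  have := DFunLike.congr_fun h fun i => g (v i)
  change θ (fun i => f (g (v i))) = η (fun i => f (g (v i))) at this
  simpa only [hg] using this

variable {n : ℕ} {α : W [⋀^Fin 1]→L[ℝ] ℝ} {Ω : W [⋀^Fin 2]→L[ℝ] ℝ}

theorem IsDecomposition.compContinuousLinearMap {a : ℕ} {θ : W [⋀^Fin a]→L[ℝ] ℝ}
    {π : (j : ℕ) → W [⋀^Fin j]→L[ℝ] ℝ}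
    (h : IsDecomposition n α Ω a (Pi.single a θ) fun j => Pi.single j (π j)) (f : V →L[ℝ] W) :
    IsDecomposition n (α.compContinuousLinearMap f) (Ω.compContinuousLinearMap f) a
      (Pi.single a (θ.compContinuousLinearMap f))
      fun j => Pi.single j ((π j).compContinuousLinearMap f) := by
  refine ⟨fun j => isHomogeneous_single _ _, fun j hj => ?_, ?_⟩
  · rw [← gradedPullback_single, ← gradedPullback_mulOne, ← gradedPullback_mulTwo_pow,
      h.primitive j hj, map_zero]
  · rw [← gradedPullback_single, ← gradedPullback_mulOne, h.sum_eq, map_sum]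
    refine Finset.sum_congr rfl fun j _ => ?_
    rw [gradedPullback_mulTwo_pow, gradedPullback_mulOne, gradedPullback_single]

theorem IsContactPair.compContinuousLinearMap (h : IsContactPair n α Ω) {f : V →L[ℝ] W}
    (hf : Function.Surjective f) :
    IsContactPair n (α.compContinuousLinearMap f) (Ω.compContinuousLinearMap f) := by
  rw [isContactPair_iff] at h ⊢
  rw [← lefschetzPow_compContinuousLinearMap]
  exact fun h0 => h (compContinuousLinearMap_injective hf h0)

/-- Surjectivity ensures that f maps the kernel of the pulled-back 2-form into that of Ω. -/
theorem IsHorizontal.compContinuousLinearMap {j : ℕ} {θ : W [⋀^Fin j]→L[ℝ] ℝ}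
    (h : IsHorizontal Ω (Pi.single j θ)) {f : V →L[ℝ] W} (hf : Function.Surjective f) :
    IsHorizontal (Ω.compContinuousLinearMap f) (Pi.single j (θ.compContinuousLinearMap f)) := by
  intro r hr
  rw [contractLast_compContinuousLinearMap] at hr
  have h1 := h (f r) (compContinuousLinearMap_injective hf hr)
  rw [← gradedPullback_single]
  funext p
  have h2 := contractLast_compContinuousLinearMap f r
    ((Pi.single j θ : GradedForm W) (p + 1))
  refine h2.trans ?_
  have h3 := congrFun h1 p
  rw [contract_apply] at h3
  rw [h3]
  rfl

end LinearPullback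

/-! ### Proportionality of 1-forms with equal kernels -/

section OneForms

theorem one_form_add {V : Type*} [AddCommGroup V] [Module ℝ V] [TopologicalSpace V]
    (α : V [⋀^Fin 1]→L[ℝ] ℝ) (u v : V) :
    α (fun _ => u + v) = α (fun _ => u) + α (fun _ => v) := by
  have h : ∀ w : V, (fun _ : Fin 1 => w) = Function.update (fun _ => 0) 0 w := fun w => by
    funext i; rw [Subsingleton.elim i 0, Function.update_self]
  rw [h (u + v), α.map_update_add, ← h u, ← h v]

theorem one_form_smul {V : Type*} [AddCommGroup V] [Module ℝ V] [TopologicalSpace V]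
    (α : V [⋀^Fin 1]→L[ℝ] ℝ) (c : ℝ) (v : V) : α (fun _ => c • v) = c * α (fun _ => v) := by
  have h : ∀ w : V, (fun _ : Fin 1 => w) = Function.update (fun _ => 0) 0 w := fun w => by
    funext i; rw [Subsingleton.elim i 0, Function.update_self]
  rw [h (c • v), α.map_update_smul, ← h v, smul_eq_mul]

/-- The vector α(w) v - α(v) w lies in ker α, hence β vanishes on it. -/
theorem one_form_mul_eq {V : Type*} [AddCommGroup V] [Module ℝ V] [TopologicalSpace V]
    {α β : V [⋀^Fin 1]→L[ℝ] ℝ} (h : ∀ v, α (fun _ => v) = 0 → β (fun _ => v) = 0) (v w : V) :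
    β (fun _ => v) * α (fun _ => w) = β (fun _ => w) * α (fun _ => v) := by
  have h1 := h (α (fun _ => w) • v + (-α (fun _ => v)) • w) (by
    rw [one_form_add, one_form_smul, one_form_smul]; ring)
  rw [one_form_add, one_form_smul, one_form_smul] at h1
  linarith

variable {E : Type*} [NormedAddCommGroup E] [NormedSpace ℝ E]

theorem extDeriv_one_form_apply {α : E → E [⋀^Fin 1]→L[ℝ] ℝ} {y : E}
    (hα : DifferentiableAt ℝ α y) (v : Fin 2 → E) : extDeriv α y v =
      fderiv ℝ (fun z => α z fun _ => v 1) y (v 0) -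
        fderiv ℝ (fun z => α z fun _ => v 0) y (v 1) := by
  have h0 : Fin.removeNth 0 v = fun _ => v 1 := by
    funext i; rw [Subsingleton.elim i 0]; rfl
  have h1 : Fin.removeNth 1 v = fun _ => v 0 := by
    funext i; rw [Subsingleton.elim i 0]; rfl
  rw [extDeriv_apply hα, Fin.sum_univ_two, h0, h1]
  simp [sub_eq_add_neg]

/-- Two 1-forms with the same kernels are proportional, and so are their derivatives on the
kernel. -/
theorem exists_smul_of_kernel_eq {α β : E → E [⋀^Fin 1]→L[ℝ] ℝ} {y : E}
    (hα : DifferentiableAt ℝ α y) (hβ : DifferentiableAt ℝ β y)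
    (h : ∀ᶠ z in 𝓝 y, ∀ v, α z (fun _ => v) = 0 ↔ β z (fun _ => v) = 0) (h0 : α y ≠ 0) :
    ∃ f : ℝ, f ≠ 0 ∧ β y = f • α y ∧ ∀ v : Fin 2 → E, (∀ i, α y (fun _ => v i) = 0) →
      extDeriv β y v = f * extDeriv α y v := by
  obtain ⟨w, hw⟩ : ∃ w, α y (fun _ => w) ≠ 0 := by
    by_contra! hc
    refine h0 (ContinuousAlternatingMap.ext fun v => ?_)
    rw [show v = fun _ => v 0 from funext fun i => by rw [Subsingleton.elim i 0], hc]
    rfl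
  have hmul : ∀ᶠ z in 𝓝 y, ∀ v, β z (fun _ => v) * α z (fun _ => w) =
      β z (fun _ => w) * α z (fun _ => v) :=
    h.mono fun z hz v => one_form_mul_eq (fun v => (hz v).1) v w
  have hβv : ∀ v, β y (fun _ => v) = β y (fun _ => w) / α y (fun _ => w) * α y (fun _ => v) := by
    intro v
    have := hmul.self_of_nhds v
    field_simp
    linarith
  -- Differentiate β(v) α(w) = β(w) α(v) at y. For v in the common kernel at y, the terms with
  -- undifferentiated α(v) or β(v) drop out, so no derivative of the proportionality factor appears.
  have hd : ∀ v : E, α y (fun _ => v) = 0 → ∀ u, fderiv ℝ (fun z => β z fun _ => v) y u =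
      β y (fun _ => w) / α y (fun _ => w) * fderiv ℝ (fun z => α z fun _ => v) y u := by
    intro v hv u
    have hv' := (h.self_of_nhds v).1 hv
    have hA : ∀ v : E, DifferentiableAt ℝ (fun z => α z fun _ => v) y := fun v =>
      hα.continuousAlternatingMap_apply_const _
    have hB : ∀ v : E, DifferentiableAt ℝ (fun z => β z fun _ => v) y := fun v =>
      hβ.continuousAlternatingMap_apply_const _
    have h1 : (fun z => β z (fun _ => v) * α z (fun _ => w)) =ᶠ[𝓝 y]
      fun z => β z (fun _ => w) * α z (fun _ => v) := hmul.mono fun z hz => hz v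
    have h2 := h1.fderiv_eq (𝕜 := ℝ)
    rw [fderiv_fun_mul (hB v) (hA w), fderiv_fun_mul (hB w) (hA v), hv, hv'] at h2
    have h3 := DFunLike.congr_fun h2 u
    simp only [zero_smul, zero_add, add_zero, smul_apply, smul_eq_mul] at h3
    field_simp
    linarith
  refine ⟨β y (fun _ => w) / α y (fun _ => w), div_ne_zero ?_ hw, ?_, fun v hv => ?_⟩
  · exact fun hc => hw ((h.self_of_nhds w).2 hc)
  · ext v
    rw [show v = fun _ => v 0 from funext fun i => by rw [Subsingleton.elim i 0]]
    exact hβv _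
  · rw [extDeriv_one_form_apply hα, extDeriv_one_form_apply hβ, hd _ (hv 0), hd _ (hv 1)]
    ring

end OneForms

/-! ### Comparison of defining forms on a contact manifold -/

section DefiningForms

instance {d : ℕ} {M : Type*} [TopologicalSpace M] [ChartedSpace (EuclideanSpace ℝ (Fin d)) M]
    (x : M) : T2Space (TangentSpace (𝓡 d) x) :=
  inferInstanceAs (T2Space (EuclideanSpace ℝ (Fin d)))

instance {d : ℕ} {M : Type*} [TopologicalSpace M] [ChartedSpace (EuclideanSpace ℝ (Fin d)) M]
    (x : M) : FiniteDimensional ℝ (TangentSpace (𝓡 d) x) :=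
  inferInstanceAs (FiniteDimensional ℝ (EuclideanSpace ℝ (Fin d)))

theorem finrank_tangentSpace {d : ℕ} {M : Type*} [TopologicalSpace M]
    [ChartedSpace (EuclideanSpace ℝ (Fin d)) M] (x : M) :
    Module.finrank ℝ (TangentSpace (𝓡 d) x) = d :=
  finrank_euclideanSpace_fin

theorem inChart_compContinuousLinearMap {d : ℕ} {M : Type*} [TopologicalSpace M]
    [ChartedSpace (EuclideanSpace ℝ (Fin d)) M] [IsManifold (𝓡 d) ∞ M]
    {e : OpenPartialHomeomorph M (EuclideanSpace ℝ (Fin d))}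
    (he : e ∈ atlas (EuclideanSpace ℝ (Fin d)) M) {x : M} (hx : x ∈ e.source) {k : ℕ}
    (θ : FormField d M k) :
    (inChart e θ (e x)).compContinuousLinearMap (mfderiv (𝓡 d) (𝓡 d) e x) = θ x := by
  have hem : e ∈ IsManifold.maximalAtlas (𝓡 d) ∞ M := IsManifold.subset_maximalAtlas he
  have h1 : pullbackField e (inChart e θ) x = pullbackField (e.symm ∘ e) θ x :=
    pullbackField_comp
      ((contMDiffAt_symm_of_mem_maximalAtlas hem (e.map_source hx)).mdifferentiableAt (by simp))
      ((contMDiffAt_of_mem_maximalAtlas hem hx).mdifferentiableAt (by simp)) θ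
  have h2 : pullbackField (e.symm ∘ e) θ x = pullbackField id θ x := by
    refine pullbackField_congr ?_ θ
    filter_upwards [e.open_source.mem_nhds hx] with z hz
    exact e.left_inv hz
  rw [h2, pullbackField_id] at h1
  exact h1

theorem surjective_mfderiv_symm {d : ℕ} {M : Type*} [TopologicalSpace M]
    [ChartedSpace (EuclideanSpace ℝ (Fin d)) M] [IsManifold (𝓡 d) ∞ M]
    {e : OpenPartialHomeomorph M (EuclideanSpace ℝ (Fin d))}
    (he : e ∈ atlas (EuclideanSpace ℝ (Fin d)) M) {y} (hy : y ∈ e.target) :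
    Function.Surjective (mfderiv (𝓡 d) (𝓡 d) e.symm y) := by
  have hem : e ∈ IsManifold.maximalAtlas (𝓡 d) ∞ M := IsManifold.subset_maximalAtlas he
  have hx := e.map_target hy
  have h1 : e.symm ∘ e =ᶠ[𝓝 (e.symm y)] id := by
    filter_upwards [e.open_source.mem_nhds hx] with z hz
    exact e.left_inv hz
  have h2 := h1.mfderiv_eq (I := 𝓡 d) (I' := 𝓡 d)
  have hd1 : MDifferentiableAt (𝓡 d) (𝓡 d) e.symm (e (e.symm y)) := by
    rw [e.right_inv hy]
    exact (contMDiffAt_symm_of_mem_maximalAtlas hem hy).mdifferentiableAt (by simp)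
  rw [mfderiv_comp (e.symm y) hd1
    ((contMDiffAt_of_mem_maximalAtlas hem hx).mdifferentiableAt (by simp)), mfderiv_id] at h2
  have h3 : ∀ z, z = y → ∀ v : EuclideanSpace ℝ (Fin d), ∀ w : EuclideanSpace ℝ (Fin d),
      mfderiv (𝓡 d) (𝓡 d) e.symm z v = w → mfderiv (𝓡 d) (𝓡 d) e.symm y v = w := by
    rintro z rfl v w h; exact h
  intro w
  exact ⟨mfderiv (𝓡 d) (𝓡 d) e (e.symm y) w, h3 _ (e.right_inv hy) _ w (DFunLike.congr_fun h2 w)⟩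

variable {n : ℕ} {M : Type*} [TopologicalSpace M]
  [ChartedSpace (EuclideanSpace ℝ (Fin (2 * n + 1))) M] [IsManifold (𝓡 (2 * n + 1)) ∞ M]

theorem IsDefiningFormOn.exists_smul {Q : PlaneField n M} {U U' : Set M}
    {α β : FormField (2 * n + 1) M 1} (hα : IsDefiningFormOn Q U α)
    (hβ : IsDefiningFormOn Q U' β) {x : M} (hx : x ∈ U) (hx' : x ∈ U') (h0 : α x ≠ 0) :
    ∃ f : ℝ, f ≠ 0 ∧ β x = f • α x ∧
      restrictTo (Q x) (extDerivField β x) = f • restrictTo (Q x) (extDerivField α x) := by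
  set e := chartAt (EuclideanSpace ℝ (Fin (2 * n + 1))) x with he
  have hxs : x ∈ e.source := mem_chart_source _ x
  have heq : ∀ {k : ℕ} (θ : FormField (2 * n + 1) M k), _ = θ x := fun θ =>
    inChart_compContinuousLinearMap (chart_mem_atlas _ x) hxs θ
  have hsα := hα.smooth.smoothFormAt hα.isOpen hx
  have hsβ := hβ.smooth.smoothFormAt hβ.isOpen hx'
  have hsymm : Filter.Tendsto e.symm (𝓝 (e x)) (𝓝 x) := by
    have := e.symm.continuousAt (e.map_source hxs)
    rwa [ContinuousAt, e.left_inv hxs] at this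
  obtain ⟨f, hf, h1, h2⟩ := exists_smul_of_kernel_eq (hsα.differentiableAt (by simp))
    (hsβ.differentiableAt (by simp)) (by
      filter_upwards [hsymm.eventually (hα.isOpen.eventually_mem hx),
        hsymm.eventually (hβ.isOpen.eventually_mem hx')] with z hz hz' v
      exact (hα.mem_iff _ hz _).symm.trans (hβ.mem_iff _ hz' _)) (by
      intro hc
      apply h0
      rw [← heq α, hc]
      rfl)
  refine ⟨f, hf, ?_, ?_⟩
  · rw [← heq α, ← heq β, h1]
    rfl
  · ext v
    refine h2 (fun i => mfderiv (𝓡 (2 * n + 1)) (𝓡 (2 * n + 1)) e x (v i)) fun i => ?_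
    have h3 := (hα.mem_iff x hx (v i)).1 (v i).2
    rw [← heq α] at h3
    exact h3

/-- A defining form is only required to have kernel Q; nondegeneracy is inherited from the contact
form given near x, to which it is proportional at x by a nonzero factor. -/
theorem IsDefiningFormOn.isContactPair {ξ : ContactStructure n M} {U : Set M}
    {α : FormField (2 * n + 1) M 1} (hα : IsDefiningFormOn ξ.plane U α) {x : M} (hx : x ∈ U) :
    IsContactPair n (α x) (extDerivField α x) := by
  obtain ⟨U₀, α₀, hx₀, hα₀, h⟩ := ξ.exists_contactForm x
  have h0 := isContactPair_iff.2 (h x hx₀)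
  obtain ⟨f, hf, h1, h2⟩ := hα₀.exists_smul hα hx₀ hx h0.ne_zero
  rw [h1]
  exact h0.smul (hα₀.mem_iff x hx₀) hf h2

theorem IsDefiningFormOn.operator_eq {ξ : ContactStructure n M} {U U' : Set M}
    {α β : FormField (2 * n + 1) M 1} (hα : IsDefiningFormOn ξ.plane U α)
    (hβ : IsDefiningFormOn ξ.plane U' β) {x : M} (hx : x ∈ U) (hx' : x ∈ U') {a : ℕ}
    {θ : TangentSpace (𝓡 (2 * n + 1)) x [⋀^Fin a]→L[ℝ] ℝ}
    {π π' : (j : ℕ) → TangentSpace (𝓡 (2 * n + 1)) x [⋀^Fin j]→L[ℝ] ℝ}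
    (hπ : IsDecomposition n (α x) (extDerivField α x) a (Pi.single a θ)
      fun j => Pi.single j (π j))
    (hπ' : IsDecomposition n (β x) (extDerivField β x) a (Pi.single a θ)
      fun j => Pi.single j (π' j)) {i : ℕ} (hi : i ∈ lefschetzIndices n a) (hia : i + 2 ≤ a) :
    wedge (lefschetzPow (extDerivField β x) (π' i) ((a - i - 2) / 2)) (β x) =
      wedge (lefschetzPow (extDerivField α x) (π i) ((a - i - 2) / 2)) (α x) := by
  have h0 := hα.isContactPair hx
  obtain ⟨f, hf, h1, h2⟩ := hα.exists_smul hβ hx hx' h0.ne_zero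
  rw [h1] at hπ' ⊢
  have h := h0.operator_eq (hα.mem_iff x hx) hf h2 hπ hπ' hi hia
  simp only [mulTwo_pow_single, mulOne_single] at h
  have h' := congrFun h (i + 2 * ((a - i - 2) / 2) + 1)
  rwa [Pi.single_eq_same, Pi.single_eq_same] at h'

end DefiningForms

/-! ### Smoothness of derivatives and products of forms -/

section SmoothForms

variable {d : ℕ} {M : Type*} [TopologicalSpace M] [ChartedSpace (EuclideanSpace ℝ (Fin d)) M]
  [IsManifold (𝓡 d) ∞ M]

theorem contDiffAt_extDeriv {E : Type*} [NormedAddCommGroup E] [NormedSpace ℝ E] {k : ℕ}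
    {θ : E → E [⋀^Fin k]→L[ℝ] ℝ} {y : E} (hθ : ContDiffAt ℝ ∞ θ y) :
    ContDiffAt ℝ ∞ (extDeriv θ) y := by
  change ContDiffAt ℝ ∞ (ContinuousAlternatingMap.alternatizeUncurryFinCLM ℝ E ℝ ∘ fderiv ℝ θ) y
  exact (ContinuousLinearMap.contDiff _).contDiffAt.comp y
    (hθ.fderiv_right (m := ∞) (by simp))

theorem tendsto_symm {e : OpenPartialHomeomorph M (EuclideanSpace ℝ (Fin d))} {x : M}
    (hx : x ∈ e.source) : Filter.Tendsto e.symm (𝓝 (e x)) (𝓝 x) := by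
  have := e.symm.continuousAt (e.map_source hx)
  rwa [ContinuousAt, e.left_inv hx] at this

theorem SmoothFormAt.extDerivField {k : ℕ} {θ : FormField d M k} {x : M}
    (h : ∀ᶠ z in 𝓝 x, SmoothFormAt θ z) : SmoothFormAt (extDerivField θ) x := by
  set e := chartAt (EuclideanSpace ℝ (Fin d)) x with he
  have hxs : x ∈ e.source := mem_chart_source _ x
  refine ContDiffAt.congr_of_eventuallyEq (contDiffAt_extDeriv h.self_of_nhds) ?_
  filter_upwards [e.open_target.eventually_mem (e.map_source hxs), (tendsto_symm hxs).eventually h]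
    with y hy hy'
  exact inChart_extDerivField (chart_mem_atlas _ x) hy hy'

theorem SmoothFormAt.congr {k : ℕ} {θ η : FormField d M k} {x : M} (h : SmoothFormAt θ x)
    (he : ∀ᶠ z in 𝓝 x, η z = θ z) : SmoothFormAt η x := by
  refine ContDiffAt.congr_of_eventuallyEq h ?_
  filter_upwards [(tendsto_symm (mem_chart_source _ x)).eventually he] with y hy
  change (η _).compContinuousLinearMap _ = (θ _).compContinuousLinearMap _
  rw [hy]

theorem SmoothFormAt.castDegree {p q : ℕ} (h : p = q) {θ : FormField d M p} {x : M}
    (hθ : SmoothFormAt θ x) : SmoothFormAt (fun z => castDegree h (θ z)) x := by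
  subst h; exact hθ

theorem SmoothFormAt.wedge {p q : ℕ} {θ : FormField d M p} {η : FormField d M q} {x : M}
    (hθ : SmoothFormAt θ x) (hη : SmoothFormAt η x) :
    SmoothFormAt (fun z => wedge (θ z) (η z)) x := by
  refine ContDiffAt.congr_of_eventuallyEq (contDiffAt_wedge hθ hη)
    (Filter.Eventually.of_forall fun y => ?_)
  exact wedge_compContinuousLinearMap _ _ _

theorem SmoothFormAt.lefschetzPow {p : ℕ} {Ω : FormField d M 2} {θ : FormField d M p} {x : M}
    (hΩ : SmoothFormAt Ω x) (hθ : SmoothFormAt θ x) (k : ℕ) :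
    SmoothFormAt (fun z => lefschetzPow (Ω z) (θ z) k) x := by
  induction k with
  | zero => exact hθ
  | succ k ih => exact ih.wedge hΩ

end SmoothForms

/-! ### Smooth Lefschetz decompositions -/

section Existence

variable {n : ℕ} {M : Type*} [TopologicalSpace M]
  [ChartedSpace (EuclideanSpace ℝ (Fin (2 * n + 1))) M] [IsManifold (𝓡 (2 * n + 1)) ∞ M]
  {ξ : ContactStructure n M} {U : Set M} {α : FormField (2 * n + 1) M 1} {a : ℕ}

theorem IsDefiningFormOn.smoothFormAt {Q : PlaneField n M} (hα : IsDefiningFormOn Q U α) {x : M}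
    (hx : x ∈ U) : SmoothFormAt α x :=
  hα.smooth.smoothFormAt hα.isOpen hx

theorem IsDefiningFormOn.smoothFormAt_extDerivField {Q : PlaneField n M}
    (hα : IsDefiningFormOn Q U α) {x : M} (hx : x ∈ U) : SmoothFormAt (extDerivField α) x :=
  SmoothFormAt.extDerivField ((hα.isOpen.eventually_mem hx).mono fun _ hz => hα.smoothFormAt hz)

/-- Horizontal decompositions are chosen at each point independently. Their uniqueness makes them
smooth with no further choice, and on the whole of U, so nothing has to be patched. -/
theorem IsDefiningFormOn.exists_isLefschetzDecompositionOn (hα : IsDefiningFormOn ξ.plane U α)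
    (ha : a ≤ 2 * n) {θ : FormField (2 * n + 1) M a} (hθ : IsSmoothFormOn U θ) :
    ∃ π : (j : ℕ) → FormField (2 * n + 1) M j, IsLefschetzDecompositionOn ξ U α θ π := by
  have h : ∀ x, ∃ π : (j : ℕ) → TangentSpace (𝓡 (2 * n + 1)) x [⋀^Fin j]→L[ℝ] ℝ, x ∈ U →
      IsDecomposition n (α x) (extDerivField α x) a (Pi.single a (θ x))
        (fun j => Pi.single j (π j)) ∧
      ∀ j, IsHorizontal (extDerivField α x) (Pi.single j (π j)) := by
    intro x
    by_cases hx : x ∈ U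
    · obtain ⟨π, hπ⟩ := (hα.isContactPair hx).exists_horizontal (finrank_tangentSpace x) ha (θ x)
      exact ⟨π, fun _ => hπ⟩
    · exact ⟨fun _ => 0, fun hx' => absurd hx' hx⟩
  choose π hπ using h
  have hiff : ∀ x ∈ U, _ := fun x hx =>
    (isDecomposition_single_iff (hα.isContactPair hx).ne_zero (hα.mem_iff x hx)).1 (hπ x hx).1
  refine ⟨fun j x => π x j, fun j hj => isSmoothFormOn_of_smoothFormAt fun x hx => ?_,
    fun j hj => ⟨?_, fun x hx => (hiff x hx).1 j hj⟩, fun x hx => (hiff x hx).2⟩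
  · set e := chartAt (EuclideanSpace ℝ (Fin (2 * n + 1))) x with he
    have hxs : x ∈ e.source := mem_chart_source _ x
    have hnear : ∀ᶠ y in 𝓝 (e x), y ∈ e.target ∧ e.symm y ∈ U :=
      (e.open_target.eventually_mem (e.map_source hxs)).and
        ((tendsto_symm hxs).eventually (hα.isOpen.eventually_mem hx))
    refine contDiffAt_of_isDecomposition (α := inChart e α) (Ω := inChart e (extDerivField α))
      (θ := inChart e θ) (π := fun y j => inChart e (fun x => π x j) y) (n := n) (a := a)
      finrank_euclideanSpace_fin (hα.smoothFormAt hx) (hα.smoothFormAt_extDerivField hx)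
      ?_ (hθ.smoothFormAt hα.isOpen hx) ?_ ?_ hj
    · filter_upwards [hnear] with y hy
      exact (hα.isContactPair hy.2).compContinuousLinearMap
        (surjective_mfderiv_symm (chart_mem_atlas _ x) hy.1)
    · filter_upwards [hnear] with y hy
      exact (hπ _ hy.2).1.compContinuousLinearMap (mfderiv (𝓡 (2 * n + 1)) (𝓡 (2 * n + 1)) e.symm y)
    · filter_upwards [hnear] with y hy j
      exact ((hπ _ hy.2).2 j).compContinuousLinearMap
        (surjective_mfderiv_symm (chart_mem_atlas _ x) hy.1)
  · have := mem_lefschetzIndices.1 hj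
    omega

theorem IsLefschetzDecompositionOn.isDecomposition (hα : IsDefiningFormOn ξ.plane U α)
    {θ : FormField (2 * n + 1) M a} {π : (j : ℕ) → FormField (2 * n + 1) M j}
    (h : IsLefschetzDecompositionOn ξ U α θ π) {x : M} (hx : x ∈ U) :
    IsDecomposition n (α x) (extDerivField α x) a (Pi.single a (θ x))
      (fun j => Pi.single j (π j x)) :=
  (isDecomposition_single_iff (hα.isContactPair hx).ne_zero (hα.mem_iff x hx)).2
    ⟨fun j hj => (h.primitive j hj).2 x hx, h.decomp x hx⟩

end Existence

/-! ### Linearity of decompositions at a point -/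

section PointwiseLinear

variable {V : Type*} [AddCommGroup V] [Module ℝ V] [TopologicalSpace V]
  [IsTopologicalAddGroup V] [ContinuousSMul ℝ V] {n a : ℕ} {α : V [⋀^Fin 1]→L[ℝ] ℝ}
  {Ω : V [⋀^Fin 2]→L[ℝ] ℝ} {θ θ' : V [⋀^Fin a]→L[ℝ] ℝ} {π π' : (j : ℕ) → V [⋀^Fin j]→L[ℝ] ℝ}

theorem IsDecomposition.add
    (h : IsDecomposition n α Ω a (Pi.single a θ) fun j => Pi.single j (π j))
    (h' : IsDecomposition n α Ω a (Pi.single a θ') fun j => Pi.single j (π' j)) :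
    IsDecomposition n α Ω a (Pi.single a (θ + θ')) fun j => Pi.single j (π j + π' j) := by
  refine ⟨fun j => isHomogeneous_single _ _, fun j hj => ?_, ?_⟩
  · rw [Pi.single_add, map_add, map_add, h.primitive j hj, h'.primitive j hj, add_zero]
  · rw [Pi.single_add, map_add, h.sum_eq, h'.sum_eq, ← Finset.sum_add_distrib]
    refine Finset.sum_congr rfl fun j _ => ?_
    rw [Pi.single_add, map_add, map_add]

theorem IsDecomposition.smul
    (h : IsDecomposition n α Ω a (Pi.single a θ) fun j => Pi.single j (π j)) (c : ℝ) :
    IsDecomposition n α Ω a (Pi.single a (c • θ)) fun j => Pi.single j (c • π j) := by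
  refine ⟨fun j => isHomogeneous_single _ _, fun j hj => ?_, ?_⟩
  · rw [Pi.single_smul, map_smul, map_smul, h.primitive j hj, smul_zero]
  · rw [Pi.single_smul, map_smul, h.sum_eq, Finset.smul_sum]
    refine Finset.sum_congr rfl fun j _ => ?_
    rw [Pi.single_smul, map_smul, map_smul]

theorem lefschetzPow_add (Ω : V [⋀^Fin 2]→L[ℝ] ℝ) {p : ℕ} (θ η : V [⋀^Fin p]→L[ℝ] ℝ) (k : ℕ) :
    lefschetzPow Ω (θ + η) k = lefschetzPow Ω θ k + lefschetzPow Ω η k := by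
  induction k with
  | zero => rfl
  | succ k ih =>
    exact (congrArg (fun ψ => wedge (p := p + 2 * k) (q := 2) ψ Ω) ih).trans
      (wedge_add_left _ _ _)

theorem lefschetzPow_smul (Ω : V [⋀^Fin 2]→L[ℝ] ℝ) {p : ℕ} (c : ℝ) (θ : V [⋀^Fin p]→L[ℝ] ℝ)
    (k : ℕ) : lefschetzPow Ω (c • θ) k = c • lefschetzPow Ω θ k := by
  induction k with
  | zero => rfl
  | succ k ih =>
    exact (congrArg (fun ψ => wedge (p := p + 2 * k) (q := 2) ψ Ω) ih).trans
      (wedge_smul_left _ _ _)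

theorem castDegree_add {p q : ℕ} (h : p = q) (θ η : V [⋀^Fin p]→L[ℝ] ℝ) :
    castDegree h (θ + η) = castDegree h θ + castDegree h η := by
  subst h; rfl

theorem castDegree_smul {p q : ℕ} (h : p = q) (c : ℝ) (θ : V [⋀^Fin p]→L[ℝ] ℝ) :
    castDegree h (c • θ) = c • castDegree h θ := by
  subst h; rfl

end PointwiseLinear

/-! ### The contact operator, described by its values at points -/

section Operator

variable {n a i : ℕ} (hia : i + 2 ≤ a) (hmod : i % 2 = a % 2)
  {M : Type*} [TopologicalSpace M]
  [ChartedSpace (EuclideanSpace ℝ (Fin (2 * n + 1))) M] [IsManifold (𝓡 (2 * n + 1)) ∞ M]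

/-- `η` is the value at `x` of the contact operator applied to `θ`, computed with some defining
form and some decomposition at `x`. -/
def IsOperatorValue (ξ : ContactStructure n M) (θ : FormField (2 * n + 1) M a) (x : M)
    (η : TangentSpace (𝓡 (2 * n + 1)) x [⋀^Fin (a - 1)]→L[ℝ] ℝ) : Prop :=
  ∃ (U : Set M) (α : FormField (2 * n + 1) M 1)
    (π : (j : ℕ) → TangentSpace (𝓡 (2 * n + 1)) x [⋀^Fin j]→L[ℝ] ℝ),
    IsDefiningFormOn ξ.plane U α ∧ x ∈ U ∧
    IsDecomposition n (α x) (extDerivField α x) a (Pi.single a (θ x))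
      (fun j => Pi.single j (π j)) ∧
    η = castDegree (operator_degree hia hmod)
      (wedge (lefschetzPow (extDerivField α x) (π i) ((a - i - 2) / 2)) (α x))

variable {ξ : ContactStructure n M} {θ θ' : FormField (2 * n + 1) M a} {x : M}
  {η η' : TangentSpace (𝓡 (2 * n + 1)) x [⋀^Fin (a - 1)]→L[ℝ] ℝ}

theorem IsLefschetzDecompositionOn.isOperatorValue {U : Set M} {α : FormField (2 * n + 1) M 1}
    (hα : IsDefiningFormOn ξ.plane U α) {π : (j : ℕ) → FormField (2 * n + 1) M j}
    (h : IsLefschetzDecompositionOn ξ U α θ π) (hx : x ∈ U) :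
    IsOperatorValue hia hmod ξ θ x (castDegree (operator_degree hia hmod)
      (wedge (lefschetzPow (extDerivField α x) (π i x) ((a - i - 2) / 2)) (α x))) :=
  ⟨U, α, fun j => π j x, hα, hx, h.isDecomposition hα hx, rfl⟩

theorem IsOperatorValue.unique (hin : i + a ≤ 2 * n) (h : IsOperatorValue hia hmod ξ θ x η)
    (h' : IsOperatorValue hia hmod ξ θ x η') : η = η' := by
  obtain ⟨U, α, π, hα, hx, hπ, rfl⟩ := h
  obtain ⟨U', α', π', hα', hx', hπ', rfl⟩ := h'
  rw [hα'.operator_eq hα hx' hx hπ' hπ (mem_lefschetzIndices.2 ⟨by omega, hin, hmod⟩) hia]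

theorem exists_isOperatorValue (hin : i + a ≤ 2 * n) (ξ : ContactStructure n M)
    (θ : FormField (2 * n + 1) M a) (x : M) : ∃ η, IsOperatorValue hia hmod ξ θ x η := by
  obtain ⟨U, α, hx, hα, -⟩ := ξ.exists_contactForm x
  obtain ⟨π, hπ, -⟩ := (hα.isContactPair hx).exists_horizontal (finrank_tangentSpace x)
    (by omega) (θ x)
  exact ⟨_, U, α, π, hα, hx, hπ, rfl⟩

/-- Lets a value be recomputed with a prescribed defining form, so that two values can be added
using the same one. -/
theorem IsOperatorValue.exists_of_isDefiningFormOn (hin : i + a ≤ 2 * n)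
    (h : IsOperatorValue hia hmod ξ θ x η)
    {U : Set M} {α : FormField (2 * n + 1) M 1} (hα : IsDefiningFormOn ξ.plane U α)
    (hx : x ∈ U) :
    ∃ π : (j : ℕ) → TangentSpace (𝓡 (2 * n + 1)) x [⋀^Fin j]→L[ℝ] ℝ,
    IsDecomposition n (α x) (extDerivField α x) a (Pi.single a (θ x))
      (fun j => Pi.single j (π j)) ∧
    η = castDegree (operator_degree hia hmod)
      (wedge (lefschetzPow (extDerivField α x) (π i) ((a - i - 2) / 2)) (α x)) := by
  obtain ⟨π, hπ, -⟩ := (hα.isContactPair hx).exists_horizontal (finrank_tangentSpace x)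
    (by omega : a ≤ 2 * n) (θ x)
  exact ⟨π, hπ, h.unique hia hmod hin ⟨U, α, π, hα, hx, hπ, rfl⟩⟩

theorem IsOperatorValue.add (hin : i + a ≤ 2 * n) (h : IsOperatorValue hia hmod ξ θ x η)
    (h' : IsOperatorValue hia hmod ξ θ' x η') :
    IsOperatorValue hia hmod ξ (θ + θ') x (η + η') := by
  obtain ⟨U, α, π, hα, hx, hπ, rfl⟩ := h
  obtain ⟨π', hπ', rfl⟩ := h'.exists_of_isDefiningFormOn hia hmod hin hα hx
  refine ⟨U, α, fun j => π j + π' j, hα, hx, hπ.add hπ', ?_⟩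
  rw [lefschetzPow_add, wedge_add_left, castDegree_add]

theorem IsOperatorValue.smul (h : IsOperatorValue hia hmod ξ θ x η) (c : ℝ) :
    IsOperatorValue hia hmod ξ (c • θ) x (c • η) := by
  obtain ⟨U, α, π, hα, hx, hπ, rfl⟩ := h
  refine ⟨U, α, fun j => c • π j, hα, hx, hπ.smul c, ?_⟩
  rw [lefschetzPow_smul, wedge_smul_left, castDegree_smul]

/-- Near each point the values agree, by uniqueness, with the formula for one smooth decomposition.
-/
theorem isSmoothFormOn_of_isOperatorValue (hin : i + a ≤ 2 * n)
    (hθ : IsSmoothFormOn Set.univ θ)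
    {ψ : FormField (2 * n + 1) M (a - 1)} (h : ∀ x, IsOperatorValue hia hmod ξ θ x (ψ x)) :
    IsSmoothFormOn Set.univ ψ := by
  refine isSmoothFormOn_of_smoothFormAt fun x _ => ?_
  obtain ⟨U, α, hx, hα, -⟩ := ξ.exists_contactForm x
  obtain ⟨π, hπ⟩ := hα.exists_isLefschetzDecompositionOn (by omega : a ≤ 2 * n) (θ := θ)
    (isSmoothFormOn_of_smoothFormAt fun z _ =>
      hθ.smoothFormAt isOpen_univ (Set.mem_univ z))
  have hπi := (hπ.smooth i (mem_lefschetzIndices.2 ⟨by omega, hin, hmod⟩)).smoothFormAt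
    hα.isOpen hx
  refine SmoothFormAt.congr ((((hα.smoothFormAt_extDerivField hx).lefschetzPow hπi
    ((a - i - 2) / 2)).wedge (hα.smoothFormAt hx)).castDegree (operator_degree hia hmod)) ?_
  filter_upwards [hα.isOpen.eventually_mem hx] with z hz
  exact (h z).unique hia hmod hin (hπ.isOperatorValue hia hmod hα hz)

/-- The contact operator on smooth forms. -/
theorem exists_operator (hin : i + a ≤ 2 * n) (ξ : ContactStructure n M) :
    ∃ P : DifferentialForm (2 * n + 1) M a →ₗ[ℝ] DifferentialForm (2 * n + 1) M (a - 1),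
      ∀ (θ : DifferentialForm (2 * n + 1) M a) (x : M),
        IsOperatorValue hia hmod ξ (θ : FormField (2 * n + 1) M a) x
          ((P θ : FormField (2 * n + 1) M (a - 1)) x) := by
  -- The choices are arbitrary at every point; additivity and homogeneity hold because sums and
  -- multiples of values are values, and values are unique.
  choose F hF using fun (θ : FormField (2 * n + 1) M a) (x : M) =>
    exists_isOperatorValue hia hmod hin ξ θ x
  refine ⟨{
    toFun := fun θ => ⟨F θ, isSmoothFormOn_of_isOperatorValue hia hmod hin θ.2 (hF θ)⟩
    map_add' := fun θ θ' => Subtype.ext (funext fun x => ?_)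
    map_smul' := fun c θ => Subtype.ext (funext fun x => ?_) }, fun θ x => hF θ x⟩
  · exact (hF _ x).unique hia hmod hin ((hF θ x).add hia hmod hin (hF θ' x))
  · exact (hF _ x).unique hia hmod hin ((hF θ x).smul hia hmod c)

end Operator

/-! ### Compatibility with local contactomorphisms -/

section Naturality

variable {n a i : ℕ} {M : Type*} [TopologicalSpace M]
  [ChartedSpace (EuclideanSpace ℝ (Fin (2 * n + 1))) M] [IsManifold (𝓡 (2 * n + 1)) ∞ M]
  {M' : Type*} [TopologicalSpace M']
  [ChartedSpace (EuclideanSpace ℝ (Fin (2 * n + 1))) M'] [IsManifold (𝓡 (2 * n + 1)) ∞ M']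
  {ξ : ContactStructure n M} {ξ' : ContactStructure n M'} {φ : M → M'}

theorem IsLocalContactomorphism.mem_plane_iff (hφ : IsLocalContactomorphism ξ ξ' φ) (x : M)
    (v : TangentSpace (𝓡 (2 * n + 1)) x) :
    mfderiv (𝓡 (2 * n + 1)) (𝓡 (2 * n + 1)) φ x v ∈ ξ'.plane (φ x) ↔ v ∈ ξ.plane x := by
  have hinj : Function.Injective (mfderiv (𝓡 (2 * n + 1)) (𝓡 (2 * n + 1)) φ x) := by
    have h := (hφ.isLocalDiffeomorph x).mfderivToContinuousLinearEquiv_coe (by simp)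
    rw [← h]
    exact ContinuousLinearEquiv.injective _
  rw [← hφ.map_plane x]
  exact Function.Injective.mem_set_image (s := (ξ.plane x : Set _)) hinj

theorem IsLocalContactomorphism.isDefiningFormOn (hφ : IsLocalContactomorphism ξ ξ' φ)
    {U : Set M'} {α : FormField (2 * n + 1) M' 1} (hα : IsDefiningFormOn ξ'.plane U α) :
    IsDefiningFormOn ξ.plane (φ ⁻¹' U) (pullbackField φ α) where
  isOpen := hα.isOpen.preimage hφ.isLocalDiffeomorph.contMDiff.continuous
  smooth := isSmoothFormOn_of_smoothFormAt fun _ hx =>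
    SmoothFormAt.pullbackField (Filter.Eventually.of_forall fun z =>
      hφ.isLocalDiffeomorph.contMDiff z) (hα.smoothFormAt hx)
  mem_iff _ hx v := (hφ.mem_plane_iff _ v).symm.trans (hα.mem_iff _ hx _)

/-- All the data are transported: φ^*α is a defining form, d commutes with φ^*, and products and
decompositions pull back along the linear map dφ. -/
theorem IsOperatorValue.pullback (hia : i + 2 ≤ a) (hmod : i % 2 = a % 2)
    (hφ : IsLocalContactomorphism ξ ξ' φ) {θ : FormField (2 * n + 1) M' a} {x : M}
    {η : TangentSpace (𝓡 (2 * n + 1)) (φ x) [⋀^Fin (a - 1)]→L[ℝ] ℝ}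
    (h : IsOperatorValue hia hmod ξ' θ (φ x) η) :
    IsOperatorValue hia hmod ξ (pullbackField φ θ) x
      (η.compContinuousLinearMap (mfderiv (𝓡 (2 * n + 1)) (𝓡 (2 * n + 1)) φ x)) := by
  obtain ⟨U, α, π, hα, hx, hπ, rfl⟩ := h
  have hd := pullbackField_extDerivField (φ := φ) (x := x) (Filter.Eventually.of_forall fun z =>
    hφ.isLocalDiffeomorph.contMDiff z) (hα.smoothFormAt hx)
  refine ⟨φ ⁻¹' U, pullbackField φ α, fun j => (π j).compContinuousLinearMap
    (mfderiv (𝓡 (2 * n + 1)) (𝓡 (2 * n + 1)) φ x), hφ.isDefiningFormOn hα, hx, ?_, ?_⟩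
  · rw [← hd]
    exact hπ.compContinuousLinearMap _
  · rw [← hd, castDegree_compContinuousLinearMap]
    refine congrArg (castDegree _) ((wedge_compContinuousLinearMap _ _ _).trans ?_)
    rw [lefschetzPow_compContinuousLinearMap]
    rfl

end Naturality

end ContactForms

end

/-! ### The natural contact morphism and its uniqueness -/

theorem mainTheorem5 (n a i : ℕ) (hia : i + 2 ≤ a) (hin : i + a ≤ 2 * n)
    (hmod : i % 2 = a % 2) :
    (∀ (M : Type u) [TopologicalSpace M]
      [ChartedSpace (EuclideanSpace ℝ (Fin (2 * n + 1))) M] [IsManifold (𝓡 (2 * n + 1)) ∞ M]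
      (ξ : ContactStructure n M) (U : Set M) (α : FormField (2 * n + 1) M 1),
      IsDefiningFormOn ξ.plane U α → ∀ θ : DifferentialForm (2 * n + 1) M a,
        ∃ π : (j : ℕ) → FormField (2 * n + 1) M j,
          IsLefschetzDecompositionOn ξ U α (θ : FormField (2 * n + 1) M a) π) ∧
    ∃! P : NaturalContactMorphism.{u} n a (a - 1),
      ∀ (M : Type u) [TopologicalSpace M]
        [ChartedSpace (EuclideanSpace ℝ (Fin (2 * n + 1))) M] [IsManifold (𝓡 (2 * n + 1)) ∞ M]
        (ξ : ContactStructure n M) (U : Set M) (α : FormField (2 * n + 1) M 1),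
        IsDefiningFormOn ξ.plane U α → ∀ (θ : DifferentialForm (2 * n + 1) M a)
          (π : (j : ℕ) → FormField (2 * n + 1) M j),
          IsLefschetzDecompositionOn ξ U α (θ : FormField (2 * n + 1) M a) π →
            ∀ x ∈ U, (P.app M ξ θ : FormField (2 * n + 1) M (a - 1)) x =
              castDegree (operator_degree hia hmod)
                (wedge (lefschetzPow (extDerivField α x) (π i x) ((a - i - 2) / 2)) (α x)) := by
  refine ⟨fun M _ _ _ ξ U α hα θ => ?_, ?_⟩
  · exact hα.exists_isLefschetzDecompositionOn (by omega) (isSmoothFormOn_of_smoothFormAt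
      fun x _ => θ.2.smoothFormAt isOpen_univ (Set.mem_univ x))
  · choose P hP using fun (M : Type u) [TopologicalSpace M]
      [ChartedSpace (EuclideanSpace ℝ (Fin (2 * n + 1))) M] [IsManifold (𝓡 (2 * n + 1)) ∞ M]
      (ξ : ContactStructure n M) => exists_operator hia hmod hin ξ
    refine ⟨⟨fun M _ _ _ ξ => P M ξ, fun M M' _ _ _ _ _ _ ξ ξ' φ hφ θ => ?_⟩, ?_, ?_⟩
    · refine Subtype.ext (funext fun x => ?_)
      -- Both sides are operator values at x for the pulled-back form, so they coincide.
      exact (hP M ξ _ x).unique hia hmod hin ((hP M' ξ' θ (φ x)).pullback hia hmod hφ)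
    · intro M _ _ _ ξ U α hα θ π hπ x hx
      exact (hP M ξ θ x).unique hia hmod hin (hπ.isOperatorValue hia hmod hα hx)
    -- Every point has a neighbourhood with a contact form and a decomposition, so the formula
    -- determines the morphism at every point.
    · rintro ⟨P', hP'⟩ h
      congr 1
      funext M _ _ _ ξ
      refine LinearMap.ext fun θ => Subtype.ext (funext fun x => ?_)
      obtain ⟨U, α, hx, hα, -⟩ := ξ.exists_contactForm x
      obtain ⟨π, hπ⟩ := hα.exists_isLefschetzDecompositionOn (by omega : a ≤ 2 * n)
        (isSmoothFormOn_of_smoothFormAt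
          fun x _ => θ.2.smoothFormAt isOpen_univ (Set.mem_univ x))
      exact (h M ξ U α hα θ π hπ x hx).trans
        ((hπ.isOperatorValue hia hmod hα hx).unique hia hmod hin (hP M ξ θ x))
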